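/- \textbf{Setting.} A \emph{projective space} is a set $P$ of points with a family of subsets, called lines, such that: (1) two distinct points $A,B$ lie on a unique line $A\vee B$; (2) if $A,B,C,D$ are distinct and $A\vee B$ meets $C\vee D$, then $A\vee C$ meets $B\vee D$; (3) there are two lines that do not meet; (4) every line has more than two points; (5) if $A,C,B$ are distinct and collinear and $A,C,B,D$ is a harmonic set (defined below), then $D\notin\{A,C,B\}$; (6) three lines, no two of which meet, belong to at most one ruling, where a ruling is the set of all lines that meet each of three given lines, no two of which meet. A flat is a set of points that contains the line through any two of its points; a plane is a flat generated by three non-collinear points. A \emph{quadrangle} $A,C,B,D$ (in dihedral order) consists of four coplanar points, no three collinear; its sides are $A\vee C$, $C\vee B$, $B\vee D$, $D\vee A$, its diagonal lines are $A\vee B$ and $C\vee D$, and its diagonal points are the two intersections of opposite sides. Collinear points $A,C,B,D$ form a \emph{harmonic set} if some quadrangle has diagonal points $A,B$, with $C$ on one of its diagonal lines and $D$ on the other; $D$ is then the harmonic conjugate of $C$ with respect to $A,B$. Dually, concurrent lines $a,c,b,d$ form a \emph{harmonic pencil} if $a,b$ are the two diagonal lines of some quadrangle, $c$ passes through one of its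 diagonal points and $d$ through the other. For distinct points $A,B$ of a line $\ell$, the \emph{harmonic reflection} $\rho_{A,B}:\ell\to\ell$ fixes $A$ and $B$ and sends every other point to its harmonic conjugate with respect to $A,B$. In a plane, for a line $m$ and a point $Q\notin m$, the harmonic reflection $\rho_{Q,m}$ fixes $Q$ and sends $X\ne Q$ to its image under $\rho_{Q,M}$, where $M=(X\vee Q)\wedge m$. For a line $\ell$, let $\mathcal Har(1)=\mathcal Har(\ell)$ be the group of transformations of $\ell$ generated by its harmonic reflections. The \emph{harmonic curve} of a quadrangle $A,C,B,D$ is the set of centers of harmonic pencils $a,c,b,d$ with $A\in a$, $C\in c$, $B\in b$, $D\in d$. The tangent at the vertex $A$ is the line $a$ such that $a,\,A\vee C,\,A\vee B,\,A\vee D$ is a harmonic pencil centered at $A$, and similarly at the other vertices. The \emph{tangent bundle} consists of the lines that carry a harmonic set $A',C',B',D'$ with $A',C',B',D'$ on the tangents at $A,C,B,D$, respectively. The tangent line (polar) of the curve at one of its points $Z$ is the line of the tangent bundle through $Z$. \textbf{Theorem.} Let $\mathcal C$ be a harmonic curve in a plane $\pi$ of a projective space. Through each point of $\mathcal C$ there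 is exactly one tangent line, independent of the quadrangle that generates $\mathcal C$. For distinct $U,V\in\mathcal C$ there is a well-defined hyperbolic reflection $\eta_q=\rho_{Q,q}$ of $\pi$, where $q=U\vee V$ and $Q$ is the pole of $q$, that is, the intersection of the tangent lines at $U$ and $V$. Let $\mathcal Hyp(2)$ be the group of transformations of $\pi$ generated by all these reflections. Then $$\mathcal Hyp(2)\cong\mathcal Har(1),$$ that is, $\mathcal Hyp(2)\cong\mathcal Har(\ell)$ for every line $\ell$. Moreover, let $T\in\mathcal C$ with tangent line $t$, and let $\tau:\mathcal C\to t$ be the tangential map, $\tau(T)=T$ and $\tau(X)=t\wedge x$ for $X\neq T$, where $x$ is the tangent line at $X$. Then $\tau$ is a bijection, $\mathcal Hyp(2)$ leaves $\mathcal C$ invariant, and there is a group isomorphism $\Phi:\mathcal Hyp(2)\to\mathcal Har(t)$ such that $\Phi(g)(\tau(X))=\tau(g(X))$ for all $g\in\mathcal Hyp(2)$ and $X\in\mathcal C$, and $\Phi(\eta_{U\vee V})=\rho_{\tau(U),\tau(V)}$ for all distinct $U,V\in\mathcal C$. -/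

import Mathlib

namespace HarmonicGeometry

/-- A set `P` of points with a distinguished family of subsets, called lines. -/
class PointLineGeometry (P : Type*) where
  /-- `IsLine l` says that the set of points `l` is a line. -/
  IsLine : Set P → Prop

open PointLineGeometry

section Incidence

variable {P : Type*} [PointLineGeometry P]

/-- A flat is a set of points that is closed under taking lines. -/
def IsFlat (F : Set P) : Prop :=
  ∀ A ∈ F, ∀ B ∈ F, A ≠ B → ∀ l : Set P, IsLine l → A ∈ l → B ∈ l → l ⊆ F

/-- The flat generated by a set of points. -/
def flatSpan (S : Set P) : Set P :=
  ⋂₀ {F : Set P | IsFlat F ∧ S ⊆ F}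

/-- `A ∨ B`: for `A ≠ B` in a projective space, the line through `A` and `B`. -/
def join (A B : P) : Set P :=
  flatSpan {A, B}

/-- The points of `S` lie on a common line. -/
def AreCollinear (S : Set P) : Prop :=
  ∃ l : Set P, IsLine l ∧ S ⊆ l

/-- A plane is a flat generated by three points that are not collinear. -/
def IsPlane (E : Set P) : Prop :=
  ∃ A B C : P, ¬ AreCollinear {A, B, C} ∧ E = flatSpan {A, B, C}

/-- The points `A, C, B, D`, in this dihedral order, are the vertices of a quadrangle: they are
coplanar and no three of them are collinear. The sides are `A ∨ C`, `C ∨ B`, `B ∨ D`, `D ∨ A`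
and the diagonal lines are `A ∨ B` and `C ∨ D`. -/
def IsQuadrangle (A C B D : P) : Prop :=
  (∃ E : Set P, IsPlane E ∧ A ∈ E ∧ C ∈ E ∧ B ∈ E ∧ D ∈ E) ∧
    ¬ AreCollinear {A, C, B} ∧ ¬ AreCollinear {C, B, D} ∧
    ¬ AreCollinear {B, D, A} ∧ ¬ AreCollinear {D, A, C}

/-- The collinear points `A, C, B, D`, in this dihedral order, are a harmonic set: some quadrangle
`p, q, r, s` has diagonal points `A` and `B`, its diagonal line `p ∨ r` passes through `C`, and its
diagonal line `q ∨ s` passes through `D`. -/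
def IsHarmonicSet (A C B D : P) : Prop :=
  AreCollinear {A, C, B, D} ∧
    ∃ p q r s : P, IsQuadrangle p q r s ∧
      A ∈ join p q ∩ join r s ∧ B ∈ join q r ∩ join s p ∧
      C ∈ join p r ∧ D ∈ join q s

/-- The lines `a, c, b, d`, in this dihedral order, are a harmonic pencil with center `Z`: they
pass through `Z`, and for some quadrangle `p, q, r, s` the lines `a` and `b` are the diagonal lines
while `c` and `d` pass through the diagonal points. -/
def IsHarmonicPencil (Z : P) (a c b d : Set P) : Prop :=
  (IsLine a ∧ IsLine c ∧ IsLine b ∧ IsLine d) ∧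
    (Z ∈ a ∧ Z ∈ c ∧ Z ∈ b ∧ Z ∈ d) ∧
    ∃ p q r s : P, IsQuadrangle p q r s ∧
      a = join p r ∧ b = join q s ∧
      (c ∩ (join p q ∩ join r s)).Nonempty ∧ (d ∩ (join q r ∩ join s p)).Nonempty

/-- Three lines in general position: no two of them have a common point. -/
def InGeneralPosition (a b c : Set P) : Prop :=
  IsLine a ∧ IsLine b ∧ IsLine c ∧ Disjoint a b ∧ Disjoint b c ∧ Disjoint a c

/-- The set of lines that meet all three of `a`, `b`, `c`. -/
def transversalRuling (a b c : Set P) : Set (Set P) :=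
  {x | IsLine x ∧ (x ∩ a).Nonempty ∧ (x ∩ b).Nonempty ∧ (x ∩ c).Nonempty}

/-- A ruling is the set of transversals to three lines in general position. -/
def IsRuling (R : Set (Set P)) : Prop :=
  ∃ a b c : Set P, InGeneralPosition a b c ∧ R = transversalRuling a b c

end Incidence

/-- A projective space (of dimension at least three), given by points and lines. -/
class ProjectiveSpace (P : Type*) extends PointLineGeometry P where
  /-- Two distinct points lie on a unique line. -/
  existsUnique_line : ∀ A B : P, A ≠ B → ∃! l : Set P, IsLine l ∧ A ∈ l ∧ B ∈ l
  /-- If the lines `A ∨ B` and `C ∨ D` meet, then so do `A ∨ C` and `B ∨ D`. -/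
  veblen : ∀ A B C D : P, A ≠ B → A ≠ C → A ≠ D → B ≠ C → B ≠ D → C ≠ D →
    (join A B ∩ join C D).Nonempty → (join A C ∩ join B D).Nonempty
  /-- There are two lines that do not meet. -/
  exists_disjoint_lines : ∃ l m : Set P, IsLine l ∧ IsLine m ∧ Disjoint l m
  /-- Lines have more than two points. -/
  two_lt_encard : ∀ l : Set P, IsLine l → 2 < l.encard
  /-- The harmonic fourth of three collinear points is none of them. -/
  harmonic_fourth_ne : ∀ A C B D : P, A ≠ C → C ≠ B → A ≠ B → IsHarmonicSet A C B D →
    D ≠ A ∧ D ≠ C ∧ D ≠ B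
  /-- Three lines in general position belong to at most one ruling. (When they span a space of
  dimension three, the other axioms give at least one.) -/
  equipal : ∀ a b c : Set P, InGeneralPosition a b c → ∀ R S : Set (Set P),
    IsRuling R → IsRuling S → a ∈ R → b ∈ R → c ∈ R → a ∈ S → b ∈ S → c ∈ S → R = S

section Harmonic

variable {P : Type*} [ProjectiveSpace P]

/-- For distinct `A`, `B` and a point `X` on the line `A ∨ B`: the harmonic reflection with respect
to `A` and `B` sends `X` to `Y`. It fixes `A` and `B` and takes any other point of the line to its
harmonic conjugate. -/
def ReflectsTo (A B X Y : P) : Prop :=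
  (X = A ∧ Y = A) ∨ (X = B ∧ Y = B) ∨ (X ≠ A ∧ X ≠ B ∧ IsHarmonicSet A X B Y)

/-- `f` is the harmonic reflection of the line `l` with respect to its distinct points
`A` and `B`. -/
def IsLineReflection (l : Set P) (A B : P) (f : Equiv.Perm l) : Prop :=
  A ∈ l ∧ B ∈ l ∧ A ≠ B ∧ ∀ X : l, ReflectsTo A B (X : P) (f X : P)

/-- `f` is the harmonic reflection of the plane `E` with center `C` and mirror `m`, a line of `E`
not through `C`: it fixes `C`, and on the line joining `C` to a point `M` of `m` it is the harmonic
reflection with respect to `C` and `M`. -/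
def IsPlaneReflection (E : Set P) (C : P) (m : Set P) (f : Equiv.Perm E) : Prop :=
  C ∈ E ∧ IsLine m ∧ m ⊆ E ∧ C ∉ m ∧
    ∀ X : E, ((X : P) = C → (f X : P) = C) ∧
      ((X : P) ≠ C → ∃ M ∈ join (X : P) C ∩ m, ReflectsTo C M (X : P) (f X : P))

/-- `Har(1)`: the group of transformations of the projective line `l` generated by its
harmonic reflections. -/
def harmonicGroup (l : Set P) : Subgroup (Equiv.Perm l) :=
  Subgroup.closure {f | ∃ A B : P, IsLineReflection l A B f}

/-- The harmonic curve of the quadrangle `A, C, B, D`: the centers of the harmonic pencils that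
are transversal to it. -/
def harmonicCurve (A C B D : P) : Set P :=
  {Z | ∃ a c b d : Set P, IsHarmonicPencil Z a c b d ∧ A ∈ a ∧ C ∈ c ∧ B ∈ b ∧ D ∈ d}

/-- The harmonic bundle of the quadrilateral with sides `a, c, b, d`: the lines that support a
harmonic set transversal to its sides. -/
def harmonicBundle (a c b d : Set P) : Set (Set P) :=
  {z | IsLine z ∧ ∃ A C B D : P, IsHarmonicSet A C B D ∧
    (A ∈ z ∧ C ∈ z ∧ B ∈ z ∧ D ∈ z) ∧ A ∈ a ∧ C ∈ c ∧ B ∈ b ∧ D ∈ d}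

/-- `a` is the tangent line at the vertex `A` of the quadrangle `A, C, B, D`: the harmonic conjugate
of the diagonal at `A` with respect to the sides at `A`. -/
def IsVertexTangent (A C B D : P) (a : Set P) : Prop :=
  IsHarmonicPencil A a (join A C) (join A B) (join A D)

/-- The tangent bundle of the quadrangle `A, C, B, D`: the harmonic bundle of the quadrilateral
formed by the tangent lines at its vertices. -/
def tangentBundle (A C B D : P) : Set (Set P) :=
  {z | ∃ a c b d : Set P, IsVertexTangent A C B D a ∧ IsVertexTangent C B D A c ∧
    IsVertexTangent B D A C b ∧ IsVertexTangent D A C B d ∧ z ∈ harmonicBundle a c b d}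

/-- `K` is a harmonic curve in the plane `E`. -/
def IsHarmonicCurve (E K : Set P) : Prop :=
  IsPlane E ∧ ∃ A C B D : P, (A ∈ E ∧ C ∈ E ∧ B ∈ E ∧ D ∈ E) ∧
    IsQuadrangle A C B D ∧ K = harmonicCurve A C B D

/-- `z` is the tangent line to the harmonic curve `K` at its point `Z`: the line through `Z` in the
tangent bundle of a quadrangle that generates `K`. -/
def IsTangentLine (K : Set P) (Z : P) (z : Set P) : Prop :=
  Z ∈ K ∧ Z ∈ z ∧ ∃ A C B D : P, IsQuadrangle A C B D ∧ K = harmonicCurve A C B D ∧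
    z ∈ tangentBundle A C B D

/-- `Q` is the pole of the secant line `U ∨ V`, where `U` and `V` are distinct points of `K`: the
point where the polar lines of `U` and `V`, that is, the tangent lines at `U` and `V`, meet. -/
def IsSecantPole (K : Set P) (U V Q : P) : Prop :=
  U ≠ V ∧ ∃ u v : Set P, IsTangentLine K U u ∧ IsTangentLine K V v ∧ Q ∈ u ∩ v

/-- `f` is the hyperbolic reflection on the secant line `U ∨ V` of the harmonic curve `K` in
the plane `E`: the harmonic reflection with this line as mirror and its pole as center. -/
def IsHyperbolicReflection (E K : Set P) (U V : P) (f : Equiv.Perm E) : Prop :=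
  ∃ Q : P, IsSecantPole K U V Q ∧ IsPlaneReflection E Q (join U V) f

/-- `Hyp(2)`: the group of transformations of the plane `E` generated by the hyperbolic reflections
on the secant lines of the harmonic curve `K`. -/
def hyperbolicGroup (E K : Set P) : Subgroup (Equiv.Perm E) :=
  Subgroup.closure {f | ∃ U ∈ K, ∃ V ∈ K, U ≠ V ∧ IsHyperbolicReflection E K U V f}

/-- `τ` is the tangential map from `K` to its tangent line `t` at `T`: it fixes `T`, and it sends
any other point `X` to the intersection of `t` with the tangent line at `X`. -/
def IsTangentialMap (K : Set P) (T : P) (t : Set P) (τ : K → t) : Prop :=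
  ∀ X : K, ((X : P) = T → (τ X : P) = T) ∧
    ((X : P) ≠ T → ∃ x : Set P, IsTangentLine K (X : P) x ∧ (τ X : P) ∈ t ∩ x)

end Harmonic

end HarmonicGeometry

open HarmonicGeometry

/-! ### Incidence geometry: flats, cones and planes. -/

namespace HarmonicGeometry

open PointLineGeometry

section IncidenceTheory

variable {P : Type*} [ProjectiveSpace P]

/-! The axioms make every plane a projective plane over a field of characteristic other than two,
and over such a field the theorem is a computation with a parametrized conic.

Coordinates. Some point `o` lies outside the plane `E`. In the solid spanned by `o` and `E`, take
`E` as the plane at infinity; the remaining points form an affine space in which the theorem of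
Desargues holds, because one can leave any plane. Hence dilatations exist in abundance
(`exists_dilatation`), the translations form an abelian group, and its direction-preserving
endomorphisms form a division ring. The harmonic axiom gives `2 ≠ 0` (`scalars_two_ne_zero`), and
the axiom on rulings gives commutativity (`scalars_mul_comm`). Points of `E` are directions of
vectors, so `E` receives homogeneous coordinates (`exists_planeChart`).

The curve. In coordinates adapted to the quadrangle, the harmonic curve is the conic of the points
`(s², st, t²)` and the tangent bundle is the set of its tangent lines. A line that meets the conic
in one point only is a tangent (`eq_tangent_of_forall`); this description does not mention the
quadrangle, so the tangent at a point depends on the curve alone (`exists_conicChart`).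

The isomorphism. The intersection of the tangents at the parameters `u` and `v` is bilinear in `u`
and `v`. With `u` fixed, it is therefore a projective coordinate on the tangent at `u`, and in these
coordinates the tangential map is the identity on parameters. The hyperbolic reflection on the
secant of `u` and `v` sends the parameter `α u + β v` to `α u - β v` (`homology_conic`), which is
also the formula for the harmonic reflection of a line. Thus the tangential map carries generators
to generators. Nothing is lost by restricting to the curve, since a linear map that fixes every
point of the conic is a scalar (`eq_one_of_fixes`). Finally, the harmonic groups of any two lines
are isomorphic: intersecting lines are coordinatized over one field, and skew lines are compared
through a line that meets both. -/

theorem line_unique {l m : Set P} {A B : P} (hl : IsLine l) (hm : IsLine m) (hAB : A ≠ B)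
    (hAl : A ∈ l) (hBl : B ∈ l) (hAm : A ∈ m) (hBm : B ∈ m) : l = m :=
  (ProjectiveSpace.existsUnique_line A B hAB).unique ⟨hl, hAl, hBl⟩ ⟨hm, hAm, hBm⟩

theorem isFlat_of_isLine {l : Set P} (hl : IsLine l) : IsFlat l := by
  intro A hA B hB hAB m hm hAm hBm
  exact (line_unique hm hl hAB hAm hBm hA hB).le

theorem subset_flatSpan (S : Set P) : S ⊆ flatSpan S :=
  fun _ hx _ hF => hF.2 hx

theorem flatSpan_subset {S F : Set P} (hF : IsFlat F) (h : S ⊆ F) : flatSpan S ⊆ F :=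
  fun _ hx => hx F ⟨hF, h⟩

theorem isFlat_flatSpan (S : Set P) : IsFlat (flatSpan S) := by
  intro A hA B hB hAB l hl hAl hBl X hX F hF
  exact hF.1 A (hA F hF) B (hB F hF) hAB l hl hAl hBl hX

theorem join_eq {l : Set P} {A B : P} (hl : IsLine l) (hAB : A ≠ B) (hA : A ∈ l) (hB : B ∈ l) :
    join A B = l := by
  apply Set.Subset.antisymm
  · exact flatSpan_subset (isFlat_of_isLine hl) (by rintro x (rfl | rfl) <;> assumption)
  · exact isFlat_flatSpan _ A (subset_flatSpan _ (by simp)) B (subset_flatSpan _ (by simp)) hAB l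
      hl hA hB

theorem left_mem_join (A B : P) : A ∈ join A B := subset_flatSpan _ (by simp)

theorem right_mem_join (A B : P) : B ∈ join A B := subset_flatSpan _ (by simp)

theorem isLine_join {A B : P} (hAB : A ≠ B) : IsLine (join A B) := by
  obtain ⟨l, ⟨hl, hA, hB⟩, -⟩ := ProjectiveSpace.existsUnique_line A B hAB
  rwa [join_eq hl hAB hA hB]

theorem join_comm (A B : P) : join A B = join B A := by
  unfold join; rw [Set.pair_comm]

theorem join_subset {A B : P} {F : Set P} (hF : IsFlat F) (hA : A ∈ F) (hB : B ∈ F) :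
    join A B ⊆ F :=
  flatSpan_subset hF (by rintro x (rfl | rfl) <;> assumption)

/-- Two lines that meet a pair of intersecting lines in distinct points have a common point. -/
theorem lines_meet {l m n k : Set P} {X Y X' Y' : P} (hl : IsLine l) (hm : IsLine m)
    (hn : IsLine n) (hk : IsLine k) (hnk : (n ∩ k).Nonempty) (hXn : X ∈ n) (hXn' : X' ∈ n)
    (hYk : Y ∈ k) (hYk' : Y' ∈ k) (hXl : X ∈ l) (hYl : Y ∈ l) (hXm : X' ∈ m) (hYm : Y' ∈ m)
    (hXY : X ≠ Y) (hXY' : X' ≠ Y') : (l ∩ m).Nonempty := by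
  by_cases h1 : X = X'
  · exact ⟨X, hXl, h1 ▸ hXm⟩
  by_cases h2 : Y = Y'
  · exact ⟨Y, hYl, h2 ▸ hYm⟩
  by_cases h3 : X = Y'
  · exact ⟨X, hXl, h3 ▸ hYm⟩
  by_cases h4 : X' = Y
  · exact ⟨Y, hYl, h4 ▸ hXm⟩
  have := ProjectiveSpace.veblen X X' Y Y' h1 hXY h3 h4 hXY' h2
    (by rwa [join_eq hn h1 hXn hXn', join_eq hk h2 hYk hYk'])
  rwa [join_eq hl hXY hXl hYl, join_eq hm hXY' hXm hYm] at this

theorem exists_mem_ne {l : Set P} (hl : IsLine l) (A B : P) : ∃ X ∈ l, X ≠ A ∧ X ≠ B := by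
  by_contra! h
  have h1 : l ⊆ {A, B} := fun X hX => by
    by_cases hXA : X = A
    · simp [hXA]
    · simp [h X hX hXA]
  have h2 := (ProjectiveSpace.two_lt_encard l hl).trans_le (Set.encard_le_encard h1)
  exact absurd (Set.encard_insert_le {B} A) (not_le.mpr (by rw [Set.encard_singleton]; exact h2))

theorem exists_line_through (A : P) : ∃ l : Set P, IsLine l ∧ A ∈ l := by
  obtain ⟨l, m, hl, -, -⟩ := ProjectiveSpace.exists_disjoint_lines (P := P)
  obtain ⟨X, -, hXA, -⟩ := exists_mem_ne hl A A
  exact ⟨join A X, isLine_join hXA.symm, left_mem_join _ _⟩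

/-- Covers coinciding points as well, which spares later collinearity arguments a case distinction.
-/
theorem areCollinear_pair (A B : P) : ∃ l : Set P, IsLine l ∧ A ∈ l ∧ B ∈ l := by
  by_cases h : A = B
  · obtain ⟨l, hl, hA⟩ := exists_line_through A
    exact ⟨l, hl, hA, h ▸ hA⟩
  · exact ⟨_, isLine_join h, left_mem_join _ _, right_mem_join _ _⟩

theorem areCollinear_triple {A B C : P} :
    AreCollinear {A, B, C} ↔ ∃ l : Set P, IsLine l ∧ A ∈ l ∧ B ∈ l ∧ C ∈ l := by
  simp [AreCollinear, Set.insert_subset_iff]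

theorem areCollinear_rotate {A B C : P} : AreCollinear {A, B, C} ↔ AreCollinear {B, C, A} := by
  rw [areCollinear_triple, areCollinear_triple]
  tauto

theorem areCollinear_iff_mem_join {A B C : P} (hAB : A ≠ B) :
    AreCollinear {A, B, C} ↔ C ∈ join A B := by
  rw [areCollinear_triple]
  constructor
  · rintro ⟨l, hl, hA, hB, hC⟩
    rwa [join_eq hl hAB hA hB]
  · exact fun h => ⟨_, isLine_join hAB, left_mem_join _ _, right_mem_join _ _, h⟩

theorem ne_of_not_areCollinear {A B C : P} (h : ¬ AreCollinear {A, B, C}) :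
    A ≠ B ∧ A ≠ C ∧ B ≠ C := by
  rw [areCollinear_triple] at h
  refine ⟨?_, ?_, ?_⟩ <;> rintro rfl <;> apply h
  · obtain ⟨l, hl, h1, h2⟩ := areCollinear_pair A C
    exact ⟨l, hl, h1, h1, h2⟩
  · obtain ⟨l, hl, h1, h2⟩ := areCollinear_pair A B
    exact ⟨l, hl, h1, h2, h1⟩
  · obtain ⟨l, hl, h1, h2⟩ := areCollinear_pair A B
    exact ⟨l, hl, h1, h2, h2⟩

/-- The union of the lines that join a point to the points of a set. -/
def cone (O : P) (F : Set P) : Set P :=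
  {X | ∃ Y ∈ F, ∃ l : Set P, IsLine l ∧ O ∈ l ∧ Y ∈ l ∧ X ∈ l}

theorem subset_cone (O : P) (F : Set P) : F ⊆ cone O F := fun X hX => by
  obtain ⟨l, hl, hO, hXl⟩ := areCollinear_pair O X
  exact ⟨X, hX, l, hl, hO, hXl, hXl⟩

theorem apex_mem_cone (O : P) {F : Set P} (hF : F.Nonempty) : O ∈ cone O F := by
  obtain ⟨X, hX⟩ := hF
  obtain ⟨l, hl, hO, hXl⟩ := areCollinear_pair O X
  exact ⟨X, hX, l, hl, hO, hXl, hO⟩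

theorem cone_subset {O : P} {F G : Set P} (hG : IsFlat G) (hO : O ∉ F) (hOG : O ∈ G)
    (hFG : F ⊆ G) : cone O F ⊆ G := by
  rintro X ⟨Y, hY, l, hl, hOl, hYl, hX⟩
  exact hG O hOG Y (hFG hY) (fun h => hO (h ▸ hY)) l hl hOl hYl hX

/-- A line of the cone over a flat meets the flat. -/
theorem line_meets_base {O : P} {F l : Set P} (hF : IsFlat F) (hO : O ∉ F) (hl : IsLine l)
    (h : l ⊆ cone O F) : (l ∩ F).Nonempty := by
  obtain ⟨X, hX, -⟩ := exists_mem_ne hl O O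
  obtain ⟨X', hX', hne, -⟩ := exists_mem_ne hl X X
  obtain ⟨Y, hY, n, hn, hOn, hYn, hXn⟩ := h hX
  obtain ⟨Y', hY', k, hk, hOk, hYk, hXk⟩ := h hX'
  by_cases hYY : Y = Y'
  · subst hYY
    have : n = k := line_unique hn hk (fun e : O = Y => hO (e ▸ hY)) hOn hYn hOk hYk
    subst this
    have : l = n := line_unique hl hn hne hX' hX hXk hXn
    exact ⟨Y, this ▸ hYn, hY⟩
  · obtain ⟨W, hW, hW'⟩ := lines_meet hl (isLine_join hYY) hn hk ⟨O, hOn, hOk⟩ hXn hYn hXk hYk hX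
      hX' (left_mem_join _ _) (right_mem_join _ _) hne.symm hYY
    exact ⟨W, hW, join_subset hF hY hY' hW'⟩

/-- If `X₁`, `X₂` lie over `Y₁`, `Y₂`, the line `X₁ X₂` meets `Y₁ Y₂` by Veblen's axiom. A second
use of the axiom shows that the line from `O` to a further point `X` meets `Y₁ Y₂` too, hence meets
`F`. -/
theorem isFlat_cone {O : P} {F : Set P} (hF : IsFlat F) (hO : O ∉ F) : IsFlat (cone O F) := by
  rintro X₁ ⟨Y₁, hY₁, n, hn, hOn, hYn, hXn⟩ X₂ ⟨Y₂, hY₂, k, hk, hOk, hYk, hXk⟩ hne l hl h1 h2 X hX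
  by_cases hYY : Y₁ = Y₂
  · subst hYY
    have : n = k := line_unique hn hk (fun e : O = Y₁ => hO (e ▸ hY₁)) hOn hYn hOk hYk
    subst this
    have : l = n := line_unique hl hn hne h1 h2 hXn hXk
    exact ⟨Y₁, hY₁, n, hn, hOn, hYn, this ▸ hX⟩
  by_cases hXO : X = O
  · exact ⟨Y₁, hY₁, n, hn, hOn, hYn, hXO ▸ hOn⟩
  by_cases hOl : O ∈ l
  · by_cases hX1 : X₁ = O
    · have : l = k := line_unique hl hk (fun e : X₂ = O => hne (hX1.trans e.symm)) h2 hOl hXk hOk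
      exact ⟨Y₂, hY₂, k, hk, hOk, hYk, this ▸ hX⟩
    · have : l = n := line_unique hl hn hX1 h1 hOl hXn hOn
      exact ⟨Y₁, hY₁, n, hn, hOn, hYn, this ▸ hX⟩
  have hm := isLine_join hYY
  obtain ⟨W, hW, hWm⟩ := lines_meet hl hm hn hk ⟨O, hOn, hOk⟩ hXn hYn hXk hYk h1 h2
    (left_mem_join _ _) (right_mem_join _ _) hne hYY
  have hOX : O ≠ X := fun e => hXO e.symm
  -- Veblen's axiom needs a base point different from `W`; at least one of `Y₁`, `Y₂` is.
  have key : (join O X ∩ join Y₁ Y₂).Nonempty := by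
    by_cases hW1 : Y₁ = W
    · have hW2 : Y₂ ≠ W := fun e => hYY (hW1.trans e.symm)
      exact lines_meet (isLine_join hOX) hm hk hl ⟨X₂, hXk, h2⟩ hOk hYk hX hW (left_mem_join _ _)
        (right_mem_join _ _) (right_mem_join _ _) hWm hOX hW2
    · exact lines_meet (isLine_join hOX) hm hn hl ⟨X₁, hXn, h1⟩ hOn hYn hX hW (left_mem_join _ _)
        (right_mem_join _ _) (left_mem_join _ _) hWm hOX hW1
  obtain ⟨Y, hYj, hYF⟩ := key
  exact ⟨Y, join_subset hF hY₁ hY₂ hYF, _, isLine_join hOX, left_mem_join _ _, hYj,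
    right_mem_join _ _⟩

/-- The exchange property: the line that puts `X` over a point of the base also puts `O` in the cone
with apex `X`. -/
theorem cone_exchange {O X : P} {F : Set P} (hF : IsFlat F) (hO : O ∉ F)
    (hX : X ∈ cone O F) (hXF : X ∉ F) : cone O F = cone X F := by
  apply Set.Subset.antisymm
  · refine cone_subset (isFlat_cone hF hXF) hO ?_ (subset_cone _ _)
    obtain ⟨Y, hY, l, hl, hOl, hYl, hXl⟩ := hX
    exact ⟨Y, hY, l, hl, hXl, hYl, hOl⟩
  · exact cone_subset (isFlat_cone hF hO) hXF hX (subset_cone _ _)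

theorem nonempty_of_isLine {l : Set P} (hl : IsLine l) : l.Nonempty := by
  obtain ⟨l', m, hl', -, -⟩ := ProjectiveSpace.exists_disjoint_lines (P := P)
  have h := ProjectiveSpace.two_lt_encard l hl
  rw [← Set.encard_pos]
  exact lt_trans (by norm_num) h

theorem flatSpan_triple {A B C : P} (h : ¬ AreCollinear {A, B, C}) :
    flatSpan {A, B, C} = cone A (join B C) ∧ A ∉ join B C := by
  have hne := ne_of_not_areCollinear h
  have hA : A ∉ join B C := fun hA => h <| areCollinear_triple.mpr
    ⟨_, isLine_join hne.2.2, hA, left_mem_join _ _, right_mem_join _ _⟩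
  have hfl := isFlat_of_isLine (isLine_join hne.2.2)
  refine ⟨Set.Subset.antisymm ?_ ?_, hA⟩
  · refine flatSpan_subset (isFlat_cone hfl hA) ?_
    rintro X (rfl | rfl | rfl)
    · exact apex_mem_cone _ ⟨_, left_mem_join _ _⟩
    · exact subset_cone _ _ (left_mem_join _ _)
    · exact subset_cone _ _ (right_mem_join _ _)
  · exact cone_subset (isFlat_flatSpan _) hA (subset_flatSpan _ (by simp))
      (join_subset (isFlat_flatSpan _) (subset_flatSpan _ (by simp)) (subset_flatSpan _ (by simp)))

theorem isPlane_cone {X : P} {l : Set P} (hl : IsLine l) (hX : X ∉ l) : IsPlane (cone X l) := by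
  obtain ⟨Y, hY, -⟩ := exists_mem_ne hl X X
  obtain ⟨Z, hZ, hZY, -⟩ := exists_mem_ne hl Y Y
  have hj := join_eq hl hZY.symm hY hZ
  have h : ¬ AreCollinear {X, Y, Z} := by
    rw [areCollinear_triple]
    rintro ⟨m, hm, h1, h2, h3⟩
    exact hX ((line_unique hm hl hZY.symm h2 h3 hY hZ) ▸ h1)
  exact ⟨X, Y, Z, h, by rw [(flatSpan_triple h).1, hj]⟩

theorem IsPlane.isFlat {E : Set P} (hE : IsPlane E) : IsFlat E := by
  obtain ⟨A, B, C, -, rfl⟩ := hE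
  exact isFlat_flatSpan _

/-- A plane is generated by any of its lines and any of its points off that line. -/
theorem IsPlane.eq_cone {E l : Set P} {X : P} (hE : IsPlane E) (hl : IsLine l) (hlE : l ⊆ E)
    (hX : X ∈ E) (hXl : X ∉ l) : E = cone X l := by
  obtain ⟨A, B, C, hABC, rfl⟩ := hE
  obtain ⟨hcone, hA⟩ := flatSpan_triple hABC
  have hk := isLine_join (ne_of_not_areCollinear hABC).2.2
  rw [hcone] at hlE hX ⊢
  set k := join B C
  by_cases hlk : l = k
  · subst hlk
    exact cone_exchange (isFlat_of_isLine hl) hA hX hXl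
  obtain ⟨W, hWl, hWk⟩ := line_meets_base (isFlat_of_isLine hk) hA hl hlE
  obtain ⟨Y, hYl, hYW, -⟩ := exists_mem_ne hl W W
  obtain ⟨Z, hZk, hZW, -⟩ := exists_mem_ne hk W W
  have hYk : Y ∉ k := fun h => hlk (line_unique hl hk hYW hYl hWl h hWk)
  have hZl : Z ∉ l := fun h => hlk (line_unique hl hk hZW h hWl hZk hWk)
  -- Three exchanges: move the apex to a point `Y` of `l`, swap the roles of the intersecting lines
  -- `k` and `l`, then move the apex to `X`.
  have h1 : cone A k = cone Y k :=
    cone_exchange (isFlat_of_isLine hk) hA (hlE hYl) hYk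
  have h2 : cone Y k = cone Z l := by
    apply Set.Subset.antisymm
    · refine cone_subset (isFlat_cone (isFlat_of_isLine hl) hZl) hYk (subset_cone _ _ hYl) ?_
      exact isFlat_cone (isFlat_of_isLine hl) hZl Z (apex_mem_cone _ (nonempty_of_isLine hl)) W
        (subset_cone _ _ hWl) hZW k hk hZk hWk
    · refine cone_subset (isFlat_cone (isFlat_of_isLine hk) hYk) hZl (subset_cone _ _ hZk) ?_
      exact isFlat_cone (isFlat_of_isLine hk) hYk Y (apex_mem_cone _ (nonempty_of_isLine hk)) W
        (subset_cone _ _ hWk) hYW l hl hYl hWl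
  have h3 : cone Z l = cone X l :=
    cone_exchange (isFlat_of_isLine hl) hZl (h2 ▸ h1 ▸ hX) hXl
  rw [h1, h2, h3]

theorem IsPlane.lines_meet {E l m : Set P} (hE : IsPlane E) (hl : IsLine l) (hm : IsLine m)
    (hlE : l ⊆ E) (hmE : m ⊆ E) : (l ∩ m).Nonempty := by
  by_cases h : l ⊆ m
  · obtain ⟨X, hX⟩ := nonempty_of_isLine hl
    exact ⟨X, hX, h hX⟩
  · obtain ⟨X, hX, hXm⟩ := Set.not_subset.mp h
    have := hE.eq_cone hm hmE (hlE hX) hXm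
    exact line_meets_base (isFlat_of_isLine hm) hXm hl (this ▸ hlE)

theorem IsPlane.exists_not_mem_line {E l : Set P} (hE : IsPlane E) (hl : IsLine l) :
    ∃ X ∈ E, X ∉ l := by
  by_contra! h
  obtain ⟨A, B, C, hABC, rfl⟩ := hE
  exact hABC ⟨l, hl, fun X hX => h X (subset_flatSpan _ hX)⟩

theorem IsPlane.eq_of_subset {E G : Set P} (hE : IsPlane E) (hG : IsPlane G) (h : E ⊆ G) :
    E = G := by
  obtain ⟨A, B, C, hABC, rfl⟩ := hE
  obtain ⟨hcone, hA⟩ := flatSpan_triple hABC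
  have hk := isLine_join (ne_of_not_areCollinear hABC).2.2
  rw [hcone] at h ⊢
  exact (hG.eq_cone hk ((subset_cone _ _).trans h)
    (h (apex_mem_cone _ (nonempty_of_isLine hk))) hA).symm

theorem IsPlane.eq_of_mem {E G : Set P} {A B C : P} (hE : IsPlane E) (hG : IsPlane G)
    (h : ¬ AreCollinear {A, B, C}) (hA : A ∈ E) (hB : B ∈ E) (hC : C ∈ E) (hA' : A ∈ G)
    (hB' : B ∈ G) (hC' : C ∈ G) : E = G := by
  have h1 : IsPlane (flatSpan {A, B, C}) := ⟨A, B, C, h, rfl⟩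
  have h2 := h1.eq_of_subset hE (flatSpan_subset hE.isFlat (by rintro x (rfl | rfl | rfl) <;> assumption))
  have h3 := h1.eq_of_subset hG (flatSpan_subset hG.isFlat (by rintro x (rfl | rfl | rfl) <;> assumption))
  rw [← h2, h3]

/-- Any two lines of a plane meet, so the two disjoint lines of the axiom cannot both lie in `E`.
This supplies the third dimension needed for Desargues. -/
theorem IsPlane.exists_not_mem {E : Set P} (hE : IsPlane E) : ∃ X : P, X ∉ E := by
  by_contra! h
  obtain ⟨l, m, hl, hm, hlm⟩ := ProjectiveSpace.exists_disjoint_lines (P := P)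
  obtain ⟨X, hX, hX'⟩ := hE.lines_meet hl hm (fun x _ => h x) (fun x _ => h x)
  exact Set.disjoint_left.mp hlm hX hX'

theorem exists_isPlane_of_lines_meet {l m : Set P} (hl : IsLine l) (hm : IsLine m)
    (h : (l ∩ m).Nonempty) (hne : l ≠ m) : ∃ E : Set P, IsPlane E ∧ l ⊆ E ∧ m ⊆ E := by
  obtain ⟨X, hXl, hXm⟩ := h
  obtain ⟨Y, hY, hYX, -⟩ := exists_mem_ne hm X X
  have hYl : Y ∉ l := fun h => hne (line_unique hl hm hYX h hXl hY hXm)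
  refine ⟨cone Y l, isPlane_cone hl hYl, subset_cone _ _, ?_⟩
  exact isFlat_cone (isFlat_of_isLine hl) hYl Y (apex_mem_cone _ (nonempty_of_isLine hl)) X
    (subset_cone _ _ hXl) hYX m hm hY hXm

end IncidenceTheory

end HarmonicGeometry
-- Affine spaces given by directions: Desargues and dilatations.
namespace HarmonicGeometry

/-- An affine space of dimension three, described by the direction `dir a b`, a point of the
projective plane `D` at infinity, of the line joining distinct points `a` and `b`. -/
structure DirectionSpace (A D : Type*) where
  -- The value `dir a a` carries no geometric meaning.
  dir : A → A → D
  IsAxis : Set D → Prop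
  dir_comm : ∀ a b, dir a b = dir b a
  dir_trans : ∀ a b c, a ≠ b → a ≠ c → b ≠ c → dir a b = dir a c → dir b c = dir a b
  exists_dir : ∀ a d, ∃ b, b ≠ a ∧ dir a b = d
  exists_axis : ∀ d e, ∃ L, IsAxis L ∧ d ∈ L ∧ e ∈ L
  axis_unique : ∀ d e L M, d ≠ e → IsAxis L → IsAxis M → d ∈ L → e ∈ L → d ∈ M → e ∈ M → L = M
  exists_not_mem : ∀ L, IsAxis L → ∃ d, d ∉ L
  triangle : ∀ a b c, a ≠ b → a ≠ c → b ≠ c →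
    ∃ L, IsAxis L ∧ dir a b ∈ L ∧ dir a c ∈ L ∧ dir b c ∈ L
  -- Veblen's axiom in affine form: coplanar lines of different directions meet.
  complete : ∀ a b e f L, a ≠ b → IsAxis L → dir a b ∈ L → e ∈ L → f ∈ L → e ≠ f → e ≠ dir a b →
    f ≠ dir a b → ∃ c, c ≠ a ∧ c ≠ b ∧ dir a c = e ∧ dir b c = f

namespace DirectionSpace

variable {A D : Type*} (G : DirectionSpace A D)

theorem dir_mem {a b c : A} {L : Set D} (hab : a ≠ b) (hac : a ≠ c) (hbc : b ≠ c)
    (hL : G.IsAxis L) (h1 : G.dir a b ∈ L) (h2 : G.dir a c ∈ L) : G.dir b c ∈ L := by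
  by_cases h : G.dir a b = G.dir a c
  · rw [G.dir_trans a b c hab hac hbc h]; exact h1
  · obtain ⟨M, hM, m1, m2, m3⟩ := G.triangle a b c hab hac hbc
    rwa [G.axis_unique _ _ L M h hL hM h1 h2 m1 m2]

/-- The pairs `a, x` and `a', x'` have the same direction, or both are degenerate. -/
def Parallel (a x a' x' : A) : Prop :=
  (x = a ∧ x' = a') ∨ (x ≠ a ∧ x' ≠ a' ∧ G.dir a' x' = G.dir a x)

variable {G}

theorem Parallel.symm {a x a' x' : A} (h : G.Parallel a x a' x') : G.Parallel x a x' a' := by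
  rcases h with ⟨rfl, rfl⟩ | ⟨h1, h2, h3⟩
  · exact Or.inl ⟨rfl, rfl⟩
  · exact Or.inr ⟨h1.symm, h2.symm, by rw [G.dir_comm, h3, G.dir_comm]⟩

theorem Parallel.ne {a x a' x' : A} (h : G.Parallel a x a' x') (hne : a ≠ x) : a' ≠ x' := by
  rcases h with ⟨rfl, rfl⟩ | ⟨h1, h2, h3⟩
  · exact absurd rfl hne
  · exact h2.symm

theorem Parallel.dir_eq {a x a' x' : A} (h : G.Parallel a x a' x') (hne : a ≠ x) :
    G.dir a' x' = G.dir a x := by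
  rcases h with ⟨rfl, rfl⟩ | ⟨h1, h2, h3⟩
  · exact absurd rfl hne
  · exact h3

theorem parallel_of_dir_eq {a x a' x' : A} (h : a ≠ x) (h' : a' ≠ x')
    (hd : G.dir a' x' = G.dir a x) : G.Parallel a x a' x' :=
  Or.inr ⟨h.symm, h'.symm, hd⟩

variable (G)

/-- `c` is not on the line through the distinct points `a`, `b`. -/
def Off (a b c : A) : Prop :=
  a ≠ b ∧ a ≠ c ∧ b ≠ c ∧ G.dir a b ≠ G.dir a c

variable {G}

theorem Off.ne_right {a b c : A} (h : G.Off a b c) : G.dir a c ≠ G.dir b c := fun e => by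
  obtain ⟨h1, h2, h3, h4⟩ := h
  have := G.dir_trans c a b h2.symm h3.symm h1 (by rw [G.dir_comm c a, G.dir_comm c b, e])
  exact h4 (by rw [this, G.dir_comm])

theorem Off.ne_left {a b c : A} (h : G.Off a b c) : G.dir a b ≠ G.dir b c := fun e => by
  obtain ⟨h1, h2, h3, h4⟩ := h
  have := G.dir_trans b a c h1.symm h3 h2 (by rw [G.dir_comm b a, e])
  exact h4 (by rw [this, G.dir_comm])

theorem Off.swap {a b c : A} (h : G.Off a b c) : G.Off b a c :=
  ⟨h.1.symm, h.2.2.1, h.2.1, by rw [G.dir_comm b a]; exact h.ne_left⟩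

theorem Off.rot {a b c : A} (h : G.Off a b c) : G.Off b c a :=
  ⟨h.2.2.1, h.1.symm, h.2.1.symm, by rw [G.dir_comm b a]; exact h.ne_left.symm⟩

/-- A triangle can be rebuilt, with the same directions, on any segment parallel to a side. -/
theorem Off.exists_parallel {a b c a' b' : A} (h : G.Off a b c) (hp : G.Parallel a b a' b') :
    ∃ c', G.Parallel a c a' c' ∧ G.Parallel b c b' c' := by
  obtain ⟨L, hL, h1, h2, h3⟩ := G.triangle a b c h.1 h.2.1 h.2.2.1
  have e := hp.dir_eq h.1
  obtain ⟨c', n1, n2, d1, d2⟩ := G.complete a' b' (G.dir a c) (G.dir b c) L (hp.ne h.1) hL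
    (by rwa [e]) h2 h3 h.ne_right (by rw [e]; exact h.2.2.2.symm) (by rw [e]; exact h.ne_left.symm)
  exact ⟨c', parallel_of_dir_eq h.2.1 n1.symm d1, parallel_of_dir_eq h.2.2.1 n2.symm d2⟩

/-- If `x ≠ y`, the line `x y` would have both the direction of `a c` and that of `b c`. -/
theorem Off.unique {a b c a' b' x y : A} (h : G.Off a b c) (h1 : G.Parallel a c a' x)
    (h2 : G.Parallel b c b' x) (h3 : G.Parallel a c a' y) (h4 : G.Parallel b c b' y) : x = y := by
  by_contra hxy
  have e1 := G.dir_trans a' x y (h1.ne h.2.1) (h3.ne h.2.1) hxy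
    (by rw [h1.dir_eq h.2.1, h3.dir_eq h.2.1])
  have e2 := G.dir_trans b' x y (h2.ne h.2.2.1) (h4.ne h.2.2.1) hxy
    (by rw [h2.dir_eq h.2.2.1, h4.dir_eq h.2.2.1])
  rw [h1.dir_eq h.2.1] at e1
  rw [h2.dir_eq h.2.2.1, e1] at e2
  exact h.ne_right e2

/-- The theorem of Desargues for a tetrahedron. -/
theorem parallel_of_not_coplanar {a b x y a' b' x' y' : A} (hx : G.Off a b x)
    (hy : y ≠ a ∧ y ≠ b ∧ y ≠ x)
    (hL : ∀ L, G.IsAxis L → G.dir y a ∈ L → G.dir y b ∈ L → G.dir y x ∉ L)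
    (hax : G.Parallel a x a' x') (hbx : G.Parallel b x b' x')
    (hay : G.Parallel a y a' y') (hby : G.Parallel b y b' y') : G.Parallel x y x' y' := by
  obtain ⟨ya, yb, yx⟩ := hy
  have nab : G.dir y a ≠ G.dir y b := fun e => by
    obtain ⟨L, hL', h1, h2⟩ := G.exists_axis (G.dir y a) (G.dir y x)
    exact hL L hL' h1 (e ▸ h1) h2
  have nax : G.dir y a ≠ G.dir y x := fun e => by
    obtain ⟨L, hL', h1, h2⟩ := G.exists_axis (G.dir y a) (G.dir y b)
    exact hL L hL' h1 h2 (e ▸ h1)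
  have nbx : G.dir y b ≠ G.dir y x := fun e => by
    obtain ⟨L, hL', h1, h2⟩ := G.exists_axis (G.dir y a) (G.dir y b)
    exact hL L hL' h1 h2 (e ▸ h2)
  have oa : G.Off a x y := ⟨hx.2.1, ya.symm, yx.symm, fun e => nax (by
    rw [G.dir_comm y x, G.dir_trans a x y hx.2.1 ya.symm yx.symm e, e, G.dir_comm])⟩
  have ob : G.Off b x y := ⟨hx.2.2.1, yb.symm, yx.symm, fun e => nbx (by
    rw [G.dir_comm y x, G.dir_trans b x y hx.2.2.1 yb.symm yx.symm e, e, G.dir_comm])⟩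
  -- The triangles `a x y` and `b x y` are rebuilt over their new sides, with third vertices `p` and
  -- `q`. Were `y'` different from both, the directions of `y a`, `y b`, `y x` would occur among
  -- `y'`, `p`, `q`, contrary to non-coplanarity.
  obtain ⟨p, p1, p2⟩ := oa.exists_parallel hax
  obtain ⟨q, q1, q2⟩ := ob.exists_parallel hbx
  have ray : ∀ {c c' u v : A}, c ≠ y → G.Parallel c y c' u → G.Parallel c y c' v → u ≠ v →
      G.dir u v = G.dir y c := fun {c c' u v} hc h1 h2 huv => by
    rw [G.dir_trans c' u v (h1.ne hc) (h2.ne hc) huv (by rw [h1.dir_eq hc, h2.dir_eq hc]),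
      h1.dir_eq hc, G.dir_comm]
  by_cases e1 : y' = p
  · rwa [e1]
  by_cases e2 : y' = q
  · rwa [e2]
  exfalso
  have r1 := ray ya.symm hay p1 e1
  have r2 := ray yb.symm hby q1 e2
  by_cases e3 : p = q
  · subst e3
    exact nab (r1.symm.trans r2)
  have r3 := ray yx.symm p2 q2 e3
  obtain ⟨L, hL', h1, h2, h3⟩ := G.triangle y' p q e1 e2 e3
  exact hL L hL' (r1 ▸ h1) (r2 ▸ h2) (r3 ▸ h3)

/-- An axis of a plane through all four points would share the distinct directions of `a b` and `a
x` with `L`, hence be `L`, which omits the direction of `a z`. -/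
theorem not_coplanar_of_not_mem {a b x z : A} {L : Set D} (hL : G.IsAxis L) (hx : G.Off a b x)
    (hz : z ≠ a) (hab : G.dir a b ∈ L) (hax : G.dir a x ∈ L) (haz : G.dir a z ∉ L) :
    z ≠ b ∧ z ≠ x ∧
      ∀ M, G.IsAxis M → G.dir z a ∈ M → G.dir z b ∈ M → G.dir z x ∉ M := by
  have zb : z ≠ b := by rintro rfl; exact haz hab
  have zx : z ≠ x := by rintro rfl; exact haz hax
  refine ⟨zb, zx, fun M hM h1 h2 h3 => ?_⟩
  have m1 := G.dir_mem hz zb hx.1 hM h1 h2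
  have m2 := G.dir_mem hz zx hx.2.1 hM h1 h3
  rw [G.dir_comm] at h1
  exact haz (G.axis_unique _ _ L M hx.2.2.2 hL hM hab hax m1 m2 ▸ h1)

/-- The theorem of Desargues for two triangles with a common side. -/
theorem parallel_of_off {a b x y a' b' x' y' : A} (hab : G.Parallel a b a' b') (hx : G.Off a b x)
    (hy : G.Off a b y) (hax : G.Parallel a x a' x') (hbx : G.Parallel b x b' x')
    (hay : G.Parallel a y a' y') (hby : G.Parallel b y b' y') (hxy : x ≠ y) :
    G.Parallel x y x' y' := by
  by_cases hcop : ∀ L, G.IsAxis L → G.dir y a ∈ L → G.dir y b ∈ L → G.dir y x ∉ L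
  · exact parallel_of_not_coplanar hx ⟨hy.2.1.symm, hy.2.2.1.symm, hxy.symm⟩ hcop hax hbx hay hby
  push Not at hcop
  obtain ⟨L, hL, ha, hb, hx'⟩ := hcop
  obtain ⟨nab, nax, nbx, -⟩ := id hx
  obtain ⟨-, nay, nby, -⟩ := id hy
  have lab := G.dir_mem nay.symm nby.symm nab hL ha hb
  have lax := G.dir_mem nay.symm hxy.symm nax hL ha hx'
  have lbx := G.dir_mem nby.symm hxy.symm nbx hL hb hx'
  have lay : G.dir a y ∈ L := by rwa [G.dir_comm]
  -- In the plane case, an auxiliary point `z` outside the plane reduces the claim to tetrahedra.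
  obtain ⟨δ, hδ⟩ := G.exists_not_mem L hL
  obtain ⟨z, hza, hz⟩ := G.exists_dir a δ
  rw [← hz] at hδ
  obtain ⟨zb, zx, cx⟩ := not_coplanar_of_not_mem hL hx hza lab lax hδ
  obtain ⟨-, zy, cy⟩ := not_coplanar_of_not_mem hL hy hza lab lay hδ
  have oz : G.Off a b z := ⟨nab, hza.symm, zb.symm, fun e => hδ (e ▸ lab)⟩
  obtain ⟨z', paz, pbz⟩ := oz.exists_parallel hab
  have pxz := parallel_of_not_coplanar hx ⟨hza, zb, zx⟩ cx hax hbx paz pbz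
  have pyz := parallel_of_not_coplanar hy ⟨hza, zb, zy⟩ cy hay hby paz pbz
  have lbz : G.dir b z ∉ L := fun h => hδ <|
    G.dir_mem nab.symm zb.symm hza.symm hL (by rwa [G.dir_comm]) h
  have lyz : G.dir y z ∉ L := fun h => hδ <| G.dir_mem nay.symm zy.symm hza.symm hL ha h
  -- One of `a`, `b` is off the line `x y`; that point and `z` form the common side for the last
  -- application.
  by_cases hon : G.dir y a = G.dir y x
  · have hon' : G.dir y b ≠ G.dir y x := fun e => hy.ne_right (by
      rw [G.dir_comm a y, G.dir_comm b y, hon, e])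
    refine parallel_of_not_coplanar (a := b) (b := z) (a' := b') (b' := z')
      ⟨zb.symm, nbx, zx, fun e => lbz (e ▸ lbx)⟩ ⟨nby.symm, zy.symm, hxy.symm⟩ ?_ hbx pxz.symm hby
      pyz.symm
    intro M hM h1 h2 h3
    exact lyz (G.axis_unique _ _ L M hon' hL hM hb hx' h1 h3 ▸ h2)
  · refine parallel_of_not_coplanar (a := a) (b := z) (a' := a') (b' := z')
      ⟨hza.symm, nax, zx, fun e => hδ (e ▸ lax)⟩ ⟨nay.symm, zy.symm, hxy.symm⟩ ?_ hax pxz.symm hay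
      pyz.symm
    intro M hM h1 h2 h3
    exact lyz (G.axis_unique _ _ L M hon hL hM ha hx' h1 h3 ▸ h2)

theorem exists_off {a b : A} (hab : a ≠ b) : ∃ c, G.Off a b c := by
  obtain ⟨L, hL, h1, -⟩ := G.exists_axis (G.dir a b) (G.dir a b)
  obtain ⟨δ, hδ⟩ := G.exists_not_mem L hL
  obtain ⟨c, hca, hc⟩ := G.exists_dir a δ
  refine ⟨c, hab, hca.symm, ?_, fun e => hδ (hc ▸ e ▸ h1)⟩
  rintro rfl
  exact hδ (hc ▸ h1)

/-- A point other than the vertices lies on at most one side line of a triangle. Consequently any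
two such points are off a common side. -/
theorem off_or_off {a b c x : A} (h : G.Off a b c) (hxa : x ≠ a) (hxb : x ≠ b) (hxc : x ≠ c) :
    (G.Off a b x ∧ G.Off a c x) ∨ (G.Off a b x ∧ G.Off b c x) ∨ (G.Off a c x ∧ G.Off b c x) := by
  obtain ⟨h1, h2, h3, h4⟩ := id h
  by_cases e1 : G.dir a b = G.dir a x
  · refine Or.inr (Or.inr ⟨⟨h2, hxa.symm, hxc.symm, fun e => h4 (e1.trans e.symm)⟩, h3, hxb.symm,
      hxc.symm, fun e => ?_⟩)
    have := G.dir_trans a b x h1 hxa.symm hxb.symm e1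
    exact h.ne_left (this.symm.trans e.symm)
  by_cases e2 : G.dir a c = G.dir a x
  · refine Or.inr (Or.inl ⟨⟨h1, hxa.symm, hxb.symm, e1⟩, h3, hxb.symm, hxc.symm, fun e => ?_⟩)
    have h5 := G.dir_trans a c x h2 hxa.symm hxc.symm e2
    have h6 := G.dir_trans b c x h3 hxb.symm hxc.symm e
    exact h.ne_right (h5.symm.trans h6)
  · exact Or.inl ⟨⟨h1, hxa.symm, hxb.symm, e1⟩, ⟨h2, hxa.symm, hxc.symm, e2⟩⟩

variable (G) in
/-- The group of dilatations: the permutations that preserve directions. -/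
def dilatations : Subgroup (Equiv.Perm A) where
  carrier := {σ | ∀ a b, a ≠ b → G.dir (σ a) (σ b) = G.dir a b}
  one_mem' := fun _ _ _ => rfl
  mul_mem' := fun {σ τ} hσ hτ a b hab => by
    rw [Equiv.Perm.mul_apply, Equiv.Perm.mul_apply, hσ _ _ (τ.injective.ne hab), hτ a b hab]
  inv_mem' := fun {σ} hσ a b hab => by
    rw [← hσ _ _ (σ⁻¹.injective.ne hab)]; simp

theorem parallel_refl_of_dil {f : A → A} (hf : ∀ a b, a ≠ b → f a ≠ f b ∧ G.dir (f a) (f b) = G.dir a b)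
    (a b : A) : G.Parallel a b (f a) (f b) := by
  by_cases h : a = b
  · subst h; exact Or.inl ⟨rfl, rfl⟩
  · exact parallel_of_dir_eq h (hf a b h).1 (hf a b h).2

/-- The image of a point off a line follows from the images of two points of the line. An auxiliary
point `c` off `a b` then reaches the points of `a b` itself. -/
theorem dilatation_unique {f g : A → A}
    (hf : ∀ a b, a ≠ b → f a ≠ f b ∧ G.dir (f a) (f b) = G.dir a b)
    (hg : ∀ a b, a ≠ b → g a ≠ g b ∧ G.dir (g a) (g b) = G.dir a b) {a b : A} (hab : a ≠ b)
    (ha : f a = g a) (hb : f b = g b) : f = g := by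
  have key : ∀ {a b c}, G.Off a b c → f a = g a → f b = g b → f c = g c := by
    intro a b c h ha hb
    refine h.unique (parallel_refl_of_dil hf a c) (parallel_refl_of_dil hf b c) ?_ ?_
    · rw [ha]; exact parallel_refl_of_dil hg a c
    · rw [hb]; exact parallel_refl_of_dil hg b c
  obtain ⟨c, hc⟩ := G.exists_off hab
  have hfc := key hc ha hb
  funext x
  by_cases xa : x = a
  · rw [xa, ha]
  by_cases xb : x = b
  · rw [xb, hb]
  by_cases xc : x = c
  · rw [xc, hfc]
  rcases off_or_off hc xa xb xc with h | h | h
  · exact key h.1 ha hb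
  · exact key h.1 ha hb
  · exact key h.1 ha hfc

/-- A reference triangle `a b c` is copied to `a' b' c'`, and each `x` is rebuilt from one side of
it. Desargues with a common side shows that the result is parallel to `x` as seen from all three
vertices, and then that directions between arbitrary points are kept. -/
theorem exists_dilatation_fun {a b a' b' : A} (hab : a ≠ b) (hp : G.Parallel a b a' b') :
    ∃ f : A → A, (∀ x y, x ≠ y → f x ≠ f y ∧ G.dir (f x) (f y) = G.dir x y) ∧
      f a = a' ∧ f b = b' := by
  obtain ⟨c, hc⟩ := G.exists_off hab
  obtain ⟨c', hac, hbc⟩ := hc.exists_parallel hp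
  have hac' : G.Off a c b := hc.swap.rot
  have hbc' : G.Off b c a := hc.rot
  have ex : ∀ x, ∃ x', G.Parallel a x a' x' ∧ G.Parallel b x b' x' ∧ G.Parallel c x c' x' := by
    intro x
    by_cases xa : x = a
    · subst xa; exact ⟨a', Or.inl ⟨rfl, rfl⟩, hp.symm, hac.symm⟩
    by_cases xb : x = b
    · subst xb; exact ⟨b', hp, Or.inl ⟨rfl, rfl⟩, hbc.symm⟩
    by_cases xc : x = c
    · subst xc; exact ⟨c', hac, hbc, Or.inl ⟨rfl, rfl⟩⟩
    have hcase : G.Off a b x ∨ G.Off a c x := by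
      rcases off_or_off hc xa xb xc with h | h | h
      · exact Or.inl h.1
      · exact Or.inl h.1
      · exact Or.inr h.1
    rcases hcase with h | h
    · obtain ⟨x', h1, h2⟩ := h.exists_parallel hp
      exact ⟨x', h1, h2, parallel_of_off hp hc h hac hbc h1 h2 (Ne.symm xc)⟩
    · obtain ⟨x', h1, h2⟩ := h.exists_parallel hac
      exact ⟨x', h1, parallel_of_off hac hac' h hp hbc.symm h1 h2 (Ne.symm xb), h2⟩
  choose f hfa hfb hfc using ex
  have fa : f a = a' := by
    rcases hfa a with h | h
    · exact h.2
    · exact absurd rfl h.1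
  have fb : f b = b' := by
    rcases hfb b with h | h
    · exact h.2
    · exact absurd rfl h.1
  have fc : f c = c' := by
    rcases hfc c with h | h
    · exact h.2
    · exact absurd rfl h.1
  refine ⟨f, fun x y hxy => ?_, fa, fb⟩
  have main : G.Parallel x y (f x) (f y) := by
    by_cases xa : x = a
    · subst xa; rw [fa]; exact hfa y
    by_cases xb : x = b
    · subst xb; rw [fb]; exact hfb y
    by_cases xc : x = c
    · subst xc; rw [fc]; exact hfc y
    by_cases ya : y = a
    · subst ya; rw [fa]; exact (hfa x).symm
    by_cases yb : y = b
    · subst yb; rw [fb]; exact (hfb x).symm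
    by_cases yc : y = c
    · subst yc; rw [fc]; exact (hfc x).symm
    have hx := off_or_off hc xa xb xc
    have hy := off_or_off hc ya yb yc
    -- Each of `x`, `y` is off two of the three sides, so they share one.
    have hcases : (G.Off a b x ∧ G.Off a b y) ∨ (G.Off a c x ∧ G.Off a c y) ∨
        (G.Off b c x ∧ G.Off b c y) := by tauto
    rcases hcases with h | h | h
    · exact parallel_of_off hp h.1 h.2 (hfa x) (hfb x) (hfa y) (hfb y) hxy
    · exact parallel_of_off hac h.1 h.2 (hfa x) (hfc x) (hfa y) (hfc y) hxy
    · exact parallel_of_off hbc h.1 h.2 (hfb x) (hfc x) (hfb y) (hfc y) hxy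
  exact ⟨main.ne hxy, main.dir_eq hxy⟩

/-- Parallel segments are related by a dilatation. -/
theorem exists_dilatation {a b a' b' : A} (hab : a ≠ b) (hab' : a' ≠ b')
    (hd : G.dir a' b' = G.dir a b) : ∃ σ ∈ G.dilatations, σ a = a' ∧ σ b = b' := by
  obtain ⟨f, hf, fa, fb⟩ := exists_dilatation_fun hab (parallel_of_dir_eq hab hab' hd)
  obtain ⟨g, hg, ga, gb⟩ := exists_dilatation_fun hab' (parallel_of_dir_eq hab' hab hd.symm)
  have comp : ∀ {f g : A → A}, (∀ x y, x ≠ y → f x ≠ f y ∧ G.dir (f x) (f y) = G.dir x y) →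
      (∀ x y, x ≠ y → g x ≠ g y ∧ G.dir (g x) (g y) = G.dir x y) →
      ∀ x y, x ≠ y → (g ∘ f) x ≠ (g ∘ f) y ∧ G.dir ((g ∘ f) x) ((g ∘ f) y) = G.dir x y :=
    fun hf hg x y h => ⟨(hg _ _ (hf _ _ h).1).1, by
      simp only [Function.comp]; rw [(hg _ _ (hf _ _ h).1).2, (hf _ _ h).2]⟩
  have hid : ∀ x y : A, x ≠ y → id x ≠ id y ∧ G.dir (id x) (id y) = G.dir x y :=
    fun x y h => ⟨h, rfl⟩
  have h1 : g ∘ f = id := dilatation_unique (comp hf hg) hid hab (by simp [fa, ga])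
    (by simp [fb, gb])
  have h2 : f ∘ g = id := dilatation_unique (comp hg hf) hid hab' (by simp [fa, ga])
    (by simp [fb, gb])
  exact ⟨⟨f, g, congrFun h1, congrFun h2⟩, fun x y h => (hf x y h).2, fa, fb⟩

theorem dilatation_ext {σ τ : Equiv.Perm A} (hσ : σ ∈ G.dilatations) (hτ : τ ∈ G.dilatations)
    {a b : A} (hab : a ≠ b) (ha : σ a = τ a) (hb : σ b = τ b) : σ = τ :=
  DFunLike.coe_injective <| dilatation_unique (G := G)
    (fun x y h => ⟨σ.injective.ne h, hσ x y h⟩) (fun x y h => ⟨τ.injective.ne h, hτ x y h⟩) hab ha hb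

/-- A dilatation without fixed points moves all points in the same direction. -/
theorem dir_eq_of_forall_ne {σ : Equiv.Perm A} (hσ : σ ∈ G.dilatations) (hfix : ∀ x, σ x ≠ x)
    (x y : A) : G.dir x (σ x) = G.dir y (σ y) := by
  by_contra hne
  have hxy : x ≠ y := by rintro rfl; exact hne rfl
  -- The line from `x` to `σ x` is mapped to itself, so all of its points move along it.
  have hline : ∀ {x y}, G.dir x (σ x) = G.dir x y → x ≠ y → G.dir x (σ x) = G.dir y (σ y) := by
    intro x y h hxy
    by_cases e : y = σ x
    · rw [e, hσ x (σ x) (hfix x).symm]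
    · have h1 := G.dir_trans x y (σ x) hxy (hfix x).symm e h.symm
      have h2 := hσ x y hxy
      by_cases e' : σ x = σ y
      · exact absurd (σ.injective e') hxy
      rw [h, ← h1]
      rw [G.dir_comm] at h1
      rw [← h2] at h1
      rw [G.dir_trans (σ x) y (σ y) (Ne.symm e) e' (hfix y).symm h1, G.dir_comm y]
  have n1 : G.dir x (σ x) ≠ G.dir x y := fun e => hne (hline e hxy)
  have n2 : G.dir y (σ y) ≠ G.dir x y := fun e =>
    hne (hline (e.trans (G.dir_comm x y)) hxy.symm).symm
  have hyx : y ≠ σ x := by rintro rfl; exact n1 rfl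
  -- Since `σ` keeps the direction of `x y`, the points `x`, `y`, `σ x`, `σ y` are coplanar. The two
  -- trace lines would therefore meet in a point `p`, which would have to move along both.
  obtain ⟨L, hL, l1, l2, l3⟩ := G.triangle x y (σ x) hxy (hfix x).symm hyx
  have hσxy : σ x ≠ σ y := σ.injective.ne hxy
  have l4 : G.dir y (σ y) ∈ L :=
    G.dir_mem hyx.symm hσxy (hfix y).symm hL (by rwa [G.dir_comm]) (by rwa [hσ x y hxy])
  obtain ⟨p, px, py, d1, d2⟩ := G.complete x y _ _ L hxy hL l1 l2 l4 hne n1 n2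
  have on : ∀ {x}, p ≠ x → G.dir x p = G.dir x (σ x) → G.dir p (σ p) = G.dir x (σ x) := by
    intro x hpx hd
    rw [hline hd.symm hpx.symm]
  exact hne ((on px d1).symm.trans (on py d2))

end DirectionSpace

end HarmonicGeometry
-- Translations, vectors and the division ring of scalars.
namespace HarmonicGeometry

namespace DirectionSpace

variable {A D : Type*} {G : DirectionSpace A D}

variable (G) in
/-- A translation is a dilatation that is the identity or has no fixed point. -/
def IsTranslation (σ : Equiv.Perm A) : Prop :=
  σ ∈ G.dilatations ∧ (σ = 1 ∨ ∀ x, σ x ≠ x)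

theorem IsTranslation.dir_eq {σ : Equiv.Perm A} (h : G.IsTranslation σ) (h1 : σ ≠ 1) (x y : A) :
    G.dir x (σ x) = G.dir y (σ y) :=
  dir_eq_of_forall_ne h.1 (h.2.resolve_left h1) x y

theorem IsTranslation.apply_ne {σ : Equiv.Perm A} (h : G.IsTranslation σ) (h1 : σ ≠ 1) (x : A) :
    σ x ≠ x := h.2.resolve_left h1 x

theorem exists_ne_point (G : DirectionSpace A D) (o : A) : ∃ x, o ≠ x := by
  obtain ⟨x, hx, -⟩ := G.exists_dir o (G.dir o o)
  exact ⟨x, hx.symm⟩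

/-- For `x` off the line from `o` to `σ o`, the image of `x` is forced as the fourth vertex of a
parallelogram; two images determine a dilatation. -/
theorem IsTranslation.ext {σ τ : Equiv.Perm A} (hσ : G.IsTranslation σ) (hτ : G.IsTranslation τ)
    {o : A} (h : σ o = τ o) : σ = τ := by
  by_cases h1 : σ = 1
  · rcases hτ.2 with h2 | h2
    · rw [h1, h2]
    · exact absurd (by rw [← h, h1]; rfl) (h2 o)
  have h2 : τ ≠ 1 := by
    rintro rfl
    exact hσ.apply_ne h1 o h
  obtain ⟨x, hx⟩ := G.exists_off (hσ.apply_ne h1 o).symm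
  refine dilatation_ext hσ.1 hτ.1 hx.2.1 h ?_
  have hox := hx.2.1
  refine hx.rot.swap.unique (a' := σ o) (b' := x) ?_ ?_ ?_ ?_
  · exact parallel_of_dir_eq hox.symm (σ.injective.ne hox) (by rw [hσ.1 o x hox, G.dir_comm])
  · exact parallel_of_dir_eq (hσ.apply_ne h1 o) (hσ.apply_ne h1 x).symm
      (by rw [hσ.dir_eq h1 x o, G.dir_comm])
  · rw [h]
    exact parallel_of_dir_eq hox.symm (τ.injective.ne hox) (by rw [hτ.1 o x hox, G.dir_comm])
  · exact parallel_of_dir_eq (hσ.apply_ne h1 o) (hτ.apply_ne h2 x).symm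
      (by rw [hτ.dir_eq h2 x o, ← h, G.dir_comm])

theorem IsTranslation.inv {σ : Equiv.Perm A} (h : G.IsTranslation σ) : G.IsTranslation σ⁻¹ := by
  refine ⟨inv_mem h.1, ?_⟩
  rcases h.2 with rfl | h'
  · exact Or.inl inv_one
  · refine Or.inr fun x e => h' x ?_
    conv_lhs => rw [← e]
    simp

/-- If the product fixes a point, then `τ` agrees there with `σ⁻¹`, hence everywhere. -/
theorem IsTranslation.mul {σ τ : Equiv.Perm A} (hσ : G.IsTranslation σ) (hτ : G.IsTranslation τ) :
    G.IsTranslation (σ * τ) := by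
  refine ⟨mul_mem hσ.1 hτ.1, ?_⟩
  by_cases h : ∃ x, (σ * τ) x = x
  · obtain ⟨x, hx⟩ := h
    have : τ = σ⁻¹ := hτ.ext hσ.inv (o := x) (by rw [Equiv.Perm.eq_inv_iff_eq]; exact hx)
    exact Or.inl (by rw [this, mul_inv_cancel])
  · exact Or.inr (not_exists.mp h)

variable (G) in
-- Complete `a`, `b`, `c` to a parallelogram with fourth vertex `d` and take the dilatation `a ↦ b`,
-- `c ↦ d`. A fixed point would lie on both of the parallel lines `a b` and `c d`.
theorem exists_translation (a b : A) : ∃ σ, G.IsTranslation σ ∧ σ a = b := by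
  by_cases hab : a = b
  · exact ⟨1, ⟨one_mem _, Or.inl rfl⟩, hab⟩
  obtain ⟨c, hc⟩ := G.exists_off hab
  obtain ⟨L, hL, h1, h2, h3⟩ := G.triangle a b c hab hc.2.1 hc.2.2.1
  obtain ⟨d, hdb, hdc, e1, e2⟩ := G.complete b c (G.dir a c) (G.dir a b) L hc.2.2.1 hL h3 h2 h1
    hc.2.2.2.symm hc.ne_right hc.ne_left
  obtain ⟨σ, hσ, s1, s2⟩ := exists_dilatation hc.2.1 hdb.symm e1
  refine ⟨σ, ⟨hσ, Or.inr fun p hp => ?_⟩, s1⟩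
  have pa : p ≠ a := by rintro rfl; exact hab (hp.symm.trans s1)
  have pc : p ≠ c := by rintro rfl; exact hdc (s2.symm.trans hp)
  have pb : p ≠ b := fun e => pa (σ.injective (by rw [hp, s1, e]))
  have pd : p ≠ d := fun e => pc (σ.injective (by rw [hp, s2, e]))
  have q1 := hσ p a pa
  have q2 := hσ p c pc
  rw [hp, s1] at q1
  rw [hp, s2] at q2
  have q3 := G.dir_trans p a b pa pb hab q1.symm
  have q4 := G.dir_trans p c d pc pd hdc.symm q2.symm
  have q5 := G.dir_trans p a c pa pc hc.2.1 (by rw [← q3, ← q4, e2])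
  exact hc.2.2.2 (q3.trans q5.symm)

theorem IsTranslation.conj {σ τ : Equiv.Perm A} (hσ : G.IsTranslation σ) (hτ : τ ∈ G.dilatations) :
    G.IsTranslation (τ * σ * τ⁻¹) := by
  refine ⟨mul_mem (mul_mem hτ hσ.1) (inv_mem hτ), ?_⟩
  rcases hσ.2 with rfl | h
  · exact Or.inl (by group)
  · refine Or.inr fun x e => h (τ⁻¹ x) ?_
    rw [Equiv.Perm.eq_inv_iff_eq]
    exact e

theorem IsTranslation.dir_conj {σ τ : Equiv.Perm A} (hσ : G.IsTranslation σ)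
    (hτ : τ ∈ G.dilatations) (h1 : σ ≠ 1) (x : A) :
    G.dir x ((τ * σ * τ⁻¹) x) = G.dir x (σ x) := by
  have h := hτ (τ⁻¹ x) (σ (τ⁻¹ x)) (hσ.apply_ne h1 _).symm
  rw [hσ.dir_eq h1 (τ⁻¹ x) x] at h
  simpa using h

theorem IsTranslation.dir_mul {σ τ : Equiv.Perm A} (hσ : G.IsTranslation σ)
    (hτ : G.IsTranslation τ) {d : D} {x : A} (h1 : σ ≠ 1 → G.dir x (σ x) = d)
    (h2 : τ ≠ 1 → G.dir x (τ x) = d) (h3 : σ * τ ≠ 1) : G.dir x ((σ * τ) x) = d := by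
  by_cases s1 : σ = 1
  · subst s1
    rw [one_mul] at h3 ⊢
    exact h2 h3
  by_cases t1 : τ = 1
  · subst t1
    rw [mul_one] at h3 ⊢
    exact h1 h3
  have e1 : G.dir x (τ x) = G.dir (τ x) (σ (τ x)) := by
    rw [h2 t1, hσ.dir_eq s1 (τ x) x, h1 s1]
  have e2 := G.dir_trans (τ x) x (σ (τ x)) (hτ.apply_ne t1 x) (hσ.apply_ne s1 _).symm
    ((hσ.mul hτ).apply_ne h3 x).symm (by rw [G.dir_comm, e1])
  rw [Equiv.Perm.mul_apply, e2, G.dir_comm, h2 t1]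

theorem IsTranslation.dir_inv {σ : Equiv.Perm A} (hσ : G.IsTranslation σ) (x : A) (h : σ ≠ 1) :
    G.dir x (σ⁻¹ x) = G.dir x (σ x) := by
  have := hσ.dir_eq h (σ⁻¹ x) x
  rw [show σ (σ⁻¹ x) = x by simp] at this
  rw [G.dir_comm, this]

/-- The commutator is a product of `σ` with a conjugate of `σ⁻¹`, and also of a conjugate of `τ`
with `τ⁻¹`. If nontrivial, it would move points in both directions. -/
theorem IsTranslation.comm_of_dir_ne {σ τ : Equiv.Perm A} (hσ : G.IsTranslation σ)
    (hτ : G.IsTranslation τ) {x : A} (h : G.dir x (σ x) ≠ G.dir x (τ x)) : σ * τ = τ * σ := by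
  by_cases s1 : σ = 1
  · simp [s1]
  by_cases t1 : τ = 1
  · simp [t1]
  by_contra hne
  have c1 : σ * (τ * σ⁻¹ * τ⁻¹) ≠ 1 := fun e => hne (by
    rw [← mul_assoc, ← mul_assoc, mul_inv_eq_one, mul_inv_eq_iff_eq_mul] at e; exact e)
  have c2 : (σ * τ * σ⁻¹) * τ⁻¹ ≠ 1 := fun e => c1 (by rw [← e]; group)
  have hs' : σ⁻¹ ≠ 1 := inv_ne_one.mpr s1
  have d1 := hσ.dir_mul (x := x) (d := G.dir x (σ x)) (hσ.inv.conj hτ.1) (fun _ => rfl)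
    (fun _ => by rw [hσ.inv.dir_conj hτ.1 hs', hσ.dir_inv x s1]) c1
  have d2 := (hτ.conj hσ.1).dir_mul (x := x) (d := G.dir x (τ x)) hτ.inv
    (fun _ => by rw [hτ.dir_conj hσ.1 t1]) (fun _ => by rw [hτ.dir_inv x t1]) c2
  have e : σ * (τ * σ⁻¹ * τ⁻¹) = (σ * τ * σ⁻¹) * τ⁻¹ := by group
  rw [e, d2] at d1
  exact h d1.symm

/-- For parallel translations, choose `ρ` in another direction: `σ` commutes with `ρ` and with `τ *
ρ`, hence with `τ`. -/
theorem IsTranslation.comm {σ τ : Equiv.Perm A} (hσ : G.IsTranslation σ)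
    (hτ : G.IsTranslation τ) : σ * τ = τ * σ := by
  by_cases s1 : σ = 1
  · simp [s1]
  by_cases h : ∃ x, G.dir x (σ x) ≠ G.dir x (τ x)
  · obtain ⟨x, hx⟩ := h
    exact hσ.comm_of_dir_ne hτ hx
  push Not at h
  by_cases t1 : τ = 1
  · simp [t1]
  obtain ⟨x⟩ : Nonempty A := by
    by_contra hA
    rw [not_nonempty_iff] at hA
    exact s1 (Subsingleton.elim _ _)
  obtain ⟨y, hy⟩ := G.exists_off (hσ.apply_ne s1 x).symm
  obtain ⟨ρ, hρ, hxy⟩ := G.exists_translation x y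
  have n1 : G.dir x (σ x) ≠ G.dir x (ρ x) := by rw [hxy]; exact hy.2.2.2
  have r1 : ρ ≠ 1 := by rintro rfl; exact hy.2.1 hxy
  have m1 : τ * ρ ≠ 1 := fun e => n1 (by
    rw [h x, eq_inv_of_mul_eq_one_left e, hρ.dir_inv x r1])
  have n2 : G.dir x (σ x) ≠ G.dir x ((τ * ρ) x) := fun e => n1 (by
    have := hτ.inv.dir_mul (x := x) (d := G.dir x (σ x)) (hτ.mul hρ)
      (fun _ => by rw [hτ.dir_inv x t1, h x]) (fun _ => e.symm) (by simpa using r1)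
    simpa using this.symm)
  have c1 := hσ.comm_of_dir_ne hρ n1
  have c2 := hσ.comm_of_dir_ne (hτ.mul hρ) n2
  have c3 : σ * τ * ρ = τ * σ * ρ := by rw [mul_assoc, c2, mul_assoc, ← c1, mul_assoc]
  exact mul_right_cancel c3

variable (G) in
/-- The group of translations. -/
def translations : Subgroup (Equiv.Perm A) where
  carrier := {σ | G.IsTranslation σ}
  one_mem' := ⟨one_mem _, Or.inl rfl⟩
  mul_mem' := fun h1 h2 => h1.mul h2
  inv_mem' := fun h => h.inv

instance : CommGroup G.translations where
  mul_comm := fun a b => Subtype.ext (a.2.comm b.2)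

variable (G) in
/-- The vectors of the affine space: its translations, written additively. -/
abbrev Vec : Type _ := Additive G.translations

/-- The point to which a vector moves a given point. -/
def shift (v : G.Vec) (x : A) : A := (Additive.toMul v : G.translations).1 x

theorem shift_isTranslation (v : G.Vec) : G.IsTranslation (Additive.toMul v : G.translations).1 :=
  (Additive.toMul v : G.translations).2

theorem shift_zero (x : A) : shift (0 : G.Vec) x = x := rfl

theorem shift_add (v w : G.Vec) (x : A) : shift (v + w) x = shift v (shift w x) := rfl

theorem vec_ext {v w : G.Vec} {x : A} (h : shift v x = shift w x) : v = w :=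
  Additive.toMul.injective (Subtype.ext ((shift_isTranslation v).ext (shift_isTranslation w) h))

theorem exists_shift (x y : A) : ∃ v : G.Vec, shift v x = y := by
  obtain ⟨σ, hσ, h⟩ := G.exists_translation x y
  exact ⟨Additive.ofMul ⟨σ, hσ⟩, h⟩

theorem shift_ne {v : G.Vec} (hv : v ≠ 0) (x : A) : shift v x ≠ x := fun h =>
  hv (vec_ext (x := x) (h.trans (shift_zero x).symm))

theorem toMul_ne_one {v : G.Vec} (hv : v ≠ 0) : (Additive.toMul v : G.translations).1 ≠ 1 :=
  fun h => hv (Additive.toMul.injective (Subtype.ext h))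

theorem dir_shift {v : G.Vec} (hv : v ≠ 0) (x y : A) :
    G.dir x (shift v x) = G.dir y (shift v y) :=
  (shift_isTranslation v).dir_eq (toMul_ne_one hv) x y

theorem dir_shift_neg {v : G.Vec} (x : A) : G.dir x (shift (-v) x) = G.dir x (shift v x) := by
  by_cases hv : v = 0
  · simp [hv]
  · exact (shift_isTranslation v).dir_inv x (toMul_ne_one hv)

theorem dir_shift_add {v w : G.Vec} {x : A} {d : D} (hv : v ≠ 0 → G.dir x (shift v x) = d)
    (hw : w ≠ 0 → G.dir x (shift w x) = d) (h : v + w ≠ 0) : G.dir x (shift (v + w) x) = d :=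
  (shift_isTranslation v).dir_mul (shift_isTranslation w)
    (fun h => hv fun e => h (by rw [e]; rfl)) (fun h => hw fun e => h (by rw [e]; rfl))
    (toMul_ne_one h)

variable (G) in
/-- The scalars: the endomorphisms of the group of vectors that preserve directions. -/
def scalars (o : A) : Subring (AddMonoid.End G.Vec) where
  carrier := {φ | ∀ v, φ v ≠ 0 → G.dir o (shift (φ v) o) = G.dir o (shift v o)}
  one_mem' := fun _ _ => rfl
  zero_mem' := fun _ h => absurd rfl h
  mul_mem' := fun {φ ψ} hφ hψ v h => by
    have e : (φ * ψ) v = φ (ψ v) := rfl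
    rw [e] at h ⊢
    rw [hφ _ h, hψ _ (fun e => h (by rw [e, map_zero]))]
  add_mem' := fun {φ ψ} hφ hψ v h => dir_shift_add (hφ v) (hψ v) h
  neg_mem' := fun {φ} hφ v h => by
    have e : (-φ) v = -(φ v) := rfl
    rw [e] at h ⊢
    rw [dir_shift_neg, hφ v (neg_ne_zero.mp h)]

section Scalars

variable {o : A}

theorem exists_dir_ne {v : G.Vec} (hv : v ≠ 0) :
    ∃ w : G.Vec, w ≠ 0 ∧ G.dir o (shift w o) ≠ G.dir o (shift v o) := by
  obtain ⟨y, hy⟩ := G.exists_off (shift_ne hv o).symm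
  obtain ⟨w, rfl⟩ := exists_shift (G := G) o y
  refine ⟨w, ?_, hy.2.2.2.symm⟩
  rintro rfl
  exact hy.2.1 rfl

/-- If `φ` kills `v` and `u` has another direction, then `φ u = φ (u + v)`. Were this nonzero, `u`
and `u + v` would be parallel, and so would `u` and `v`. Vectors parallel to `v` are reached through
a vector that is not. -/
theorem scalar_eq_zero {φ : AddMonoid.End G.Vec} (hφ : φ ∈ G.scalars o) {v : G.Vec} (hv : v ≠ 0)
    (h : φ v = 0) : φ = 0 := by
  have key : ∀ {v u : G.Vec}, v ≠ 0 → φ v = 0 → G.dir o (shift u o) ≠ G.dir o (shift v o) →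
      φ u = 0 := by
    intro v u hv h hd
    by_contra hu
    have e : φ (u + v) = φ u := by rw [map_add, h, add_zero]
    have d1 := hφ (u + v) (by rwa [e])
    rw [e, hφ u hu] at d1
    have d2 := dir_shift_add (v := u + v) (w := -u) (x := o) (d := G.dir o (shift u o))
      (fun _ => d1.symm) (fun _ => dir_shift_neg o) (by simpa using hv)
    rw [add_neg_cancel_comm] at d2
    exact hd d2.symm
  refine AddMonoidHom.ext fun u => ?_
  obtain ⟨w, hw, hwv⟩ := exists_dir_ne (o := o) hv
  by_cases hu : G.dir o (shift u o) = G.dir o (shift v o)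
  · exact key hw (key hv h hwv) (hu ▸ hwv.symm)
  · exact key hv h hu

/-- The scalar that a dilatation induces by conjugation. -/
def conjScalar {σ : Equiv.Perm A} (hσ : σ ∈ G.dilatations) : AddMonoid.End G.Vec :=
  AddMonoidHom.mk' (fun v => Additive.ofMul (⟨σ * (Additive.toMul v).1 * σ⁻¹,
    (shift_isTranslation v).conj hσ⟩ : G.translations))
    (fun v w => Additive.toMul.injective (Subtype.ext (by
      change σ * ((Additive.toMul v).1 * (Additive.toMul w).1) * σ⁻¹ =
        (σ * (Additive.toMul v).1 * σ⁻¹) * (σ * (Additive.toMul w).1 * σ⁻¹)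
      group)))

theorem shift_conjScalar {σ : Equiv.Perm A} (hσ : σ ∈ G.dilatations) (v : G.Vec) (x : A) :
    shift (conjScalar hσ v) x = σ (shift v (σ⁻¹ x)) := rfl

theorem conjScalar_mem {σ : Equiv.Perm A} (hσ : σ ∈ G.dilatations) :
    conjScalar hσ ∈ G.scalars o := fun v h =>
  (shift_isTranslation v).dir_conj hσ
    (toMul_ne_one (fun e => h (by rw [e, map_zero]))) o

/-- The dilatation fixes `o` and moves the tip of `v` to the tip of `w`. -/
theorem exists_conjScalar {v w : G.Vec} (hv : v ≠ 0) (hw : w ≠ 0)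
    (h : G.dir o (shift v o) = G.dir o (shift w o)) :
    ∃ (σ : Equiv.Perm A) (hσ : σ ∈ G.dilatations), conjScalar hσ v = w := by
  obtain ⟨σ, hσ, h1, h2⟩ := exists_dilatation (shift_ne hv o).symm (shift_ne hw o).symm h.symm
  refine ⟨σ, hσ, vec_ext (x := o) ?_⟩
  rw [shift_conjScalar, ← h2]
  congr 2
  rw [Equiv.Perm.inv_eq_iff_eq, h1]

instance : Nontrivial (G.scalars o) := by
  obtain ⟨x, hx⟩ := G.exists_ne_point o
  obtain ⟨v, rfl⟩ := exists_shift (G := G) o x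
  refine ⟨0, 1, fun h => hx ?_⟩
  have : (0 : AddMonoid.End G.Vec) v = (1 : AddMonoid.End G.Vec) v :=
    congrArg (fun c : G.scalars o => c.1 v) h
  have h2 : v = 0 := this.symm
  rw [h2, shift_zero]

/-- A nonzero scalar agrees at one nonzero vector with the scalar of a dilatation, hence everywhere;
the inverse dilatation inverts it. -/
theorem isUnit_or_eq_zero (c : G.scalars o) : IsUnit c ∨ c = 0 := by
  by_cases h : ∀ v, c.1 v = 0
  · exact Or.inr (Subtype.ext (AddMonoidHom.ext h))
  left
  push Not at h
  obtain ⟨v, hv⟩ := h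
  have hv0 : v ≠ 0 := fun e => hv (by rw [e, map_zero])
  obtain ⟨σ, hσ, e⟩ := exists_conjScalar hv0 hv (c.2 v hv).symm
  have h1 : c = ⟨conjScalar hσ, conjScalar_mem hσ⟩ := by
    have := scalar_eq_zero (sub_mem c.2 (conjScalar_mem (o := o) hσ)) hv0
      (show c.1 v - conjScalar hσ v = 0 by rw [e, sub_self])
    exact Subtype.ext (sub_eq_zero.mp this)
  have hσ' := inv_mem hσ
  refine ⟨⟨c, ⟨conjScalar hσ', conjScalar_mem hσ'⟩, ?_, ?_⟩, rfl⟩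
  · rw [h1]
    refine Subtype.ext (AddMonoidHom.ext fun v => vec_ext (x := o) ?_)
    change σ (σ⁻¹ (shift v (σ⁻¹⁻¹ (σ⁻¹ o)))) = shift v o
    simp
  · rw [h1]
    refine Subtype.ext (AddMonoidHom.ext fun v => vec_ext (x := o) ?_)
    change σ⁻¹ (σ (shift v (σ⁻¹ (σ⁻¹⁻¹ o)))) = shift v o
    simp

noncomputable instance : DivisionRing (G.scalars o) :=
  DivisionRing.ofIsUnitOrEqZero isUnit_or_eq_zero

theorem dir_shift_eq_iff {v w : G.Vec} (hv : v ≠ 0) (hw : w ≠ 0) :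
    G.dir o (shift v o) = G.dir o (shift w o) ↔ ∃ c : G.scalars o, w = c • v := by
  constructor
  · intro h
    obtain ⟨σ, hσ, e⟩ := exists_conjScalar hv hw h
    exact ⟨⟨conjScalar hσ, conjScalar_mem hσ⟩, e.symm⟩
  · rintro ⟨c, rfl⟩
    exact (c.2 v hw).symm

theorem dir_shift_add_mem {v w : G.Vec} {L : Set D} (hL : G.IsAxis L)
    (hv : v ≠ 0 → G.dir o (shift v o) ∈ L) (hw : w ≠ 0 → G.dir o (shift w o) ∈ L)
    (h : v + w ≠ 0) : G.dir o (shift (v + w) o) ∈ L := by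
  by_cases hv0 : v = 0
  · subst hv0; rw [zero_add] at h ⊢; exact hw h
  by_cases hw0 : w = 0
  · subst hw0; rw [add_zero] at h ⊢; exact hv h
  rw [shift_add]
  refine G.dir_mem (a := shift w o) (shift_ne hw0 o) (shift_ne hv0 _).symm
    (show o ≠ shift (v + w) o from (shift_ne h o).symm) hL ?_ ?_
  · rw [G.dir_comm]; exact hw hw0
  · rw [← dir_shift hv0 o]; exact hv hv0

/-- The passage from geometry to linear algebra. -/
theorem axis_iff {u v w : G.Vec} (hu : u ≠ 0) (hv : v ≠ 0) (hw : w ≠ 0) :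
    (∃ L, G.IsAxis L ∧ G.dir o (shift u o) ∈ L ∧ G.dir o (shift v o) ∈ L ∧
      G.dir o (shift w o) ∈ L) ↔
    ∃ a b c : G.scalars o, (a ≠ 0 ∨ b ≠ 0 ∨ c ≠ 0) ∧ a • u + b • v + c • w = 0 := by
  have hsm : ∀ {c : G.scalars o} {v : G.Vec}, c • v ≠ 0 →
      G.dir o (shift (c • v) o) = G.dir o (shift v o) := fun {c v} h => c.2 v h
  constructor
  · rintro ⟨L, hL, h1, h2, h3⟩
    by_cases e1 : G.dir o (shift u o) = G.dir o (shift v o)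
    · obtain ⟨c, hc⟩ := (dir_shift_eq_iff hu hv).mp e1
      exact ⟨c, -1, 0, Or.inr (Or.inl (by simp)), by simp [hc]⟩
    by_cases e2 : G.dir o (shift u o) = G.dir o (shift w o)
    · obtain ⟨c, hc⟩ := (dir_shift_eq_iff hu hw).mp e2
      exact ⟨c, 0, -1, Or.inl (fun h => hw (by simp [hc, h])), by simp [hc]⟩
    by_cases e3 : G.dir o (shift v o) = G.dir o (shift w o)
    · obtain ⟨c, hc⟩ := (dir_shift_eq_iff hv hw).mp e3
      exact ⟨0, c, -1, Or.inr (Or.inr (by simp)), by simp [hc]⟩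
    -- Three different directions on an axis are those of the sides of a triangle, and its edge
    -- vectors satisfy `q + w = p`.
    obtain ⟨x, x1, x2, d1, d2⟩ := G.complete o (shift w o) _ _ L (shift_ne hw o).symm hL h3 h1 h2 e1
      e2 e3
    obtain ⟨p, rfl⟩ := exists_shift (G := G) o x
    obtain ⟨q, hq⟩ := exists_shift (G := G) (shift w o) (shift p o)
    have hqw : q + w = p := vec_ext (x := o) hq
    have hp0 : p ≠ 0 := by rintro rfl; exact x1 rfl
    have hq0 : q ≠ 0 := by rintro rfl; exact x2 hq.symm
    rw [← hq, dir_shift hq0 _ o] at d2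
    obtain ⟨a, ha⟩ := (dir_shift_eq_iff hu hp0).mp d1.symm
    obtain ⟨b, hb⟩ := (dir_shift_eq_iff hv hq0).mp d2.symm
    refine ⟨a, -b, -1, Or.inr (Or.inr (by simp)), ?_⟩
    rw [neg_smul, neg_smul, one_smul, ← ha, ← hb, ← hqw]
    abel
  · have main : ∀ {u v w : G.Vec} {b c : G.scalars o}, w ≠ 0 → w = b • u + c • v →
        ∃ L, G.IsAxis L ∧ G.dir o (shift u o) ∈ L ∧ G.dir o (shift v o) ∈ L ∧
          G.dir o (shift w o) ∈ L := by
      intro u v w b c hw h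
      obtain ⟨L, hL, h1, h2⟩ := G.exists_axis (G.dir o (shift u o)) (G.dir o (shift v o))
      refine ⟨L, hL, h1, h2, ?_⟩
      rw [h] at hw ⊢
      exact dir_shift_add_mem hL (fun h => by rwa [hsm h]) (fun h => by rwa [hsm h]) hw
    have solve : ∀ {u v w : G.Vec} {a b c : G.scalars o}, c ≠ 0 → a • u + b • v + c • w = 0 →
        w = (-(c⁻¹ * a)) • u + (-(c⁻¹ * b)) • v := by
      intro u v w a b c hc h
      have h2 : w = c⁻¹ • (c • w) := by rw [smul_smul, inv_mul_cancel₀ hc, one_smul]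
      rw [h2, eq_neg_of_add_eq_zero_right h]
      rw [smul_neg, smul_add, smul_smul, smul_smul, neg_smul, neg_smul]
      abel
    rintro ⟨a, b, c, habc, h⟩
    rcases habc with ha | hb | hc
    · obtain ⟨L, hL, h1, h2, h3⟩ := main hu (solve ha (u := v) (v := w) (a := b) (b := c)
        (by rw [← h]; abel))
      exact ⟨L, hL, h3, h1, h2⟩
    · obtain ⟨L, hL, h1, h2, h3⟩ := main hv (solve hb (u := u) (v := w) (a := a) (b := c)
        (by rw [← h]; abel))
      exact ⟨L, hL, h1, h3, h2⟩
    · exact main hw (solve hc h)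

end Scalars

end DirectionSpace

end HarmonicGeometry
-- A solid without its plane at infinity, as a direction space.
namespace HarmonicGeometry

open PointLineGeometry

section AffinePart

variable {P : Type*} [ProjectiveSpace P]

/-- Only the case of three equal points needs care: the given line may then leave the plane and has
to be replaced. -/
theorem areCollinear_in_plane {E : Set P} (hE : IsPlane E) {X Y Z : P} (hX : X ∈ E) (hY : Y ∈ E)
    (hZ : Z ∈ E) (h : AreCollinear {X, Y, Z}) :
    ∃ l : Set P, IsLine l ∧ l ⊆ E ∧ X ∈ l ∧ Y ∈ l ∧ Z ∈ l := by
  obtain ⟨l, hl, h1, h2, h3⟩ := areCollinear_triple.mp h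
  by_cases hXY : X = Y
  · subst hXY
    by_cases hXZ : X = Z
    · subst hXZ
      obtain ⟨W, hW, hWl⟩ := hE.exists_not_mem_line hl
      have hne : X ≠ W := fun e => hWl (e ▸ h1)
      have := left_mem_join X W
      exact ⟨join X W, isLine_join hne, join_subset hE.isFlat hX hW, this, this, this⟩
    · exact ⟨l, hl, hE.isFlat X hX Z hZ hXZ l hl h1 h3, h1, h2, h3⟩
  · exact ⟨l, hl, hE.isFlat X hX Y hY hXY l hl h1 h2, h1, h2, h3⟩

/-- The points of the solid spanned by a plane and a point that do not lie in the plane. -/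
def AffinePart (E : Set P) (o : P) : Type _ := {X : P // X ∈ cone o E ∧ X ∉ E}

variable {E : Set P} {o : P}

theorem IsPlane.nonempty (hE : IsPlane E) : E.Nonempty := by
  obtain ⟨A, B, C, -, rfl⟩ := hE
  exact ⟨A, subset_flatSpan _ (by simp)⟩

/-- For `a = b` an arbitrary point of `E` serves as a default. -/
theorem exists_point_at_infinity (hE : IsPlane E) (ho : o ∉ E) (a b : AffinePart E o) :
    ∃ d : E, ∃ l : Set P, IsLine l ∧ a.1 ∈ l ∧ b.1 ∈ l ∧ d.1 ∈ l := by
  by_cases hab : a.1 = b.1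
  · obtain ⟨X, hX⟩ := hE.nonempty
    obtain ⟨l, hl, h1, h2⟩ := areCollinear_pair a.1 X
    exact ⟨⟨X, hX⟩, l, hl, h1, hab ▸ h1, h2⟩
  · have hl := isLine_join hab
    obtain ⟨X, hX, hXE⟩ := line_meets_base hE.isFlat ho hl
      (join_subset (isFlat_cone hE.isFlat ho) a.2.1 b.2.1)
    exact ⟨⟨X, hXE⟩, _, hl, left_mem_join _ _, right_mem_join _ _, hX⟩

/-- The point at infinity of the line through two affine points. -/
noncomputable def affineDir (hE : IsPlane E) (ho : o ∉ E) (a b : AffinePart E o) : E :=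
  (exists_point_at_infinity hE ho a b).choose

theorem affine_line_inter (hE : IsPlane E) {X Y Z : P} {l : Set P} (hl : IsLine l) (hX : X ∉ E)
    (hXl : X ∈ l) (hYl : Y ∈ l) (hZl : Z ∈ l) (hY : Y ∈ E) (hZ : Z ∈ E) : Y = Z := by
  by_contra hne
  exact hX (hE.isFlat Y hY Z hZ hne l hl hYl hZl hXl)

theorem affineDir_eq_iff (hE : IsPlane E) (ho : o ∉ E) {a b : AffinePart E o} (hab : a ≠ b)
    (d : E) : affineDir hE ho a b = d ↔
      ∃ l : Set P, IsLine l ∧ a.1 ∈ l ∧ b.1 ∈ l ∧ d.1 ∈ l := by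
  have hab' : a.1 ≠ b.1 := fun h => hab (Subtype.ext h)
  have spec := (exists_point_at_infinity hE ho a b).choose_spec
  constructor
  · rintro rfl
    exact spec
  · rintro ⟨l, hl, h1, h2, h3⟩
    obtain ⟨m, hm, m1, m2, m3⟩ := spec
    have : m = l := line_unique hm hl hab' m1 m2 h1 h2
    subst this
    exact Subtype.ext (affine_line_inter hE hl a.2.2 h1 m3 h3 (Subtype.prop _) d.2)

theorem affineDir_spec (hE : IsPlane E) (ho : o ∉ E) {a b : AffinePart E o} (hab : a ≠ b) :
    (affineDir hE ho a b).1 ∈ join a.1 b.1 := by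
  obtain ⟨l, hl, h1, h2, h3⟩ := (affineDir_eq_iff hE ho hab _).mp rfl
  rwa [join_eq hl (fun h => hab (Subtype.ext h)) h1 h2]

/-- The affine part of a solid, with the plane at infinity as its plane of directions. -/
noncomputable def solidDirections (hE : IsPlane E) (ho : o ∉ E) :
    DirectionSpace (AffinePart E o) E where
  dir := affineDir hE ho
  IsAxis := fun L => IsLine (Subtype.val '' L)
  dir_comm := fun a b => by
    by_cases hab : a = b
    · rw [hab]
    · rw [affineDir_eq_iff hE ho hab]
      obtain ⟨l, hl, h1, h2, h3⟩ := (affineDir_eq_iff hE ho (Ne.symm hab) _).mp rfl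
      exact ⟨l, hl, h2, h1, h3⟩
  dir_trans := fun a b c hab hac hbc h => by
    obtain ⟨l, hl, h1, h2, h3⟩ := (affineDir_eq_iff hE ho hab _).mp rfl
    obtain ⟨m, hm, m1, m2, m3⟩ := (affineDir_eq_iff hE ho hac _).mp rfl
    rw [← h] at m3
    have : l = m := line_unique hl hm (fun e => a.2.2 (Set.mem_of_eq_of_mem e (Subtype.prop _))) h1 h3 m1 m3
    subst this
    rw [affineDir_eq_iff hE ho hbc]
    exact ⟨l, hl, h2, m2, h3⟩
  exists_dir := fun a d => by
    have hne : a.1 ≠ d.1 := fun e => a.2.2 (e ▸ d.2)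
    obtain ⟨b, hb, hba, hbd⟩ := exists_mem_ne (isLine_join hne) a.1 d.1
    have hbE : b ∉ E := fun h => hbd (affine_line_inter hE (isLine_join hne) a.2.2
      (left_mem_join _ _) hb (right_mem_join _ _) h d.2)
    have hbc : b ∈ cone o E := join_subset (isFlat_cone hE.isFlat ho) a.2.1 (subset_cone _ _ d.2) hb
    have hne' : a ≠ ⟨b, hbc, hbE⟩ := fun e => hba (congrArg Subtype.val e).symm
    exact ⟨⟨b, hbc, hbE⟩, hne'.symm, (affineDir_eq_iff hE ho hne' d).mpr
      ⟨_, isLine_join hne, left_mem_join _ _, hb, right_mem_join _ _⟩⟩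
  exists_axis := fun d e => by
    obtain ⟨l, hl, hlE, h1, -, h3⟩ := areCollinear_in_plane hE d.2 d.2 e.2 (by
      obtain ⟨l, hl, h1, h2⟩ := areCollinear_pair d.1 e.1
      exact areCollinear_triple.mpr ⟨l, hl, h1, h1, h2⟩)
    exact ⟨Subtype.val ⁻¹' l, by rwa [Subtype.image_preimage_coe, Set.inter_eq_right.mpr hlE], h1, h3⟩
  axis_unique := fun d e L M hne hL hM h1 h2 h3 h4 =>
    Set.image_injective.mpr Subtype.val_injective (line_unique hL hM (fun h => hne (Subtype.ext h))
      ⟨d, h1, rfl⟩ ⟨e, h2, rfl⟩ ⟨d, h3, rfl⟩ ⟨e, h4, rfl⟩)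
  exists_not_mem := fun L hL => by
    obtain ⟨X, hX, hXL⟩ := hE.exists_not_mem_line hL
    exact ⟨⟨X, hX⟩, fun h => hXL ⟨_, h, rfl⟩⟩
  triangle := fun a b c hab hac hbc => by
    obtain ⟨l, hl, h1, h2, h3⟩ := (affineDir_eq_iff hE ho hab _).mp rfl
    obtain ⟨m, hm, m1, m2, m3⟩ := (affineDir_eq_iff hE ho hac _).mp rfl
    obtain ⟨n, hn, n1, n2, n3⟩ := (affineDir_eq_iff hE ho hbc _).mp rfl
    have key : AreCollinear {(affineDir hE ho a b).1, (affineDir hE ho a c).1,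
        (affineDir hE ho b c).1} := by
      by_cases hbl : c.1 ∈ l
      · have e1 : affineDir hE ho a c = affineDir hE ho a b :=
          (affineDir_eq_iff hE ho hac _).mpr ⟨l, hl, h1, hbl, h3⟩
        have e2 : affineDir hE ho b c = affineDir hE ho a b :=
          (affineDir_eq_iff hE ho hbc _).mpr ⟨l, hl, h2, hbl, h3⟩
        rw [e1, e2]
        exact areCollinear_triple.mpr ⟨l, hl, h3, h3, h3⟩
      · have hG := isPlane_cone hl hbl
        have hcG := apex_mem_cone c.1 (nonempty_of_isLine hl)
        have hlG := subset_cone c.1 l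
        have d1 := hlG h3
        have d2 := hG.isFlat a.1 (hlG h1) c.1 hcG (fun h => hac (Subtype.ext h)) m hm m1 m2 m3
        have d3 := hG.isFlat b.1 (hlG h2) c.1 hcG (fun h => hbc (Subtype.ext h)) n hn n1 n2 n3
        -- Three non-collinear points at infinity would make the plane of `a`, `b`, `c` equal to
        -- `E`, although `c` is not in `E`.
        by_contra hcol
        have := hG.eq_of_mem hE hcol d1 d2 d3 (affineDir hE ho a b).2 (affineDir hE ho a c).2
          (affineDir hE ho b c).2
        exact c.2.2 (this.subset hcG)
    obtain ⟨k, hk, hkE, k1, k2, k3⟩ := areCollinear_in_plane hE (affineDir hE ho a b).2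
      (affineDir hE ho a c).2 (affineDir hE ho b c).2 key
    exact ⟨Subtype.val ⁻¹' k, by rwa [Subtype.image_preimage_coe, Set.inter_eq_right.mpr hkE],
      k1, k2, k3⟩
  complete := fun a b e f L hab hL h1 h2 h3 hef he hf => by
    have hae : a.1 ≠ e.1 := fun h => a.2.2 (h ▸ e.2)
    have hbf : b.1 ≠ f.1 := fun h => b.2.2 (h ▸ f.2)
    have hab' : a.1 ≠ b.1 := fun h => hab (Subtype.ext h)
    obtain ⟨c, hc1, hc2⟩ := lines_meet (isLine_join hae) (isLine_join hbf) (isLine_join hab') hL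
      ⟨_, affineDir_spec hE ho hab, ⟨_, h1, rfl⟩⟩ (left_mem_join _ _) (right_mem_join _ _)
      ⟨e, h2, rfl⟩ ⟨f, h3, rfl⟩ (left_mem_join _ _) (right_mem_join _ _) (left_mem_join _ _)
      (right_mem_join _ _) hae hbf
    have hcE : c ∉ E := fun h => hef <| Subtype.ext <|
      (affine_line_inter hE (isLine_join hae) a.2.2 (left_mem_join _ _) hc1 (right_mem_join _ _) h
        e.2).symm.trans
      (affine_line_inter hE (isLine_join hbf) b.2.2 (left_mem_join _ _) hc2 (right_mem_join _ _) h
        f.2)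
    have hcc : c ∈ cone o E :=
      join_subset (isFlat_cone hE.isFlat ho) a.2.1 (subset_cone _ _ e.2) hc1
    have hca : c ≠ a.1 := by
      rintro rfl
      exact hf ((affineDir_eq_iff hE ho hab f).mpr
        ⟨_, isLine_join hbf, hc2, left_mem_join _ _, right_mem_join _ _⟩).symm
    have hcb : c ≠ b.1 := by
      rintro rfl
      exact he ((affineDir_eq_iff hE ho hab e).mpr
        ⟨_, isLine_join hae, left_mem_join _ _, hc1, right_mem_join _ _⟩).symm
    have hca' : (⟨c, hcc, hcE⟩ : AffinePart E o) ≠ a := fun h => hca (congrArg Subtype.val h)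
    have hcb' : (⟨c, hcc, hcE⟩ : AffinePart E o) ≠ b := fun h => hcb (congrArg Subtype.val h)
    exact ⟨⟨c, hcc, hcE⟩, hca', hcb', (affineDir_eq_iff hE ho hca'.symm e).mpr
      ⟨_, isLine_join hae, left_mem_join _ _, hc1, right_mem_join _ _⟩,
      (affineDir_eq_iff hE ho hcb'.symm f).mpr
      ⟨_, isLine_join hbf, left_mem_join _ _, hc2, right_mem_join _ _⟩⟩

end AffinePart

end HarmonicGeometry
-- Affine and infinite points in terms of vectors.
namespace HarmonicGeometry

open PointLineGeometry DirectionSpace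

section Scalars

variable {P : Type*} [ProjectiveSpace P] {E : Set P} {o : P}

variable (hE : IsPlane E) (ho : o ∉ E)

/-- The apex of the solid, as the origin of its affine part. -/
def originPoint (hE : IsPlane E) (ho : o ∉ E) : AffinePart E o :=
  ⟨o, apex_mem_cone o hE.nonempty, ho⟩

/-- The vectors of the affine part of a solid. -/
abbrev SolidVec : Type _ := (solidDirections hE ho).Vec

/-- The scalars of the affine part of a solid. -/
abbrev SolidScalars : Type _ := (solidDirections hE ho).scalars (originPoint hE ho)

/-- The affine point with a given position vector. -/
noncomputable def affinePoint (v : SolidVec hE ho) : P := (shift v (originPoint hE ho)).1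

/-- The point at infinity in the direction of a given vector. -/
noncomputable def infinitePoint (v : SolidVec hE ho) : P :=
  ((solidDirections hE ho).dir (originPoint hE ho) (shift v (originPoint hE ho))).1

variable {hE ho}

theorem infinitePoint_mem (v : SolidVec hE ho) : infinitePoint hE ho v ∈ E := Subtype.prop _

theorem affinePoint_not_mem (v : SolidVec hE ho) : affinePoint hE ho v ∉ E :=
  (shift v (originPoint hE ho)).2.2

theorem affinePoint_injective {v w : SolidVec hE ho} (h : affinePoint hE ho v = affinePoint hE ho w) :
    v = w := vec_ext (Subtype.ext h)

theorem exists_affinePoint {X : P} (hX : X ∈ cone o E) (hXE : X ∉ E) :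
    ∃ v, affinePoint hE ho v = X := by
  obtain ⟨v, hv⟩ := exists_shift (G := solidDirections hE ho) (originPoint hE ho) ⟨X, hX, hXE⟩
  exact ⟨v, congrArg Subtype.val hv⟩

/-- The translation `w - v` takes the first point to the second, and its direction is the same at
every point, so it can be read off at the origin. -/
theorem infinitePoint_mem_line {v w : SolidVec hE ho} (hvw : v ≠ w) {l : Set P} (hl : IsLine l)
    (hv : affinePoint hE ho v ∈ l) (hw : affinePoint hE ho w ∈ l) :
    infinitePoint hE ho (w - v) ∈ l := by
  have hne : shift v (originPoint hE ho) ≠ shift w (originPoint hE ho) :=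
    fun h => hvw (vec_ext h)
  have h0 : w - v ≠ 0 := sub_ne_zero.mpr hvw.symm
  have h2 : shift (w - v) (shift v (originPoint hE ho)) = shift w (originPoint hE ho) := by
    rw [← shift_add, sub_add_cancel]
  have h1 := dir_shift h0 (originPoint hE ho) (shift v (originPoint hE ho))
  rw [h2] at h1
  unfold infinitePoint
  rw [h1]
  have := affineDir_spec hE ho hne
  rwa [join_eq hl (fun h => hne (Subtype.ext h)) hv hw] at this

theorem infinitePoint_eq_iff {v w : SolidVec hE ho} (hv : v ≠ 0) (hw : w ≠ 0) :
    infinitePoint hE ho v = infinitePoint hE ho w ↔ ∃ c : SolidScalars hE ho, w = c • v := by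
  rw [← dir_shift_eq_iff hv hw]
  exact Subtype.ext_iff.symm

theorem exists_infinitePoint (hE : IsPlane E) (ho : o ∉ E) {X : P} (hX : X ∈ E) :
    ∃ v, v ≠ 0 ∧ infinitePoint hE ho v = X := by
  obtain ⟨b, hb, h⟩ := (solidDirections hE ho).exists_dir (originPoint hE ho) ⟨X, hX⟩
  obtain ⟨v, rfl⟩ := exists_shift (G := solidDirections hE ho) (originPoint hE ho) b
  refine ⟨v, ?_, congrArg Subtype.val h⟩
  rintro rfl
  exact hb rfl

theorem infinitePoint_collinear_iff {u v w : SolidVec hE ho} (hu : u ≠ 0) (hv : v ≠ 0)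
    (hw : w ≠ 0) :
    AreCollinear {infinitePoint hE ho u, infinitePoint hE ho v, infinitePoint hE ho w} ↔
      ∃ a b c : SolidScalars hE ho, (a ≠ 0 ∨ b ≠ 0 ∨ c ≠ 0) ∧ a • u + b • v + c • w = 0 := by
  rw [← axis_iff hu hv hw]
  constructor
  · intro h
    obtain ⟨l, hl, hlE, h1, h2, h3⟩ := areCollinear_in_plane hE (infinitePoint_mem u)
      (infinitePoint_mem v) (infinitePoint_mem w) h
    exact ⟨Subtype.val ⁻¹' l, show IsLine (Subtype.val '' (Subtype.val ⁻¹' l : Set E)) by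
      rwa [Subtype.image_preimage_coe, Set.inter_eq_right.mpr hlE], h1, h2, h3⟩
  · rintro ⟨L, hL, h1, h2, h3⟩
    exact areCollinear_triple.mpr ⟨_, hL, ⟨_, h1, rfl⟩, ⟨_, h2, rfl⟩, ⟨_, h3, rfl⟩⟩

/-- The points of the line through `affinePoint v` in the direction of `w`. -/
theorem affinePoint_mem_join_iff {v w x : SolidVec hE ho} (hw : w ≠ 0) :
    affinePoint hE ho x ∈ join (affinePoint hE ho v) (infinitePoint hE ho w) ↔
      ∃ c : SolidScalars hE ho, x = v + c • w := by
  have hne : affinePoint hE ho v ≠ infinitePoint hE ho w :=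
    fun h => affinePoint_not_mem v (h ▸ infinitePoint_mem w)
  have hl := isLine_join hne
  by_cases hxv : v = x
  · subst hxv
    exact ⟨fun _ => ⟨0, by simp⟩, fun _ => left_mem_join _ _⟩
  constructor
  · intro h
    have h1 := infinitePoint_mem_line hxv hl (left_mem_join _ _) h
    have h2 := affine_line_inter hE hl (affinePoint_not_mem v) (left_mem_join _ _)
      (right_mem_join _ _) h1 (infinitePoint_mem w) (infinitePoint_mem _)
    obtain ⟨c, hc⟩ := (infinitePoint_eq_iff hw (sub_ne_zero.mpr (Ne.symm hxv))).mp h2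
    exact ⟨c, by rw [← hc]; abel⟩
  · rintro ⟨c, rfl⟩
    have hne' : affinePoint hE ho v ≠ affinePoint hE ho (v + c • w) :=
      fun h => hxv (affinePoint_injective h)
    have h1 := infinitePoint_mem_line hxv (isLine_join hne') (left_mem_join _ _)
      (right_mem_join _ _)
    have h0 : c • w ≠ 0 := fun h => hxv (by rw [h, add_zero])
    rw [add_sub_cancel_left, ← (infinitePoint_eq_iff hw h0).mpr ⟨c, rfl⟩] at h1
    rw [join_eq (isLine_join hne') hne (left_mem_join _ _) h1]
    exact right_mem_join _ _

/-- The second alternative is a common point in `E`. This criterion decides incidence between the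
lines of the two families in `scalars_mul_comm`. -/
theorem affine_lines_meet_iff {v w v' w' : SolidVec hE ho} (hw : w ≠ 0) (hw' : w' ≠ 0) :
    (join (affinePoint hE ho v) (infinitePoint hE ho w) ∩
      join (affinePoint hE ho v') (infinitePoint hE ho w')).Nonempty ↔
    (∃ c c' : SolidScalars hE ho, v + c • w = v' + c' • w') ∨
      ∃ c : SolidScalars hE ho, w' = c • w := by
  have hne : ∀ v w : SolidVec hE ho, affinePoint hE ho v ≠ infinitePoint hE ho w :=
    fun v w h => affinePoint_not_mem v (h ▸ infinitePoint_mem w)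
  constructor
  · rintro ⟨X, h1, h2⟩
    by_cases hX : X ∈ E
    · right
      rw [← infinitePoint_eq_iff hw hw']
      exact (affine_line_inter hE (isLine_join (hne v w)) (affinePoint_not_mem v)
        (left_mem_join _ _) (right_mem_join _ _) h1 (infinitePoint_mem w) hX).trans
        (affine_line_inter hE (isLine_join (hne v' w')) (affinePoint_not_mem v')
        (left_mem_join _ _) (right_mem_join _ _) h2 (infinitePoint_mem w') hX).symm
    · left
      have hXc : X ∈ cone o E := join_subset (isFlat_cone hE.isFlat ho)
        (shift v (originPoint hE ho)).2.1 (subset_cone _ _ (infinitePoint_mem w)) h1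
      obtain ⟨x, rfl⟩ := exists_affinePoint (hE := hE) (ho := ho) hXc hX
      obtain ⟨c, hc⟩ := (affinePoint_mem_join_iff hw).mp h1
      obtain ⟨c', hc'⟩ := (affinePoint_mem_join_iff hw').mp h2
      exact ⟨c, c', hc ▸ hc'⟩
  · rintro (⟨c, c', h⟩ | h)
    · exact ⟨affinePoint hE ho (v + c • w), (affinePoint_mem_join_iff hw).mpr ⟨c, rfl⟩,
        (affinePoint_mem_join_iff hw').mpr ⟨c', h⟩⟩
    · rw [← infinitePoint_eq_iff hw hw'] at h
      exact ⟨_, right_mem_join _ _, h ▸ right_mem_join _ _⟩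

/-- Three vectors with non-collinear directions form a basis. -/
theorem exists_frame (hE : IsPlane E) (ho : o ∉ E) : ∃ e₁ e₂ e₃ : SolidVec hE ho,
    e₁ ≠ 0 ∧ e₂ ≠ 0 ∧ e₃ ≠ 0 ∧ (∀ a b c : SolidScalars hE ho,
      a • e₁ + b • e₂ + c • e₃ = 0 → a = 0 ∧ b = 0 ∧ c = 0) ∧
    ∀ v, ∃ a b c : SolidScalars hE ho, v = a • e₁ + b • e₂ + c • e₃ := by
  obtain ⟨A, B, C, hABC, hspan⟩ := id hE
  have hne := ne_of_not_areCollinear hABC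
  have hA : A ∈ E := hspan ▸ subset_flatSpan _ (by simp)
  have hB : B ∈ E := hspan ▸ subset_flatSpan _ (by simp)
  have hC : C ∈ E := hspan ▸ subset_flatSpan _ (by simp)
  obtain ⟨e₁, h1, rfl⟩ := exists_infinitePoint hE ho hA
  obtain ⟨e₂, h2, rfl⟩ := exists_infinitePoint hE ho hB
  obtain ⟨e₃, h3, rfl⟩ := exists_infinitePoint hE ho hC
  have key : ∀ {u v w : SolidVec hE ho}, u ≠ 0 → v ≠ 0 → w ≠ 0 →
      infinitePoint hE ho u ≠ infinitePoint hE ho v →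
      AreCollinear {infinitePoint hE ho u, infinitePoint hE ho v, infinitePoint hE ho w} →
      ∃ a b : SolidScalars hE ho, w = a • u + b • v := by
    intro u v w hu hv hw hne h
    obtain ⟨a, b, c, habc, h⟩ := (infinitePoint_collinear_iff hu hv hw).mp h
    have hc : c ≠ 0 := by
      rintro rfl
      rw [zero_smul, add_zero] at h
      apply hne
      by_cases hb : b = 0
      · subst hb
        rw [zero_smul, add_zero, smul_eq_zero] at h
        simp_all
      · rw [infinitePoint_eq_iff hu hv]
        refine ⟨-(b⁻¹ * a), ?_⟩
        have : b • v = -(a • u) := eq_neg_of_add_eq_zero_right h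
        calc v = b⁻¹ • (b • v) := by rw [smul_smul, inv_mul_cancel₀ hb, one_smul]
          _ = _ := by rw [this, smul_neg, smul_smul, neg_smul]
    refine ⟨-(c⁻¹ * a), -(c⁻¹ * b), ?_⟩
    have h2 : w = c⁻¹ • (c • w) := by rw [smul_smul, inv_mul_cancel₀ hc, one_smul]
    rw [h2, eq_neg_of_add_eq_zero_right h, smul_neg, smul_add, smul_smul, smul_smul, neg_smul,
      neg_smul]
    abel
  refine ⟨e₁, e₂, e₃, h1, h2, h3, fun a b c h => ?_, fun v => ?_⟩
  · by_contra h'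
    exact hABC ((infinitePoint_collinear_iff h1 h2 h3).mpr ⟨a, b, c, by tauto, h⟩)
  · by_cases hv : v = 0
    · exact ⟨0, 0, 0, by simp [hv]⟩
    have hm : infinitePoint hE ho e₁ ∉ join (infinitePoint hE ho e₂) (infinitePoint hE ho e₃) :=
      (flatSpan_triple hABC).2
    by_cases hv1 : infinitePoint hE ho e₁ = infinitePoint hE ho v
    · obtain ⟨c, hc⟩ := (infinitePoint_eq_iff h1 hv).mp hv1
      exact ⟨c, 0, 0, by simp [hc]⟩
    -- The line from the first frame point to that of `v` meets the opposite side. So `v` is a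
    -- combination of `e₁` and a vector `x`, which is itself a combination of `e₂` and `e₃`.
    obtain ⟨X, hX1, hX2⟩ := hE.lines_meet (isLine_join hv1) (isLine_join hne.2.2)
      (join_subset hE.isFlat (infinitePoint_mem _) (infinitePoint_mem _))
      (join_subset hE.isFlat (infinitePoint_mem _) (infinitePoint_mem _))
    have hXE := join_subset hE.isFlat (infinitePoint_mem e₂) (infinitePoint_mem e₃) hX2
    obtain ⟨x, hx, rfl⟩ := exists_infinitePoint hE ho hXE
    have hx1 : infinitePoint hE ho e₁ ≠ infinitePoint hE ho x := fun h => hm (h ▸ hX2)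
    obtain ⟨a, b, hab⟩ := key h2 h3 hx hne.2.2 (areCollinear_triple.mpr
      ⟨_, isLine_join hne.2.2, left_mem_join _ _, right_mem_join _ _, hX2⟩)
    obtain ⟨c, d, hcd⟩ := key h1 hx hv hx1 (areCollinear_triple.mpr
      ⟨_, isLine_join hv1, left_mem_join _ _, hX1, right_mem_join _ _⟩)
    exact ⟨c, d * a, d * b, by rw [hcd, hab, smul_add, smul_smul, smul_smul, add_assoc]⟩

end Scalars

end HarmonicGeometry
-- Characteristic, commutativity, and charts of planes.
namespace HarmonicGeometry

open PointLineGeometry DirectionSpace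

section ScalarField

variable {P : Type*} [ProjectiveSpace P] {E : Set P} {o : P}

variable (hE : IsPlane E) (ho : o ∉ E)

theorem not_areCollinear_affine {hE : IsPlane E} {ho : o ∉ E} {u v w : SolidVec hE ho} (huv : u ≠ v)
    (huw : u ≠ w) (h : ∀ c : SolidScalars hE ho, w - u ≠ c • (v - u)) :
    ¬ AreCollinear {affinePoint hE ho u, affinePoint hE ho v, affinePoint hE ho w} := by
  rw [areCollinear_triple]
  rintro ⟨l, hl, h1, h2, h3⟩
  have e := affine_line_inter hE hl (affinePoint_not_mem u) h1 (infinitePoint_mem_line huv hl h1 h2)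
    (infinitePoint_mem_line huw hl h1 h3) (infinitePoint_mem _) (infinitePoint_mem _)
  obtain ⟨c, hc⟩ := (infinitePoint_eq_iff (sub_ne_zero.mpr huv.symm)
    (sub_ne_zero.mpr huw.symm)).mp e
  exact h c hc

/-- The diagonals of a parallelogram are not parallel, by the axiom on harmonic fourths. -/
theorem scalars_two_ne_zero : (2 : SolidScalars hE ho) ≠ 0 := by
  intro h2
  obtain ⟨v, w, _, hv, hw, -, hind, -⟩ := exists_frame hE ho
  have hi : ∀ a b : SolidScalars hE ho, a • v + b • w = 0 → a = 0 ∧ b = 0 := fun a b h =>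
    ⟨(hind a b 0 (by simpa using h)).1, (hind a b 0 (by simpa using h)).2.1⟩
  have h11 : ∀ x : SolidVec hE ho, x + x = 0 := fun x => by
    rw [← two_smul (SolidScalars hE ho) x, h2, zero_smul]
  have hneg : ∀ x : SolidVec hE ho, -x = x := fun x => neg_eq_of_add_eq_zero_left (h11 x)
  have h10 : (1 : SolidScalars hE ho) ≠ 0 := one_ne_zero
  have hvw : v + w ≠ 0 := fun h => h10 (hi 1 1 (by simpa using h)).1
  have hne : v ≠ w := fun h => h10 (hi 1 (-1) (by simp [h])).1
  set p := affinePoint hE ho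
  set d := infinitePoint hE ho
  have inj : ∀ {x y}, x ≠ y → p x ≠ p y := fun h e => h (affinePoint_injective e)
  have dmem : ∀ {x y}, x ≠ y → d (y - x) ∈ join (p x) (p y) := fun {x y} h =>
    infinitePoint_mem_line h (isLine_join (inj h)) (left_mem_join _ _) (right_mem_join _ _)
  have n0v : (0 : SolidVec hE ho) ≠ v := hv.symm
  have nvr : v ≠ v + w := fun h => hw (by simpa using h)
  have nrw : v + w ≠ w := fun h => hv (by simpa using h)
  have dA : d v ∈ join (p 0) (p v) := by simpa using dmem n0v
  have dA' : d v ∈ join (p (v + w)) (p w) := by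
    have := dmem nrw
    rwa [show w - (v + w) = -v by abel, hneg] at this
  have dB : d w ∈ join (p v) (p (v + w)) := by simpa using dmem nvr
  have dB' : d w ∈ join (p w) (p 0) := by
    have := dmem hw
    rwa [zero_sub, hneg] at this
  have dC : d (v + w) ∈ join (p 0) (p (v + w)) := by simpa using dmem hvw.symm
  have dD : d (v + w) ∈ join (p v) (p w) := by
    have := dmem hne
    rwa [sub_eq_add_neg, hneg, add_comm] at this
  have c1 : ¬ AreCollinear {p 0, p v, p (v + w)} := not_areCollinear_affine n0v hvw.symm fun c h => by
    have := (hi (1 - c) 1 (by rw [sub_zero, sub_zero] at h; rw [sub_smul, ← h, one_smul, one_smul]; abel)).2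
    exact h10 this
  have c2 : ¬ AreCollinear {p v, p (v + w), p w} := not_areCollinear_affine nvr hne fun c h => by
    have := (hi (-1) (1 - c) (by
      rw [add_sub_cancel_left] at h
      rw [sub_smul, ← h, neg_smul, one_smul, one_smul]; abel)).1
    exact h10 (by simp at this)
  have c3 : ¬ AreCollinear {p (v + w), p w, p 0} := not_areCollinear_affine nrw hvw fun c h => by
    have := (hi (c - 1) (-1) (by
      rw [zero_sub, show w - (v + w) = -v by abel, smul_neg, neg_inj] at h
      rw [sub_smul, ← h, neg_smul, one_smul, one_smul]; abel)).2
    exact h10 (by simp at this)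
  have c4 : ¬ AreCollinear {p w, p 0, p v} := not_areCollinear_affine hw hne.symm fun c h => by
    have := (hi 1 (c - 1) (by
      rw [zero_sub, smul_neg] at h
      rw [sub_smul, one_smul, one_smul, ← neg_eq_iff_eq_neg.mpr h]; abel)).1
    exact h10 this
  have hcol : ∀ x y z : SolidVec hE ho, x ≠ 0 → y ≠ 0 → z ≠ 0 →
      (∃ a b c : SolidScalars hE ho, (a ≠ 0 ∨ b ≠ 0 ∨ c ≠ 0) ∧ a • x + b • y + c • z = 0) →
      AreCollinear {d x, d y, d z} := fun x y z hx hy hz =>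
    (infinitePoint_collinear_iff hx hy hz).mpr
  obtain ⟨l, hl, l1, l2, l3⟩ := areCollinear_triple.mp (hcol v (v + w) w hv hvw hw
    ⟨1, -1, 1, Or.inl h10, by simp only [neg_smul, one_smul]; abel⟩)
  have hds : ∀ x y : SolidVec hE ho, x ≠ 0 → y ≠ 0 → (∀ c : SolidScalars hE ho, y ≠ c • x) →
      d x ≠ d y := fun x y hx hy h e => by
    obtain ⟨c, hc⟩ := (infinitePoint_eq_iff hx hy).mp e
    exact h c hc
  obtain ⟨G, hG, hG1, hG2⟩ := exists_isPlane_of_lines_meet (isLine_join (inj n0v))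
    (isLine_join (inj hw)) ⟨_, left_mem_join _ _, right_mem_join _ _⟩ (fun e => c4 <| by
      exact areCollinear_triple.mpr ⟨_, isLine_join (inj hw), left_mem_join _ _, right_mem_join _ _,
        e ▸ right_mem_join _ _⟩)
  have hmix : ∀ x y, p x ≠ d y := fun x y h =>
    affinePoint_not_mem x (Set.mem_of_eq_of_mem h (infinitePoint_mem y))
  have hrG : p (v + w) ∈ G := by
    refine hG.isFlat _ (hG1 (right_mem_join _ _)) _ (hG2 dB') (hmix v w) _ (isLine_join (inj nvr))
      (left_mem_join _ _) dB (right_mem_join _ _)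
  -- The parallelogram `0`, `v`, `v + w`, `w` has diagonals in the directions `v + w` and `w - v`.
  -- With `2 = 0` these coincide, so a point would be its own harmonic conjugate.
  have hS : IsHarmonicSet (d v) (d (v + w)) (d w) (d (v + w)) := by
    refine ⟨⟨l, hl, ?_⟩, p 0, p v, p (v + w), p w, ⟨⟨G, hG, hG1 (left_mem_join _ _),
      hG1 (right_mem_join _ _), hrG, hG2 (left_mem_join _ _)⟩, c1, c2, c3, c4⟩, ⟨dA, dA'⟩,
      ⟨dB, dB'⟩, dC, dD⟩
    simp [Set.insert_subset_iff, l1, l2, l3]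
  refine (ProjectiveSpace.harmonic_fourth_ne _ _ _ _ ?_ ?_ ?_ hS).2.1 rfl
  · refine hds _ _ hv hvw fun c h => h10 (hi (1 - c) 1 ?_).2
    rw [sub_smul, ← h, one_smul, one_smul]; abel
  · refine hds _ _ hvw hw fun c h => ?_
    rw [smul_add] at h
    have := hi c (c - 1) (by rw [sub_smul, one_smul, ← add_sub_assoc, ← h, sub_self])
    exact h10 (by rw [← sub_sub_cancel c 1, this.2, this.1, sub_zero])
  · refine hds _ _ hv hw fun c h => h10 (hi (-c) 1 ?_).2
    rw [neg_smul, one_smul, ← h]; abel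

/-- The scalars commute, by the axiom on rulings. -/
theorem scalars_mul_comm (s t : SolidScalars hE ho) : s * t = t * s := by
  by_contra hst
  obtain ⟨e₁, e₂, e₃, -, -, -, hind, -⟩ := exists_frame hE ho
  have hinj : ∀ {a b c a' b' c' : SolidScalars hE ho},
      a • e₁ + b • e₂ + c • e₃ = a' • e₁ + b' • e₂ + c' • e₃ → a = a' ∧ b = b' ∧ c = c' := by
    intro a b c a' b' c' h
    have := hind (a - a') (b - b') (c - c') (by
      rw [← sub_eq_zero.mpr h]; simp only [sub_smul]; abel)
    exact ⟨sub_eq_zero.mp this.1, sub_eq_zero.mp this.2.1, sub_eq_zero.mp this.2.2⟩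
  have h10 : (1 : SolidScalars hE ho) ≠ 0 := one_ne_zero
  have hL0 : ∀ s : SolidScalars hE ho, e₂ + s • e₃ ≠ 0 := fun s h =>
    h10 (hind 0 1 s (by simpa using h)).2.1
  have hM0 : ∀ t : SolidScalars hE ho, e₁ + t • e₃ ≠ 0 := fun t h =>
    h10 (hind 1 0 t (by simpa using h)).1
  -- The two families of lines on the paraboloid `z = x y`. The line `L s` consists of the points
  -- `(s, c, c s)` and `M t` of the points `(c, t, c t)`, so in affine space they can only meet over
  -- `x = s`, `y = t`, and they do so exactly when `s` and `t` commute.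
  let L : SolidScalars hE ho → Set P := fun s =>
    join (affinePoint hE ho (s • e₁)) (infinitePoint hE ho (e₂ + s • e₃))
  let M : SolidScalars hE ho → Set P := fun t =>
    join (affinePoint hE ho (t • e₂)) (infinitePoint hE ho (e₁ + t • e₃))
  have line : ∀ x y : SolidVec hE ho,
      IsLine (join (affinePoint hE ho x) (infinitePoint hE ho y)) := fun x y =>
    isLine_join fun h => affinePoint_not_mem x (h ▸ infinitePoint_mem y)
  have hLL : ∀ s s', s ≠ s' → Disjoint (L s) (L s') := by
    intro s s' hne
    rw [Set.disjoint_iff_inter_eq_empty, ← Set.not_nonempty_iff_eq_empty]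
    change ¬ (join _ _ ∩ join _ _).Nonempty
    rw [affine_lines_meet_iff (hL0 s) (hL0 s')]
    rintro (⟨c, c', h⟩ | ⟨c, h⟩)
    · refine hne (hinj (b := c) (c := c * s) (b' := c') (c' := c' * s') ?_).1
      simpa only [smul_add, smul_smul, add_assoc] using h
    · have := hinj (a := 0) (b := 1) (c := s') (a' := 0) (b' := c) (c' := c * s) (by
        simpa only [smul_add, smul_smul, zero_smul, zero_add, one_smul] using h)
      exact hne (by rw [this.2.2, ← this.2.1, one_mul])
  have hMM : ∀ t t', t ≠ t' → Disjoint (M t) (M t') := by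
    intro t t' hne
    rw [Set.disjoint_iff_inter_eq_empty, ← Set.not_nonempty_iff_eq_empty]
    change ¬ (join _ _ ∩ join _ _).Nonempty
    rw [affine_lines_meet_iff (hM0 t) (hM0 t')]
    rintro (⟨c, c', h⟩ | ⟨c, h⟩)
    · refine hne (hinj (a := c) (b := t) (c := c * t) (a' := c') (b' := t') (c' := c' * t') ?_).2.1
      rw [smul_add, smul_add, smul_smul, smul_smul] at h
      rw [add_comm (c • e₁), add_comm (c' • e₁), add_assoc, add_assoc, h]
    · have := hinj (a := 1) (b := 0) (c := t') (a' := c) (b' := 0) (c' := c * t) (by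
        simpa only [smul_add, smul_smul, zero_smul, add_zero, one_smul] using h)
      exact hne (by rw [this.2.2, ← this.1, one_mul])
  have hML : ∀ t s, (M t ∩ L s).Nonempty ↔ s * t = t * s := by
    intro t s
    change (join _ _ ∩ join _ _).Nonempty ↔ _
    rw [affine_lines_meet_iff (hM0 t) (hL0 s)]
    constructor
    · rintro (⟨c, c', h⟩ | ⟨c, h⟩)
      · have := hinj (a := c) (b := t) (c := c * t) (a' := s) (b' := c') (c' := c' * s) (by
          rw [smul_add, smul_add, smul_smul, smul_smul] at h
          rw [add_comm (c • e₁), add_assoc, add_assoc, h])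
        rw [← this.1, this.2.2, ← this.2.1, this.1]
      · have := hinj (a := 0) (b := 1) (c := s) (a' := c) (b' := 0) (c' := c * t) (by
          simpa only [smul_add, smul_smul, zero_smul, zero_add, add_zero, one_smul] using h)
        exact absurd this.2.1 h10
    · intro h
      refine Or.inl ⟨s, t, ?_⟩
      rw [smul_add, smul_add, smul_smul, smul_smul, h]
      abel
  have h2 := scalars_two_ne_zero hE ho
  have n1 : (1 : SolidScalars hE ho) ≠ -1 := fun h => h2 (by
    rw [← one_add_one_eq_two]; nth_rw 2 [h]; exact add_neg_cancel 1)
  have n0 : (0 : SolidScalars hE ho) ≠ -1 := fun h => h10 (by rw [← neg_eq_zero, ← h])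
  -- The parameters `0`, `1`, `-1` are central, and they are distinct because `2 ≠ 0`.
  have gM : InGeneralPosition (M 0) (M 1) (M (-1)) :=
    ⟨line _ _, line _ _, line _ _, hMM _ _ h10.symm, hMM _ _ n1, hMM _ _ n0⟩
  have gL : InGeneralPosition (L 0) (L 1) (L (-1)) :=
    ⟨line _ _, line _ _, line _ _, hLL _ _ h10.symm, hLL _ _ n1, hLL _ _ n0⟩
  have gL' : InGeneralPosition (L 0) (L 1) (L s) :=
    ⟨line _ _, line _ _, line _ _, hLL _ _ h10.symm, hLL _ _ (by rintro rfl; simp at hst),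
      hLL _ _ (by rintro rfl; simp at hst)⟩
  have mem : ∀ t s', s' * t = t * s' → M t ∈ transversalRuling (L 0) (L 1) (L s') := fun t s' h =>
    ⟨line _ _, (hML _ _).mpr (by simp), (hML _ _).mpr (by simp), (hML _ _).mpr h⟩
  -- The lines `M 0`, `M 1`, `M (-1)` are transversal both to `L 0`, `L 1`, `L (-1)` and to `L 0`,
  -- `L 1`, `L s`, so the two rulings agree. As `M t` belongs to the first, it meets `L s`.
  have heq := ProjectiveSpace.equipal _ _ _ gM _ _ ⟨_, _, _, gL, rfl⟩ ⟨_, _, _, gL', rfl⟩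
    (mem 0 (-1) (by simp)) (mem 1 (-1) (by simp)) (mem (-1) (-1) (by simp))
    (mem 0 s (by simp)) (mem 1 s (by simp)) (mem (-1) s (by simp))
  have ht : M t ∈ transversalRuling (L 0) (L 1) (L s) := heq ▸ mem t (-1) (by simp)
  exact hst ((hML t s).mp ht.2.2.2)

noncomputable instance : Field (SolidScalars hE ho) :=
  { (inferInstance : DivisionRing (SolidScalars hE ho)) with mul_comm := scalars_mul_comm hE ho }

end ScalarField

/-- Homogeneous coordinates for a plane. -/
structure PlaneChart {P : Type*} [ProjectiveSpace P] (E : Set P) (F : Type*) [Field F] where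
  /-- The point with given homogeneous coordinates. -/
  pt : (Fin 3 → F) → P
  isPlane : IsPlane E
  pt_mem : ∀ {v}, v ≠ 0 → pt v ∈ E
  exists_pt : ∀ {X}, X ∈ E → ∃ v, v ≠ 0 ∧ pt v = X
  pt_eq_iff : ∀ {v w}, v ≠ 0 → w ≠ 0 → (pt v = pt w ↔ ∃ c : F, w = c • v)
  collinear_iff : ∀ {u v w}, u ≠ 0 → v ≠ 0 → w ≠ 0 → (AreCollinear {pt u, pt v, pt w} ↔
    ∃ a b c : F, (a ≠ 0 ∨ b ≠ 0 ∨ c ≠ 0) ∧ a • u + b • v + c • w = 0)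
  two_ne_zero : (2 : F) ≠ 0

/-- Every plane has homogeneous coordinates over a field. -/
theorem exists_planeChart.{u} {P : Type u} [ProjectiveSpace P] {E : Set P} (hE : IsPlane E) :
    ∃ (F : Type u) (_ : Field F), Nonempty (PlaneChart E F) := by
  obtain ⟨o, ho⟩ := hE.exists_not_mem
  obtain ⟨e₁, e₂, e₃, -, -, -, hind, hspan⟩ := exists_frame hE ho
  let T : (Fin 3 → SolidScalars hE ho) →ₗ[SolidScalars hE ho] SolidVec hE ho :=
    Fintype.linearCombination (SolidScalars hE ho) ![e₁, e₂, e₃]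
  have hT : ∀ v, T v = v 0 • e₁ + v 1 • e₂ + v 2 • e₃ := fun v => by
    simp [T, Fintype.linearCombination_apply, Fin.sum_univ_three]
  have hinj : ∀ {v}, T v = 0 → v = 0 := fun {v} h => by
    rw [hT] at h
    obtain ⟨h0, h1, h2⟩ := hind _ _ _ h
    funext i; fin_cases i <;> assumption
  have hne : ∀ {v}, v ≠ 0 → T v ≠ 0 := fun h e => h (hinj e)
  have heq : ∀ {v w}, T v = T w ↔ v = w := fun {v w} =>
    ⟨fun h => sub_eq_zero.mp (hinj (by rw [map_sub, h, sub_self])), fun h => by rw [h]⟩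
  -- Points of `E` are directions of vectors, so coordinates of vectors are homogeneous coordinates
  -- of points.
  refine ⟨SolidScalars hE ho, inferInstance, ⟨⟨fun v => infinitePoint hE ho (T v), hE,
    fun _ => infinitePoint_mem _, ?_, ?_, ?_, scalars_two_ne_zero hE ho⟩⟩⟩
  · intro X hX
    obtain ⟨x, hx, rfl⟩ := exists_infinitePoint hE ho hX
    obtain ⟨a, b, c, rfl⟩ := hspan x
    have e : T ![a, b, c] = a • e₁ + b • e₂ + c • e₃ := by rw [hT]; rfl
    refine ⟨![a, b, c], fun h => hx ?_, by rw [e]⟩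
    rw [← e, h, map_zero]
  · intro v w hv hw
    rw [infinitePoint_eq_iff (hne hv) (hne hw)]
    refine exists_congr fun c => ?_
    rw [← map_smul, heq]
  · intro u v w hu hv hw
    rw [infinitePoint_collinear_iff (hne hu) (hne hv) (hne hw)]
    refine exists_congr fun a => exists_congr fun b => exists_congr fun c => and_congr_right' ?_
    rw [← map_smul, ← map_smul, ← map_smul, ← map_add, ← map_add, ← map_zero T, heq]

end HarmonicGeometry
-- Cross products and lines in coordinates.
namespace HarmonicGeometry

open PointLineGeometry Matrix

section Vectors

variable {F : Type*} [Field F]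

theorem cross_eq_zero_iff {u v : Fin 3 → F} (hu : u ≠ 0) : u ⨯₃ v = 0 ↔ ∃ c : F, v = c • u := by
  constructor
  · intro h
    have h0 := congrFun h 0
    have h1 := congrFun h 1
    have h2 := congrFun h 2
    simp only [cross_apply, Pi.zero_apply, cons_val] at h0 h1 h2
    obtain ⟨i, hi⟩ := Function.ne_iff.mp hu
    refine ⟨v i / u i, ?_⟩
    funext j
    simp only [Pi.smul_apply, smul_eq_mul, Pi.zero_apply] at hi ⊢
    rw [div_mul_eq_mul_div, eq_div_iff hi]
    fin_cases i <;> fin_cases j <;> simp only [Fin.zero_eta, Fin.mk_one, Fin.reduceFinMk] <;> grind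
  · rintro ⟨c, rfl⟩
    simp

theorem left_ne_zero_of_cross {u v : Fin 3 → F} (h : u ⨯₃ v ≠ 0) : u ≠ 0 := by
  rintro rfl; simp at h

theorem right_ne_zero_of_cross {u v : Fin 3 → F} (h : u ⨯₃ v ≠ 0) : v ≠ 0 := by
  rintro rfl; simp at h

/-- The vectors orthogonal to two independent vectors are the multiples of the cross product. -/
theorem exists_smul_cross {f g w : Fin 3 → F} (h : f ⨯₃ g ≠ 0) (hf : f ⬝ᵥ w = 0)
    (hg : g ⬝ᵥ w = 0) : ∃ c : F, w = c • (f ⨯₃ g) := by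
  rw [← cross_eq_zero_iff h]
  rw [vec3_dotProduct] at hf hg
  funext i
  fin_cases i <;> simp only [cross_apply, Pi.zero_apply, cons_val, Fin.zero_eta, Fin.mk_one, Fin.reduceFinMk] <;> grind

theorem exists_dependence_iff (u v w : Fin 3 → F) :
    (∃ a b c : F, (a ≠ 0 ∨ b ≠ 0 ∨ c ≠ 0) ∧ a • u + b • v + c • w = 0) ↔ u ⬝ᵥ v ⨯₃ w = 0 := by
  rw [triple_product_eq_det]
  refine Iff.trans ?_ (Matrix.exists_vecMul_eq_zero_iff (M := Matrix.of ![u, v, w]))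
  constructor
  · rintro ⟨a, b, c, h, e⟩
    refine ⟨![a, b, c], fun h0 => ?_, ?_⟩
    · have h1 := congrFun h0 0
      have h2 := congrFun h0 1
      have h3 := congrFun h0 2
      simp at h1 h2 h3
      tauto
    · rw [Matrix.vecMul_eq_sum, Fin.sum_univ_three]; exact e
  · rintro ⟨x, hx, e⟩
    rw [Matrix.vecMul_eq_sum, Fin.sum_univ_three] at e
    refine ⟨x 0, x 1, x 2, ?_, e⟩
    by_contra h
    push Not at h
    apply hx
    funext i
    fin_cases i
    exacts [h.1, h.2.1, h.2.2]

end Vectors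

namespace PlaneChart

variable {P : Type*} [ProjectiveSpace P] {E : Set P} {F : Type*} [Field F] (φ : PlaneChart E F)

theorem areCollinear_iff {u v w : Fin 3 → F} (hu : u ≠ 0) (hv : v ≠ 0) (hw : w ≠ 0) :
    AreCollinear {φ.pt u, φ.pt v, φ.pt w} ↔ u ⬝ᵥ v ⨯₃ w = 0 := by
  rw [φ.collinear_iff hu hv hw, exists_dependence_iff]

theorem pt_eq_iff_cross {u v : Fin 3 → F} (hu : u ≠ 0) (hv : v ≠ 0) :
    φ.pt u = φ.pt v ↔ u ⨯₃ v = 0 := by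
  rw [φ.pt_eq_iff hu hv, cross_eq_zero_iff hu]

theorem pt_smul {c : F} (hc : c ≠ 0) {v : Fin 3 → F} (hv : v ≠ 0) : φ.pt (c • v) = φ.pt v :=
  ((φ.pt_eq_iff hv (smul_ne_zero hc hv)).mpr ⟨c, rfl⟩).symm

/-- The set of points whose coordinate vectors are orthogonal to a given vector. -/
def lineOf (f : Fin 3 → F) : Set P := {X | ∃ w, w ≠ 0 ∧ f ⬝ᵥ w = 0 ∧ φ.pt w = X}

variable {φ}

theorem pt_mem_lineOf {f w : Fin 3 → F} (hw : w ≠ 0) : φ.pt w ∈ φ.lineOf f ↔ f ⬝ᵥ w = 0 := by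
  constructor
  · rintro ⟨v, hv, h, e⟩
    obtain ⟨c, rfl⟩ := (φ.pt_eq_iff hv hw).mp e
    simp [h]
  · exact fun h => ⟨w, hw, h, rfl⟩

theorem lineOf_subset (f : Fin 3 → F) : φ.lineOf f ⊆ E := by
  rintro X ⟨w, hw, -, rfl⟩
  exact φ.pt_mem hw

theorem lineOf_smul {c : F} (hc : c ≠ 0) (f : Fin 3 → F) : φ.lineOf (c • f) = φ.lineOf f := by
  ext X
  simp [lineOf, hc]

theorem join_pt {u v : Fin 3 → F} (h : u ⨯₃ v ≠ 0) :
    join (φ.pt u) (φ.pt v) = φ.lineOf (u ⨯₃ v) := by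
  have hu := left_ne_zero_of_cross h
  have hv := right_ne_zero_of_cross h
  have hne : φ.pt u ≠ φ.pt v := fun e => h ((φ.pt_eq_iff_cross hu hv).mp e)
  have hsub : join (φ.pt u) (φ.pt v) ⊆ E := join_subset φ.isPlane.isFlat (φ.pt_mem hu) (φ.pt_mem hv)
  have key : ∀ w, w ≠ 0 → (φ.pt w ∈ join (φ.pt u) (φ.pt v) ↔ (u ⨯₃ v) ⬝ᵥ w = 0) := by
    intro w hw
    rw [← areCollinear_iff_mem_join hne, φ.areCollinear_iff hu hv hw, triple_product_permutation,
      triple_product_permutation, dotProduct_comm]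
  ext X
  constructor
  · intro hX
    obtain ⟨w, hw, rfl⟩ := φ.exists_pt (hsub hX)
    exact (pt_mem_lineOf hw).mpr ((key w hw).mp hX)
  · rintro ⟨w, hw, h0, rfl⟩
    exact (key w hw).mpr h0

/-- Both witnesses are orthogonal to `f`, and a nonzero coordinate of `f` makes them independent. -/
theorem exists_cross_eq {f : Fin 3 → F} (hf : f ≠ 0) :
    ∃ (u v : Fin 3 → F) (c : F), c ≠ 0 ∧ u ⨯₃ v = c • f := by
  obtain ⟨i, hi⟩ := Function.ne_iff.mp hf
  rw [Pi.zero_apply] at hi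
  fin_cases i
  · refine ⟨![-f 1, f 0, 0], ![-f 2, 0, f 0], f 0, hi, ?_⟩
    funext j
    fin_cases j <;> simp [cross_apply]
    all_goals ring
  · refine ⟨![0, -f 2, f 1], ![f 1, -f 0, 0], f 1, hi, ?_⟩
    funext j
    fin_cases j <;> simp [cross_apply]
    all_goals ring
  · refine ⟨![f 2, 0, -f 0], ![0, f 2, -f 1], f 2, hi, ?_⟩
    funext j
    fin_cases j <;> simp [cross_apply]
    all_goals ring

theorem isLine_lineOf {f : Fin 3 → F} (hf : f ≠ 0) : IsLine (φ.lineOf f) := by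
  obtain ⟨u, v, c, hc, h⟩ := exists_cross_eq hf
  have hne : u ⨯₃ v ≠ 0 := by rw [h]; exact smul_ne_zero hc hf
  rw [← lineOf_smul hc, ← h, ← join_pt hne]
  exact isLine_join fun e => hne
    ((φ.pt_eq_iff_cross (left_ne_zero_of_cross hne) (right_ne_zero_of_cross hne)).mp e)

theorem exists_lineOf {l : Set P} (hl : IsLine l) (hlE : l ⊆ E) :
    ∃ f : Fin 3 → F, f ≠ 0 ∧ l = φ.lineOf f := by
  obtain ⟨X, hX⟩ := nonempty_of_isLine hl
  obtain ⟨Y, hY, hYX, -⟩ := exists_mem_ne hl X X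
  obtain ⟨u, hu, rfl⟩ := φ.exists_pt (hlE hX)
  obtain ⟨v, hv, rfl⟩ := φ.exists_pt (hlE hY)
  have h : u ⨯₃ v ≠ 0 := fun h => hYX ((φ.pt_eq_iff_cross hu hv).mpr h).symm
  exact ⟨_, h, by rw [← join_pt h, join_eq hl hYX.symm hX hY]⟩

theorem eq_lineOf {l : Set P} (hl : IsLine l) {f u v : Fin 3 → F} (hf : f ≠ 0) (h : u ⨯₃ v ≠ 0)
    (hu : φ.pt u ∈ l) (hv : φ.pt v ∈ l) (hfu : f ⬝ᵥ u = 0) (hfv : f ⬝ᵥ v = 0) :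
    l = φ.lineOf f := by
  have hu0 := left_ne_zero_of_cross h
  have hv0 := right_ne_zero_of_cross h
  exact line_unique hl (isLine_lineOf hf) (fun e => h ((φ.pt_eq_iff_cross hu0 hv0).mp e)) hu hv
    ((pt_mem_lineOf hu0).mpr hfu) ((pt_mem_lineOf hv0).mpr hfv)

theorem join_eq_lineOf {f u v : Fin 3 → F} (hf : f ≠ 0) (h : u ⨯₃ v ≠ 0)
    (hfu : f ⬝ᵥ u = 0) (hfv : f ⬝ᵥ v = 0) : join (φ.pt u) (φ.pt v) = φ.lineOf f :=
  eq_lineOf (isLine_join fun e => h ((φ.pt_eq_iff_cross (left_ne_zero_of_cross h)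
    (right_ne_zero_of_cross h)).mp e)) hf h (left_mem_join _ _) (right_mem_join _ _) hfu hfv

theorem lineOf_inter {f g : Fin 3 → F} (h : f ⨯₃ g ≠ 0) {X : P} :
    (X ∈ φ.lineOf f ∧ X ∈ φ.lineOf g) ↔ X = φ.pt (f ⨯₃ g) := by
  constructor
  · rintro ⟨⟨w, hw, h1, rfl⟩, h2⟩
    rw [pt_mem_lineOf hw] at h2
    obtain ⟨c, rfl⟩ := exists_smul_cross h h1 h2
    have hc : c ≠ 0 := by rintro rfl; simp at hw
    exact φ.pt_smul hc h
  · rintro rfl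
    rw [pt_mem_lineOf h, pt_mem_lineOf h]
    exact ⟨dot_self_cross _ _, dot_cross_self _ _⟩

end PlaneChart

end HarmonicGeometry
-- Perspectivities, quadrangles and harmonic sets.
namespace HarmonicGeometry

open PointLineGeometry Matrix

section Projection

variable {P : Type*} [ProjectiveSpace P]

/-- Central projection from a plane to another preserves collinearity. -/
theorem areCollinear_of_perspective {E₁ E₂ : Set P} (h1 : IsPlane E₁) (h2 : IsPlane E₂) {O : P}
    (hO1 : O ∉ E₁) (hO2 : O ∉ E₂) {p q r p' q' r' : P} (hp : p ∈ E₁) (hq : q ∈ E₁) (hr : r ∈ E₁)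
    (hp' : p' ∈ E₂) (hq' : q' ∈ E₂) (hr' : r' ∈ E₂) (hpp : AreCollinear {O, p, p'})
    (hqq : AreCollinear {O, q, q'}) (hrr : AreCollinear {O, r, r'}) (h : AreCollinear {p, q, r}) :
    AreCollinear {p', q', r'} := by
  obtain ⟨m, hm, hmE, m1, m2, m3⟩ := areCollinear_in_plane h1 hp hq hr h
  have hOm : O ∉ m := fun h => hO1 (hmE h)
  have hmem : ∀ {x x'}, x ∈ m → AreCollinear {O, x, x'} → x' ∈ cone O m := by
    intro x x' hx h
    obtain ⟨n, hn, n1, n2, n3⟩ := areCollinear_triple.mp h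
    exact ⟨x, hx, n, hn, n1, n2, n3⟩
  by_contra hcol
  -- The images lie in the plane spanned by `O` and `m`. If they were not collinear, this plane
  -- would be `E₂`, which omits `O`.
  have := (isPlane_cone hm hOm).eq_of_mem h2 hcol (hmem m1 hpp) (hmem m2 hqq) (hmem m3 hrr) hp' hq'
    hr'
  exact hO2 (this ▸ apex_mem_cone O (nonempty_of_isLine hm))

/-- A common diagonal point would lie on `p ∨ q` and on `q ∨ r`, hence be `q`; but `q` is not on `r
∨ s`. -/
theorem IsQuadrangle.diagonal_ne {p q r s A B : P} (h : IsQuadrangle p q r s)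
    (hA : A ∈ join p q ∩ join r s) (hB : B ∈ join q r ∩ join s p) : A ≠ B := by
  rintro rfl
  obtain ⟨-, h1, h2, -, -⟩ := h
  have n1 := ne_of_not_areCollinear h1
  have n2 := ne_of_not_areCollinear h2
  by_cases hq : A = q
  · subst hq
    exact h2 (areCollinear_triple.mpr ⟨_, isLine_join n2.2.2, hA.2, left_mem_join _ _,
      right_mem_join _ _⟩)
  · have e1 := join_eq (isLine_join n1.1) hq hA.1 (right_mem_join _ _)
    have e2 := join_eq (isLine_join n1.2.2) hq hB.1 (left_mem_join _ _)
    refine h1 (areCollinear_triple.mpr ⟨join A q, isLine_join hq, ?_, right_mem_join _ _, ?_⟩)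
    · rw [e1]; exact left_mem_join _ _
    · rw [e2]; exact right_mem_join _ _

/-- The quadrangle that exhibits a harmonic set may be taken in any plane through its line. -/
theorem IsHarmonicSet.exists_quadrangle {E : Set P} (hE : IsPlane E) {A C B D : P}
    (h : IsHarmonicSet A C B D) (hA : A ∈ E) (hB : B ∈ E) :
    A ≠ B ∧ ∃ p q r s : P, IsQuadrangle p q r s ∧ (p ∈ E ∧ q ∈ E ∧ r ∈ E ∧ s ∈ E) ∧
      A ∈ join p q ∩ join r s ∧ B ∈ join q r ∩ join s p ∧ C ∈ join p r ∧ D ∈ join q s := by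
  obtain ⟨⟨l, hl, hsub⟩, p, q, r, s, hquad, hAp, hBp, hC, hD⟩ := h
  have hAB := hquad.diagonal_ne hAp hBp
  refine ⟨hAB, ?_⟩
  simp only [Set.insert_subset_iff, Set.singleton_subset_iff] at hsub
  obtain ⟨lA, lC, lB, lD⟩ := hsub
  obtain ⟨⟨G, hG, hp, hq, hr, hs⟩, k1, k2, k3, k4⟩ := id hquad
  by_cases hGE : G = E
  · subst hGE
    exact ⟨p, q, r, s, hquad, ⟨hp, hq, hr, hs⟩, hAp, hBp, hC, hD⟩
  have hlE : l ⊆ E := hE.isFlat A hA B hB hAB l hl lA lB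
  have hlG : l ⊆ G := hG.isFlat A (join_subset hG.isFlat hp hq hAp.1) B
    (join_subset hG.isFlat hq hr hBp.1) hAB l hl lA lB
  obtain ⟨x, hxG, hxE⟩ := Set.not_subset.mp fun h => hGE (hG.eq_of_subset hE h)
  obtain ⟨y, hyE, hyG⟩ := Set.not_subset.mp fun h => hGE (hE.eq_of_subset hG h).symm
  have hxy : x ≠ y := fun e => hxE (e ▸ hyE)
  -- The centre of projection: a third point on a line joining a point of only one plane to a point
  -- of only the other lies in neither.
  obtain ⟨O, hO, hOx, hOy⟩ := exists_mem_ne (isLine_join hxy) x y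
  have hOE : O ∉ E := fun h => hxE (hE.isFlat O h y hyE hOy _ (isLine_join hxy) hO
    (right_mem_join _ _) (left_mem_join _ _))
  have hOG : O ∉ G := fun h => hyG (hG.isFlat O h x hxG hOx _ (isLine_join hxy) hO
    (left_mem_join _ _) (right_mem_join _ _))
  have proj : ∀ u ∈ G, ∃ u' ∈ E, AreCollinear {O, u, u'} := by
    intro u hu
    rw [hG.eq_cone hl hlG hxG (fun h => hxE (hlE h))] at hu
    obtain ⟨z, hz, m, hm, m1, m2, m3⟩ := hu
    have hOu : O ≠ u := by
      rintro rfl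
      exact hOG (hG.isFlat x hxG z (hlG hz) (fun e => hxE (hlE (e ▸ hz))) m hm m1 m2 m3)
    have hyz : y ≠ z := fun e => hyG (hlG (e ▸ hz))
    obtain ⟨W, hW1, hW2⟩ := lines_meet (isLine_join hOu) (isLine_join hyz) (isLine_join hxy) hm
      ⟨x, left_mem_join _ _, m1⟩ hO (right_mem_join _ _) m3 m2 (left_mem_join _ _)
      (right_mem_join _ _) (left_mem_join _ _) (right_mem_join _ _) hOu hyz
    exact ⟨W, join_subset hE.isFlat hyE (hlE hz) hW2, areCollinear_triple.mpr
      ⟨_, isLine_join hOu, left_mem_join _ _, right_mem_join _ _, hW1⟩⟩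
  obtain ⟨p', hp', pp⟩ := proj p hp
  obtain ⟨q', hq', qq⟩ := proj q hq
  obtain ⟨r', hr', rr⟩ := proj r hr
  obtain ⟨s', hs', ss⟩ := proj s hs
  have back : ∀ {u v w u' v' w'}, u ∈ G → v ∈ G → w ∈ G → u' ∈ E → v' ∈ E → w' ∈ E →
      AreCollinear {O, u, u'} → AreCollinear {O, v, v'} → AreCollinear {O, w, w'} →
      ¬ AreCollinear {u, v, w} → ¬ AreCollinear {u', v', w'} := by
    intro u v w u' v' w' hu hv hw hu' hv' hw' uu vv ww hn hc
    refine hn (areCollinear_of_perspective hE hG hOE hOG hu' hv' hw' hu hv hw ?_ ?_ ?_ hc)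
    all_goals rw [Set.pair_comm]; assumption
  have k1' := back hp hq hr hp' hq' hr' pp qq rr k1
  have k2' := back hq hr hs hq' hr' hs' qq rr ss k2
  have k3' := back hr hs hp hr' hs' hp' rr ss pp k3
  have k4' := back hs hp hq hs' hp' hq' ss pp qq k4
  -- The points of `l` lie in both planes and correspond to themselves, so their incidences with the
  -- sides and diagonals survive.
  have forth : ∀ {u v u' v' X}, u ≠ v → u' ≠ v' → u ∈ G → v ∈ G → u' ∈ E → v' ∈ E → X ∈ l →
      AreCollinear {O, u, u'} → AreCollinear {O, v, v'} → X ∈ join u v → X ∈ join u' v' := by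
    intro u v u' v' X huv huv' hu hv hu' hv' hX uu vv h
    rw [← areCollinear_iff_mem_join huv] at h
    rw [← areCollinear_iff_mem_join huv']
    refine areCollinear_of_perspective hG hE hOG hOE hu hv (hlG hX) hu' hv' (hlE hX) uu vv ?_ h
    obtain ⟨n, hn, n1, n2⟩ := areCollinear_pair O X
    exact areCollinear_triple.mpr ⟨n, hn, n1, n2, n2⟩
  obtain ⟨npq, npr, nqr⟩ := ne_of_not_areCollinear k1
  obtain ⟨-, nqs, nrs⟩ := ne_of_not_areCollinear k2
  obtain ⟨nsp, -, -⟩ := ne_of_not_areCollinear k4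
  obtain ⟨npq', npr', nqr'⟩ := ne_of_not_areCollinear k1'
  obtain ⟨-, nqs', nrs'⟩ := ne_of_not_areCollinear k2'
  obtain ⟨nsp', -, -⟩ := ne_of_not_areCollinear k4'
  exact ⟨p', q', r', s', ⟨⟨E, hE, hp', hq', hr', hs'⟩, k1', k2', k3', k4'⟩, ⟨hp', hq', hr', hs'⟩,
    ⟨forth npq npq' hp hq hp' hq' lA pp qq hAp.1, forth nrs nrs' hr hs hr' hs' lA rr ss hAp.2⟩,
    ⟨forth nqr nqr' hq hr hq' hr' lB qq rr hBp.1, forth nsp nsp' hs hp hs' hp' lB ss pp hBp.2⟩,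
    forth npr npr' hp hr hp' hr' lC pp rr hC, forth nqs nqs' hq hs hq' hs' lD qq ss hD⟩

end Projection

section Vectors

variable {F : Type*} [Field F]

/-- Cramer's rule. -/
theorem exists_coordinates {u v w : Fin 3 → F} (h : u ⬝ᵥ v ⨯₃ w ≠ 0) (x : Fin 3 → F) :
    ∃ a b c : F, x = a • u + b • v + c • w := by
  refine ⟨x ⬝ᵥ v ⨯₃ w / (u ⬝ᵥ v ⨯₃ w), u ⬝ᵥ x ⨯₃ w / (u ⬝ᵥ v ⨯₃ w),
    u ⬝ᵥ v ⨯₃ x / (u ⬝ᵥ v ⨯₃ w), ?_⟩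
  have key : (u ⬝ᵥ v ⨯₃ w) • x = (x ⬝ᵥ v ⨯₃ w) • u + (u ⬝ᵥ x ⨯₃ w) • v + (u ⬝ᵥ v ⨯₃ x) • w := by
    funext i
    simp only [vec3_dotProduct, cross_apply, Pi.add_apply, Pi.smul_apply, smul_eq_mul, cons_val]
    fin_cases i <;> simp only [Fin.zero_eta, Fin.mk_one, Fin.reduceFinMk] <;> ring
  rw [← smul_right_injective _ h |>.eq_iff, key, smul_add, smul_add, smul_smul, smul_smul,
    smul_smul, mul_div_cancel₀ _ h, mul_div_cancel₀ _ h, mul_div_cancel₀ _ h]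

theorem cross_ne_zero_of_det {u v w : Fin 3 → F} (h : u ⬝ᵥ v ⨯₃ w ≠ 0) :
    u ⨯₃ v ≠ 0 ∧ v ⨯₃ w ≠ 0 ∧ w ⨯₃ u ≠ 0 := by
  refine ⟨fun e => h ?_, fun e => h ?_, fun e => h ?_⟩
  · rw [← triple_product_permutation, e, dotProduct_zero]
  · rw [e, dotProduct_zero]
  · rw [triple_product_permutation, e, dotProduct_zero]

theorem exists_det_ne_zero {u v : Fin 3 → F} (h : u ⨯₃ v ≠ 0) : ∃ w, w ⬝ᵥ u ⨯₃ v ≠ 0 := by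
  by_contra! hw
  apply h
  funext i
  have := hw (Pi.single i 1)
  simpa using this

end Vectors

namespace PlaneChart

variable {P : Type*} [ProjectiveSpace P] {E : Set P} {F : Type*} [Field F] {φ : PlaneChart E F}

theorem pt_mem_join {u v w : Fin 3 → F} (h : u ⨯₃ v ≠ 0) (hw : w ≠ 0) :
    φ.pt w ∈ join (φ.pt u) (φ.pt v) ↔ w ⬝ᵥ u ⨯₃ v = 0 := by
  rw [join_pt h, pt_mem_lineOf hw, dotProduct_comm]

theorem not_areCollinear {u v w : Fin 3 → F} (h : u ⬝ᵥ v ⨯₃ w ≠ 0) :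
    ¬ AreCollinear {φ.pt u, φ.pt v, φ.pt w} := by
  have := cross_ne_zero_of_det h
  rwa [φ.areCollinear_iff (left_ne_zero_of_cross this.1) (left_ne_zero_of_cross this.2.1)
    (left_ne_zero_of_cross this.2.2)]

theorem isQuadrangle_of_det {p q r : Fin 3 → F} (h : p ⬝ᵥ q ⨯₃ r ≠ 0) :
    IsQuadrangle (φ.pt p) (φ.pt q) (φ.pt r) (φ.pt (p + q + r)) := by
  have h1 : q ⬝ᵥ r ⨯₃ (p + q + r) ≠ 0 := by
    have e : q ⬝ᵥ r ⨯₃ (p + q + r) = p ⬝ᵥ q ⨯₃ r := by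
      simp only [vec3_dotProduct, cross_apply, Pi.add_apply, cons_val]; ring
    rwa [e]
  have h2 : r ⬝ᵥ (p + q + r) ⨯₃ p ≠ 0 := by
    have e : r ⬝ᵥ (p + q + r) ⨯₃ p = -(p ⬝ᵥ q ⨯₃ r) := by
      simp only [vec3_dotProduct, cross_apply, Pi.add_apply, cons_val]; ring
    rwa [e, neg_ne_zero]
  have h3 : (p + q + r) ⬝ᵥ p ⨯₃ q ≠ 0 := by
    have e : (p + q + r) ⬝ᵥ p ⨯₃ q = p ⬝ᵥ q ⨯₃ r := by
      simp only [vec3_dotProduct, cross_apply, Pi.add_apply, cons_val]; ring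
    rwa [e]
  have hc := cross_ne_zero_of_det h
  have hc' := cross_ne_zero_of_det h3
  exact ⟨⟨E, φ.isPlane, φ.pt_mem (left_ne_zero_of_cross hc.1), φ.pt_mem (left_ne_zero_of_cross hc.2.1),
    φ.pt_mem (left_ne_zero_of_cross hc.2.2), φ.pt_mem (left_ne_zero_of_cross hc'.1)⟩,
    not_areCollinear h, not_areCollinear h1, not_areCollinear h2, not_areCollinear h3⟩

theorem det_ne_zero {u v w : Fin 3 → F} (hu : u ≠ 0) (hv : v ≠ 0) (hw : w ≠ 0)
    (h : ¬ AreCollinear {φ.pt u, φ.pt v, φ.pt w}) : u ⬝ᵥ v ⨯₃ w ≠ 0 := by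
  rwa [φ.areCollinear_iff hu hv hw] at h

/-- The fourth vertex is a combination of the other three with nonzero coefficients, because no
three vertices are collinear; these coefficients are absorbed into the vectors. -/
theorem exists_frame_of_quadrangle (φ : PlaneChart E F) {A B C D : P} (h : IsQuadrangle A B C D)
    (hE : A ∈ E ∧ B ∈ E ∧ C ∈ E ∧ D ∈ E) : ∃ p q r : Fin 3 → F, p ⬝ᵥ q ⨯₃ r ≠ 0 ∧
      A = φ.pt p ∧ B = φ.pt q ∧ C = φ.pt r ∧ D = φ.pt (p + q + r) := by
  obtain ⟨p, hp, rfl⟩ := φ.exists_pt hE.1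
  obtain ⟨q, hq, rfl⟩ := φ.exists_pt hE.2.1
  obtain ⟨r, hr, rfl⟩ := φ.exists_pt hE.2.2.1
  obtain ⟨s, hs, rfl⟩ := φ.exists_pt hE.2.2.2
  have h1 := det_ne_zero hp hq hr h.2.1
  have h2 := det_ne_zero hq hr hs h.2.2.1
  have h3 := det_ne_zero hr hs hp h.2.2.2.1
  have h4 := det_ne_zero hs hp hq h.2.2.2.2
  obtain ⟨a, b, c, rfl⟩ := exists_coordinates h1 s
  have ha : a ≠ 0 := by
    rintro rfl
    apply h2
    simp only [vec3_dotProduct, cross_apply, Pi.add_apply, Pi.smul_apply, smul_eq_mul, cons_val]; ring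
  have hb : b ≠ 0 := by
    rintro rfl
    apply h3
    simp only [vec3_dotProduct, cross_apply, Pi.add_apply, Pi.smul_apply, smul_eq_mul, cons_val]; ring
  have hc : c ≠ 0 := by
    rintro rfl
    apply h4
    simp only [vec3_dotProduct, cross_apply, Pi.add_apply, Pi.smul_apply, smul_eq_mul, cons_val]; ring
  refine ⟨a • p, b • q, c • r, ?_, (φ.pt_smul ha hp).symm, (φ.pt_smul hb hq).symm,
    (φ.pt_smul hc hr).symm, rfl⟩
  have e : (a • p) ⬝ᵥ (b • q) ⨯₃ (c • r) = a * b * c * (p ⬝ᵥ q ⨯₃ r) := by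
    simp only [vec3_dotProduct, cross_apply, Pi.smul_apply, smul_eq_mul, cons_val]; ring
  rw [e]
  exact mul_ne_zero (mul_ne_zero (mul_ne_zero ha hb) hc) h1

theorem isHarmonicSet_pt {a b : Fin 3 → F} (hab : a ⨯₃ b ≠ 0) {x y : F} (hx : x ≠ 0) (hy : y ≠ 0) :
    IsHarmonicSet (φ.pt a) (φ.pt (x • a + y • b)) (φ.pt b) (φ.pt (x • a - y • b)) := by
  have ha := left_ne_zero_of_cross hab
  have hb := right_ne_zero_of_cross hab
  rw [← φ.pt_smul hx ha, ← φ.pt_smul (neg_ne_zero.mpr hy) hb, sub_eq_add_neg, ← neg_smul]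
  have hab' : (x • a) ⨯₃ (-y • b) ≠ 0 := by simp [hab, hx, hy]
  have e1 : x • a + y • b = x • a - (-y • b) := by rw [neg_smul, sub_neg_eq_add]
  rw [e1]
  -- The scalars, and a sign, are absorbed into `a` and `b`; what remains is the pair `a - b`, `a +
  -- b`.
  clear hab hx hy ha hb e1
  generalize x • a = a at *
  generalize -y • b = b at *
  obtain ⟨q, hq⟩ := exists_det_ne_zero hab'
  have ha := left_ne_zero_of_cross hab'
  have hb := right_ne_zero_of_cross hab'
  -- For `q` off the line, the quadrangle `a - q`, `q`, `b - q`, `a + b - q` has diagonal points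
  -- `a`, `b`, and its diagonal lines cut the line `a b` in `a - b` and `a + b`.
  have hdet : (a - q) ⬝ᵥ q ⨯₃ (b - q) ≠ 0 := by
    have e : (a - q) ⬝ᵥ q ⨯₃ (b - q) = -(q ⬝ᵥ a ⨯₃ b) := by
      simp only [vec3_dotProduct, cross_apply, Pi.sub_apply, cons_val]; ring
    rw [e]; exact neg_ne_zero.mpr hq
  have hquad := isQuadrangle_of_det (φ := φ) hdet
  have hs : a - q + q + (b - q) = a + b - q := by abel
  rw [hs] at hquad
  have hsub : a - b ≠ 0 := fun e => hab' (by rw [sub_eq_zero.mp e, cross_self])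
  have hadd : a + b ≠ 0 := fun e => hab' (by
    rw [eq_neg_of_add_eq_zero_left e, map_neg, LinearMap.neg_apply, cross_self, neg_zero])
  have hc := cross_ne_zero_of_det hdet
  have hc2 : (b - q) ⨯₃ (a + b - q) ≠ 0 := by
    refine (cross_ne_zero_of_det (u := q) ?_).2.1
    have e : q ⬝ᵥ (b - q) ⨯₃ (a + b - q) = -(q ⬝ᵥ a ⨯₃ b) := by
      simp only [vec3_dotProduct, cross_apply, Pi.add_apply, Pi.sub_apply, cons_val]; ring
    rw [e]; exact neg_ne_zero.mpr hq
  have hc3 : (a + b - q) ⨯₃ (a - q) ≠ 0 := by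
    refine (cross_ne_zero_of_det (u := q) ?_).2.1
    have e : q ⬝ᵥ (a + b - q) ⨯₃ (a - q) = -(q ⬝ᵥ a ⨯₃ b) := by
      simp only [vec3_dotProduct, cross_apply, Pi.add_apply, Pi.sub_apply, cons_val]; ring
    rw [e]; exact neg_ne_zero.mpr hq
  have hc4 : (a - q) ⨯₃ (b - q) ≠ 0 := by
    rw [← cross_anticomm]; exact neg_ne_zero.mpr hc.2.2
  have hc5 : q ⨯₃ (a + b - q) ≠ 0 := by
    refine (cross_ne_zero_of_det (w := b) (u := q) (v := a + b - q) ?_).1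
    have e : q ⬝ᵥ (a + b - q) ⨯₃ b = q ⬝ᵥ a ⨯₃ b := by
      simp only [vec3_dotProduct, cross_apply, Pi.add_apply, Pi.sub_apply, cons_val]; ring
    rwa [e]
  refine ⟨⟨φ.lineOf (a ⨯₃ b), isLine_lineOf hab', ?_⟩, _, _, _, _, hquad, ⟨?_, ?_⟩, ⟨?_, ?_⟩, ?_, ?_⟩
  · simp only [Set.insert_subset_iff, Set.singleton_subset_iff]
    rw [pt_mem_lineOf ha, pt_mem_lineOf hb, pt_mem_lineOf hsub, pt_mem_lineOf hadd]
    refine ⟨?_, ?_, ?_, ?_⟩ <;>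
    · simp only [vec3_dotProduct, cross_apply, Pi.add_apply, Pi.sub_apply, cons_val]; ring
  · rw [pt_mem_join hc.1 ha]
    simp only [vec3_dotProduct, cross_apply, Pi.sub_apply, cons_val]; ring
  · rw [pt_mem_join hc2 ha]
    simp only [vec3_dotProduct, cross_apply, Pi.add_apply, Pi.sub_apply, cons_val]; ring
  · rw [pt_mem_join hc.2.1 hb]
    simp only [vec3_dotProduct, cross_apply, Pi.sub_apply, cons_val]; ring
  · rw [pt_mem_join hc3 hb]
    simp only [vec3_dotProduct, cross_apply, Pi.add_apply, Pi.sub_apply, cons_val]; ring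
  · rw [pt_mem_join hc4 hsub]
    simp only [vec3_dotProduct, cross_apply, Pi.sub_apply, cons_val]; ring
  · rw [pt_mem_join hc5 hadd]
    simp only [vec3_dotProduct, cross_apply, Pi.add_apply, Pi.sub_apply, cons_val]; ring

end PlaneChart

end HarmonicGeometry
-- Harmonic sets and harmonic pencils in coordinates.
namespace HarmonicGeometry

open PointLineGeometry Matrix

theorem cross_ne_zero_of_frame {F : Type*} [Field F] {p q r : Fin 3 → F} (h : p ⬝ᵥ q ⨯₃ r ≠ 0) :
    p ⨯₃ q ≠ 0 ∧ q ⨯₃ r ≠ 0 ∧ p ⨯₃ r ≠ 0 ∧ r ⨯₃ (p + q + r) ≠ 0 ∧ (p + q + r) ⨯₃ p ≠ 0 ∧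
      q ⨯₃ (p + q + r) ≠ 0 := by
  have hc := cross_ne_zero_of_det h
  refine ⟨hc.1, hc.2.1, ?_, ?_, ?_, ?_⟩
  · rw [← cross_anticomm]; exact neg_ne_zero.mpr hc.2.2
  · refine (cross_ne_zero_of_det (u := q) (v := r) ?_).2.1
    have e : q ⬝ᵥ r ⨯₃ (p + q + r) = p ⬝ᵥ q ⨯₃ r := by
      simp only [vec3_dotProduct, cross_apply, Pi.add_apply, cons_val]; ring
    rwa [e]
  · refine (cross_ne_zero_of_det (u := p + q + r) (v := p) (w := q) ?_).1
    have e : (p + q + r) ⬝ᵥ p ⨯₃ q = p ⬝ᵥ q ⨯₃ r := by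
      simp only [vec3_dotProduct, cross_apply, Pi.add_apply, cons_val]; ring
    rwa [e]
  · refine (cross_ne_zero_of_det (u := r) (v := q) ?_).2.1
    have e : r ⬝ᵥ q ⨯₃ (p + q + r) = -(p ⬝ᵥ q ⨯₃ r) := by
      simp only [vec3_dotProduct, cross_apply, Pi.add_apply, cons_val]; ring
    rw [e]; exact neg_ne_zero.mpr h

namespace PlaneChart

variable {P : Type*} [ProjectiveSpace P] {E : Set P} {F : Type*} [Field F] {φ : PlaneChart E F}

/-- Harmonic sets in coordinates. -/
theorem isHarmonicSet_iff {a b : Fin 3 → F} (hab : a ⨯₃ b ≠ 0) {C D : P} :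
    IsHarmonicSet (φ.pt a) C (φ.pt b) D ↔
      ∃ x y : F, x ≠ 0 ∧ y ≠ 0 ∧ C = φ.pt (x • a + y • b) ∧ D = φ.pt (x • a - y • b) := by
  constructor
  swap
  · rintro ⟨x, y, hx, hy, rfl, rfl⟩
    exact isHarmonicSet_pt hab hx hy
  intro h
  have ha := left_ne_zero_of_cross hab
  have hb := right_ne_zero_of_cross hab
  obtain ⟨hne, P₁, P₂, P₃, P₄, hquad, hmem, hA, hB, hC, hD⟩ :=
    h.exists_quadrangle φ.isPlane (φ.pt_mem ha) (φ.pt_mem hb)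
  obtain ⟨p, q, r, hdet, rfl, rfl, rfl, rfl⟩ := φ.exists_frame_of_quadrangle hquad hmem
  obtain ⟨⟨l, hl, hsub⟩, -⟩ := h
  simp only [Set.insert_subset_iff, Set.singleton_subset_iff] at hsub
  obtain ⟨lA, lC, lB, lD⟩ := hsub
  have hlE := φ.isPlane.isFlat _ (φ.pt_mem ha) _ (φ.pt_mem hb) hne l hl lA lB
  obtain ⟨c, hc, rfl⟩ := φ.exists_pt (hlE lC)
  obtain ⟨d, hd, rfl⟩ := φ.exists_pt (hlE lD)
  obtain ⟨hpq, hqr, hpr, hrs, hsp, hqs⟩ := cross_ne_zero_of_frame hdet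
  have a1 := (pt_mem_join hpq ha).mp hA.1
  have a2 := (pt_mem_join hrs ha).mp hA.2
  have b1 := (pt_mem_join hqr hb).mp hB.1
  have b2 := (pt_mem_join hsp hb).mp hB.2
  have c1 := (pt_mem_join hpr hc).mp hC
  have d1 := (pt_mem_join hqs hd).mp hD
  obtain ⟨α', α, α'', rfl⟩ := exists_coordinates hdet a
  obtain ⟨β'', β', β, rfl⟩ := exists_coordinates hdet b
  -- In the frame of the quadrangle the diagonal points are `p + q` and `q + r`; the next four
  -- equations say so for `a` and `b`.
  have e1 : α'' = 0 := by
    have : α'' * (p ⬝ᵥ q ⨯₃ r) = 0 := by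
      rw [← a1]
      simp only [vec3_dotProduct, cross_apply, Pi.add_apply, Pi.smul_apply, smul_eq_mul, cons_val]
      ring
    simpa [hdet] using this
  have e2 : α = α' := by
    have : (α - α') * (p ⬝ᵥ q ⨯₃ r) = 0 := by
      rw [← a2, e1]
      simp only [vec3_dotProduct, cross_apply, Pi.add_apply, Pi.smul_apply, smul_eq_mul, cons_val]
      ring
    simpa [hdet, sub_eq_zero] using this
  have e3 : β'' = 0 := by
    have : β'' * (p ⬝ᵥ q ⨯₃ r) = 0 := by
      rw [← b1]
      simp only [vec3_dotProduct, cross_apply, Pi.add_apply, Pi.smul_apply, smul_eq_mul, cons_val]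
      ring
    simpa [hdet] using this
  have e4 : β = β' := by
    have : (β - β') * (p ⬝ᵥ q ⨯₃ r) = 0 := by
      rw [← neg_eq_zero, ← b2, e3]
      simp only [vec3_dotProduct, cross_apply, Pi.add_apply, Pi.smul_apply, smul_eq_mul, cons_val]
      ring
    simpa [hdet, sub_eq_zero] using this
  subst e1 e2 e3 e4
  have hα : α ≠ 0 := by rintro rfl; simp at ha
  have hβ : β ≠ 0 := by rintro rfl; simp at hb
  have onl : ∀ {w : Fin 3 → F}, w ≠ 0 → φ.pt w ∈ l → ∃ x y : F,
      w = x • (α • p + α • q + (0 : F) • r) + y • ((0 : F) • p + β • q + β • r) := by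
    intro w hw hwl
    have hcol : AreCollinear {φ.pt (α • p + α • q + (0 : F) • r),
      φ.pt ((0 : F) • p + β • q + β • r), φ.pt w} := areCollinear_triple.mpr ⟨l, hl, lA, lB, hwl⟩
    rw [φ.areCollinear_iff ha hb hw] at hcol
    obtain ⟨k, k', k'', rfl⟩ := exists_coordinates hdet w
    have : k' = k + k'' := by
      have : (α * β) * (k + k'' - k') * (p ⬝ᵥ q ⨯₃ r) = 0 := by
        rw [← hcol]
        simp only [vec3_dotProduct, cross_apply, Pi.add_apply, Pi.smul_apply, smul_eq_mul, cons_val]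
        ring
      have h2 : k + k'' - k' = 0 := by simpa [hdet, hα, hβ] using this
      exact (sub_eq_zero.mp h2).symm
    refine ⟨k / α, k'' / β, ?_⟩
    subst this
    funext i
    simp only [Pi.add_apply, Pi.smul_apply, smul_eq_mul]
    field_simp
    ring
  obtain ⟨x, y, hxy⟩ := onl hc lC
  obtain ⟨x', y', hxy'⟩ := onl hd lD
  -- On the diagonal `p r` the coordinate along `q` vanishes; on the diagonal `q s` the coordinates
  -- along `p` and `r` agree. Hence `(x', y')` is proportional to `(x, -y)`.
  have c2 : x * α + y * β = 0 := by
    have : (x * α + y * β) * (p ⬝ᵥ q ⨯₃ r) = 0 := by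
      rw [← neg_eq_zero, ← c1, hxy]
      simp only [vec3_dotProduct, cross_apply, Pi.add_apply, Pi.smul_apply, smul_eq_mul, cons_val]
      ring
    simpa [hdet] using this
  have d2 : x' * α - y' * β = 0 := by
    have : (x' * α - y' * β) * (p ⬝ᵥ q ⨯₃ r) = 0 := by
      rw [← d1, hxy']
      simp only [vec3_dotProduct, cross_apply, Pi.add_apply, Pi.smul_apply, smul_eq_mul, cons_val]
      ring
    simpa [hdet] using this
  have hx : x ≠ 0 := by
    rintro rfl
    have : y = 0 := by simpa [hβ] using c2
    exact hc (by rw [hxy, this]; simp)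
  have hx' : x' ≠ 0 := by
    rintro rfl
    have : y' = 0 := by simpa [hβ] using d2
    exact hd (by rw [hxy', this]; simp)
  have hy : y ≠ 0 := by
    rintro rfl
    have : x = 0 := by simpa [hα] using c2
    exact hx this
  have hyy : y' = -(x' / x * y) := by
    field_simp
    have : β * (x * y' + x' * y) = 0 := by linear_combination x' * c2 - x * d2
    have := (mul_eq_zero.mp this).resolve_left hβ
    linear_combination this
  refine ⟨x, y, hx, hy, by rw [hxy], ?_⟩
  have hd' : d = (x' / x) • (x • (α • p + α • q + (0 : F) • r) -
      y • ((0 : F) • p + β • q + β • r)) := by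
    rw [hxy', smul_sub, smul_smul, smul_smul, div_mul_cancel₀ _ hx, hyy, neg_smul, sub_eq_add_neg]
  rw [hd']
  refine φ.pt_smul (div_ne_zero hx' hx) fun h0 => hd ?_
  rw [hd', h0, smul_zero]

end PlaneChart

section Pencils

variable {P : Type*} [ProjectiveSpace P]

/-- A harmonic pencil lies in a plane, and it is harmonic in the coordinates of that plane. -/
theorem IsHarmonicPencil.exists_plane {Z : P} {a c b d : Set P} (h : IsHarmonicPencil Z a c b d)
    (F : Type*) [Field F] : ∃ G : Set P, IsPlane G ∧ (a ⊆ G ∧ c ⊆ G ∧ b ⊆ G ∧ d ⊆ G) ∧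
      ∀ φ : PlaneChart G F, ∃ f g : Fin 3 → F, f ⨯₃ g ≠ 0 ∧ Z = φ.pt (f ⨯₃ g) ∧
        a = φ.lineOf f ∧ c = φ.lineOf (f + g) ∧ b = φ.lineOf g ∧ d = φ.lineOf (f - g) := by
  obtain ⟨⟨ha, hc, hb, hd⟩, ⟨Za, Zc, Zb, Zd⟩, p₀, q₀, r₀, s₀, hquad, rfl, rfl, ⟨X, Xc, Xpq, Xrs⟩,
    ⟨Y, Yd, Yqr, Ysp⟩⟩ := h
  obtain ⟨⟨G, hG, hp, hq, hr, hs⟩, k1, k2, k3, k4⟩ := id hquad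
  obtain ⟨npq, npr, nqr⟩ := ne_of_not_areCollinear k1
  obtain ⟨-, nqs, nrs⟩ := ne_of_not_areCollinear k2
  obtain ⟨nsp, -, -⟩ := ne_of_not_areCollinear k4
  have vertex : ∀ {u v w Z : P}, ¬ AreCollinear {u, v, w} → Z ∈ join u v → Z ∈ join v w →
      Z = v := by
    intro u v w Z hn h1 h2
    by_contra hne
    have n := ne_of_not_areCollinear hn
    refine hn (areCollinear_triple.mpr ⟨join Z v, isLine_join hne, ?_, right_mem_join _ _, ?_⟩)
    · rw [join_eq (isLine_join n.1) hne h1 (right_mem_join _ _)]; exact left_mem_join _ _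
    · rw [join_eq (isLine_join n.2.2) hne h2 (left_mem_join _ _)]; exact right_mem_join _ _
  -- The intersection of the diagonal lines is not a diagonal point. This puts the lines `c` and `d`
  -- into the plane of the quadrangle.
  have hZX : Z ≠ X := by
    rintro rfl
    have e1 := vertex (u := r₀) (v := p₀) (w := q₀)
      (fun h => k1 (areCollinear_rotate.mp h)) (by rwa [join_comm]) Xpq
    have e2 := vertex (u := p₀) (v := q₀) (w := s₀)
      (fun h => k4 (areCollinear_rotate.mpr h)) Xpq Zb
    exact npq (e1.symm.trans e2)
  have hZY : Z ≠ Y := by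
    rintro rfl
    have e1 := vertex (u := s₀) (v := q₀) (w := r₀)
      (fun h => k2 (areCollinear_rotate.mp h)) (by rwa [join_comm]) Yqr
    have e2 := vertex (u := q₀) (v := r₀) (w := p₀)
      (fun h => k1 (areCollinear_rotate.mpr h)) Yqr (by rwa [join_comm])
    exact nqr (e1.symm.trans e2)
  have aG : join p₀ r₀ ⊆ G := join_subset hG.isFlat hp hr
  have bG : join q₀ s₀ ⊆ G := join_subset hG.isFlat hq hs
  have XG : X ∈ G := join_subset hG.isFlat hp hq Xpq
  have YG : Y ∈ G := join_subset hG.isFlat hq hr Yqr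
  refine ⟨G, hG, ⟨aG, hG.isFlat Z (aG Za) X XG hZX c hc Zc Xc, bG,
    hG.isFlat Z (aG Za) Y YG hZY d hd Zd Yd⟩, fun φ => ?_⟩
  obtain ⟨p, q, r, hdet, rfl, rfl, rfl, rfl⟩ :=
    φ.exists_frame_of_quadrangle hquad ⟨hp, hq, hr, hs⟩
  obtain ⟨hpq, hqr, hpr, -, -, hqs⟩ := cross_ne_zero_of_frame hdet
  have hcX : (p + r) ⨯₃ (p + q) ≠ 0 := by
    refine (cross_ne_zero_of_det (u := p) ?_).2.1
    have e : p ⬝ᵥ (p + r) ⨯₃ (p + q) = -(p ⬝ᵥ q ⨯₃ r) := by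
      simp only [vec3_dotProduct, cross_apply, Pi.add_apply, cons_val]; ring
    rw [e]; exact neg_ne_zero.mpr hdet
  have hcY : (p + r) ⨯₃ (q + r) ≠ 0 := by
    refine (cross_ne_zero_of_det (u := p) ?_).2.1
    have e : p ⬝ᵥ (p + r) ⨯₃ (q + r) = -(p ⬝ᵥ q ⨯₃ r) := by
      simp only [vec3_dotProduct, cross_apply, Pi.add_apply, cons_val]; ring
    rw [e]; exact neg_ne_zero.mpr hdet
  have hpr' := left_ne_zero_of_cross hcX
  -- The forms `f`, `g` of the two diagonals are scaled so that `f + g` vanishes at the diagonal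
  -- point `p + q` and `f - g` at `q + r`. The centre is `p + r`.
  have hfg : (p ⨯₃ r) ⨯₃ (q ⨯₃ r - p ⨯₃ q) = (p ⬝ᵥ q ⨯₃ r) • (p + r) := by
    funext i
    simp only [vec3_dotProduct, cross_apply, Pi.add_apply, Pi.sub_apply, Pi.smul_apply, smul_eq_mul,
      cons_val]
    fin_cases i <;> simp only [Fin.zero_eta, Fin.mk_one, Fin.reduceFinMk, cons_val] <;> ring
  have hXX : (p ⨯₃ q) ⨯₃ (r ⨯₃ (p + q + r)) = (-(p ⬝ᵥ q ⨯₃ r)) • (p + q) := by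
    funext i
    simp only [vec3_dotProduct, cross_apply, Pi.add_apply, Pi.smul_apply, smul_eq_mul, cons_val]
    fin_cases i <;> simp only [Fin.zero_eta, Fin.mk_one, Fin.reduceFinMk, cons_val] <;> ring
  have hYY : (q ⨯₃ r) ⨯₃ ((p + q + r) ⨯₃ p) = (p ⬝ᵥ q ⨯₃ r) • (q + r) := by
    funext i
    simp only [vec3_dotProduct, cross_apply, Pi.add_apply, Pi.smul_apply, smul_eq_mul, cons_val]
    fin_cases i <;> simp only [Fin.zero_eta, Fin.mk_one, Fin.reduceFinMk, cons_val] <;> ring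
  have hpq0 := right_ne_zero_of_cross hcX
  have hqr0 := right_ne_zero_of_cross hcY
  have hne : (p ⨯₃ r) ⨯₃ (q ⨯₃ r - p ⨯₃ q) ≠ 0 := by rw [hfg]; exact smul_ne_zero hdet hpr'
  have hneX : (p ⨯₃ q) ⨯₃ (r ⨯₃ (p + q + r)) ≠ 0 := by
    rw [hXX]; exact smul_ne_zero (neg_ne_zero.mpr hdet) hpq0
  have hneY : (q ⨯₃ r) ⨯₃ ((p + q + r) ⨯₃ p) ≠ 0 := by
    rw [hYY]; exact smul_ne_zero hdet hqr0
  rw [PlaneChart.join_pt hpq] at Xpq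
  rw [PlaneChart.join_pt (right_ne_zero_of_cross hneX)] at Xrs
  rw [PlaneChart.join_pt hqr] at Yqr
  rw [PlaneChart.join_pt (right_ne_zero_of_cross hneY)] at Ysp
  have eX : X = φ.pt (p + q) := by
    rw [(PlaneChart.lineOf_inter hneX).mp ⟨Xpq, Xrs⟩, hXX]
    exact φ.pt_smul (neg_ne_zero.mpr hdet) hpq0
  have eY : Y = φ.pt (q + r) := by
    rw [(PlaneChart.lineOf_inter hneY).mp ⟨Yqr, Ysp⟩, hYY]
    exact φ.pt_smul hdet hqr0
  have eb : join (φ.pt q) (φ.pt (p + q + r)) = φ.lineOf (q ⨯₃ r - p ⨯₃ q) := by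
    refine PlaneChart.join_eq_lineOf (right_ne_zero_of_cross hne) hqs ?_ ?_ <;>
    · simp only [vec3_dotProduct, cross_apply, Pi.add_apply, Pi.sub_apply, cons_val]; ring
  rw [PlaneChart.join_pt hpr] at Za
  rw [eb] at Zb
  have eZ := (PlaneChart.lineOf_inter hne).mp ⟨Za, Zb⟩
  have eZ' : Z = φ.pt (p + r) := by rw [eZ, hfg]; exact φ.pt_smul hdet hpr'
  rw [eZ'] at Zc Zd
  rw [eX] at Xc
  rw [eY] at Yd
  refine ⟨p ⨯₃ r, q ⨯₃ r - p ⨯₃ q, hne, eZ, PlaneChart.join_pt hpr, ?_, eb, ?_⟩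
  · refine PlaneChart.eq_lineOf hc (fun h0 => hne ?_) hcX Zc Xc ?_ ?_
    · rw [eq_neg_of_add_eq_zero_right h0, map_neg, cross_self, neg_zero]
    all_goals simp only [vec3_dotProduct, cross_apply, Pi.add_apply, Pi.sub_apply, cons_val]; ring
  · refine PlaneChart.eq_lineOf hd (fun h0 => hne ?_) hcY Zd Yd ?_ ?_
    · rw [← sub_eq_zero.mp h0, cross_self]
    all_goals simp only [vec3_dotProduct, cross_apply, Pi.add_apply, Pi.sub_apply, cons_val]; ring

/-- Two independent linear forms, their sum and their difference define a harmonic pencil. -/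
theorem PlaneChart.isHarmonicPencil {E : Set P} {F : Type*} [Field F] (φ : PlaneChart E F)
    {f g : Fin 3 → F} (hfg : f ⨯₃ g ≠ 0) :
    IsHarmonicPencil (φ.pt (f ⨯₃ g)) (φ.lineOf f) (φ.lineOf (f + g)) (φ.lineOf g)
      (φ.lineOf (f - g)) := by
  obtain ⟨h, hh⟩ := exists_det_ne_zero hfg
  have hf := left_ne_zero_of_cross hfg
  have hg := right_ne_zero_of_cross hfg
  have hadd : f + g ≠ 0 := fun h0 => hfg (by
    rw [eq_neg_of_add_eq_zero_right h0, map_neg, cross_self, neg_zero])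
  have hsub : f - g ≠ 0 := fun h0 => hfg (by rw [← sub_eq_zero.mp h0, cross_self])
  obtain ⟨p, q, r, hdet, fp, fr, gq, gs, hX, hY⟩ : ∃ p q r : Fin 3 → F, p ⬝ᵥ q ⨯₃ r ≠ 0 ∧
      f ⬝ᵥ p = 0 ∧ f ⬝ᵥ r = 0 ∧ g ⬝ᵥ q = 0 ∧ g ⬝ᵥ (p + q + r) = 0 ∧ (f + g) ⬝ᵥ (p + q) = 0 ∧
      (f - g) ⬝ᵥ (q + r) = 0 := by
    -- Up to the common factor `h ⬝ᵥ f ⨯₃ g`, the vectors `g ⨯₃ h`, `h ⨯₃ f`, `f ⨯₃ g` form the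
    -- basis dual to `f`, `g`, `h`; the required equations are solved in it.
    refine ⟨h ⨯₃ f + f ⨯₃ g, -(g ⨯₃ h), -(h ⨯₃ f), ?_, ?_, ?_, ?_, ?_, ?_, ?_⟩
    · have e : (h ⨯₃ f + f ⨯₃ g) ⬝ᵥ (-(g ⨯₃ h)) ⨯₃ (-(h ⨯₃ f)) = (h ⬝ᵥ f ⨯₃ g) ^ 2 := by
        simp only [vec3_dotProduct, cross_apply, Pi.add_apply, Pi.neg_apply, cons_val]; ring
      rw [e]; exact pow_ne_zero 2 hh
    all_goals
      simp only [vec3_dotProduct, cross_apply, Pi.add_apply, Pi.sub_apply, Pi.neg_apply, cons_val]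
      ring
  obtain ⟨hpq, hqr, hpr, hrs, hsp, hqs⟩ := cross_ne_zero_of_frame hdet
  have hpq0 : p + q ≠ 0 := fun e => hpq (by
    rw [eq_neg_of_add_eq_zero_right e, map_neg, cross_self, neg_zero])
  have hqr0 : q + r ≠ 0 := fun e => hqr (by
    rw [eq_neg_of_add_eq_zero_right e, map_neg, cross_self, neg_zero])
  have mem : ∀ {f w : Fin 3 → F}, w ≠ 0 → f ⬝ᵥ w = 0 → φ.pt w ∈ φ.lineOf f := fun hw h =>
    (PlaneChart.pt_mem_lineOf hw).mpr h
  have zf := dot_self_cross f g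
  have zg := dot_cross_self f g
  refine ⟨⟨PlaneChart.isLine_lineOf hf, PlaneChart.isLine_lineOf hadd, PlaneChart.isLine_lineOf hg,
    PlaneChart.isLine_lineOf hsub⟩, ⟨mem hfg zf, mem hfg ?_, mem hfg zg, mem hfg ?_⟩, _, _, _, _,
    PlaneChart.isQuadrangle_of_det (φ := φ) hdet, (PlaneChart.join_eq_lineOf hf hpr fp fr).symm,
    (PlaneChart.join_eq_lineOf hg hqs gq gs).symm,
    ⟨φ.pt (p + q), mem hpq0 hX, (PlaneChart.pt_mem_join hpq hpq0).mpr ?_,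
      (PlaneChart.pt_mem_join hrs hpq0).mpr ?_⟩,
    ⟨φ.pt (q + r), mem hqr0 hY, (PlaneChart.pt_mem_join hqr hqr0).mpr ?_,
      (PlaneChart.pt_mem_join hsp hqr0).mpr ?_⟩⟩
  · rw [add_dotProduct, zf, zg, add_zero]
  · rw [sub_dotProduct, zf, zg, sub_zero]
  all_goals simp only [vec3_dotProduct, cross_apply, Pi.add_apply, cons_val]; ring

end Pencils

end HarmonicGeometry
-- The standard conic and coordinates adapted to a quadrangle.
namespace HarmonicGeometry

open PointLineGeometry Matrix

section ConicVectors

variable {F : Type*} [Field F]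

/-- The point of the standard conic with given parameters. -/
def conic (x : F × F) : Fin 3 → F := ![x.1 ^ 2, x.1 * x.2, x.2 ^ 2]

/-- The coefficients of the tangent line of the standard conic at a point. -/
def conicTangent (x : F × F) : Fin 3 → F := ![x.2 ^ 2, -(2 * x.1 * x.2), x.1 ^ 2]

theorem conic_ne_zero {x : F × F} (hx : x ≠ 0) : conic x ≠ 0 := fun h => hx <| by
  have h0 := congrFun h 0
  have h2 := congrFun h 2
  simp [conic] at h0 h2
  exact Prod.ext h0 h2

theorem conicTangent_ne_zero {x : F × F} (hx : x ≠ 0) : conicTangent x ≠ 0 := fun h => hx <| by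
  have h0 := congrFun h 0
  have h2 := congrFun h 2
  simp [conicTangent] at h0 h2
  exact Prod.ext h2 h0

theorem tangent_dot_conic (x y : F × F) :
    conicTangent x ⬝ᵥ conic y = (x.2 * y.1 - x.1 * y.2) ^ 2 := by
  simp only [vec3_dotProduct, conic, conicTangent, cons_val]; ring

/-- If `conic y` is a multiple of `conic x`, the tangent form at `x` kills it, and its value is a
square. -/
theorem conic_cross_eq_zero_iff (x y : F × F) :
    conic x ⨯₃ conic y = 0 ↔ x.2 * y.1 = x.1 * y.2 ∨ (x = 0 ∨ y = 0) := by
  constructor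
  · intro h
    by_cases hx : x = 0
    · exact Or.inr (Or.inl hx)
    obtain ⟨c, hc⟩ := (cross_eq_zero_iff (conic_ne_zero hx)).mp h
    left
    have h1 := tangent_dot_conic x y
    rw [hc, dotProduct_smul, tangent_dot_conic, mul_comm x.1, sub_self] at h1
    simpa [sub_eq_zero] using h1.symm
  · rintro (h | rfl | rfl)
    · simp only [cross_apply, conic, cons_val]
      funext i
      fin_cases i <;> simp only [Fin.zero_eta, Fin.mk_one, Fin.reduceFinMk, cons_val, Pi.zero_apply]
      · linear_combination (x.2 * y.2) * (-h)
      · linear_combination (x.2 * y.1 + x.1 * y.2) * h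
      · linear_combination (-x.1 * y.1) * h
    · simp [conic, cross_apply]
    · simp [conic, cross_apply]

end ConicVectors

namespace PlaneChart

variable {P : Type*} [ProjectiveSpace P] {E : Set P} {F : Type*} [Field F] {φ : PlaneChart E F}

/-- A change of homogeneous coordinates. -/
def reframe (φ : PlaneChart E F) {u v w : Fin 3 → F} (h : u ⬝ᵥ v ⨯₃ w ≠ 0) : PlaneChart E F :=
  let T : (Fin 3 → F) →ₗ[F] (Fin 3 → F) := Fintype.linearCombination F ![u, v, w]
  have hT : ∀ x, T x = x 0 • u + x 1 • v + x 2 • w := fun x => by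
    simp [T, Fintype.linearCombination_apply, Fin.sum_univ_three]
  have hinj : ∀ {x}, T x = 0 → x = 0 := fun {x} hx => by
    rw [hT] at hx
    by_contra hne
    refine h ((exists_dependence_iff u v w).mp ⟨x 0, x 1, x 2, ?_, hx⟩)
    by_contra h0
    push Not at h0
    apply hne
    funext i
    fin_cases i
    exacts [h0.1, h0.2.1, h0.2.2]
  have hne : ∀ {x}, x ≠ 0 → T x ≠ 0 := fun hx e => hx (hinj e)
  have heq : ∀ {x y}, T x = T y ↔ x = y := fun {x y} =>
    ⟨fun h => sub_eq_zero.mp (hinj (by rw [map_sub, h, sub_self])), fun h => by rw [h]⟩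
  { pt := fun x => φ.pt (T x)
    isPlane := φ.isPlane
    pt_mem := fun hx => φ.pt_mem (hne hx)
    exists_pt := fun {X} hX => by
      obtain ⟨y, hy, rfl⟩ := φ.exists_pt hX
      obtain ⟨a, b, c, rfl⟩ := exists_coordinates h y
      have e : T ![a, b, c] = a • u + b • v + c • w := by rw [hT]; rfl
      exact ⟨![a, b, c], fun h0 => hy (by rw [← e, h0, map_zero]), by rw [e]⟩
    pt_eq_iff := fun {x y} hx hy => by
      rw [φ.pt_eq_iff (hne hx) (hne hy)]
      exact exists_congr fun c => by rw [← map_smul, heq]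
    collinear_iff := fun {x y z} hx hy hz => by
      rw [φ.collinear_iff (hne hx) (hne hy) (hne hz)]
      refine exists_congr fun a => exists_congr fun b => exists_congr fun c => and_congr_right' ?_
      rw [← map_smul, ← map_smul, ← map_smul, ← map_add, ← map_add]
      exact ⟨hinj, fun h => by rw [h, map_zero]⟩
    two_ne_zero := φ.two_ne_zero }

theorem reframe_pt {u v w : Fin 3 → F} (h : u ⬝ᵥ v ⨯₃ w ≠ 0) (x : Fin 3 → F) :
    (φ.reframe h).pt x = φ.pt (x 0 • u + x 1 • v + x 2 • w) := by
  simp [reframe, Fintype.linearCombination_apply, Fin.sum_univ_three]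

/-- The coordinates in which the vertices of a quadrangle take their standard form. -/
structure IsAdapted (φ : PlaneChart E F) (A C B D : P) : Prop where
  eq_A : A = φ.pt ![1, 0, 0]
  eq_C : C = φ.pt ![1, 1, 1]
  eq_B : B = φ.pt ![0, 0, 1]
  eq_D : D = φ.pt ![1, -1, 1]

theorem exists_adapted (φ : PlaneChart E F) {A C B D : P} (h : IsQuadrangle A C B D)
    (hE : A ∈ E ∧ C ∈ E ∧ B ∈ E ∧ D ∈ E) : ∃ ψ : PlaneChart E F, ψ.IsAdapted A C B D := by
  obtain ⟨p, q, r, hdet, rfl, rfl, rfl, rfl⟩ := φ.exists_frame_of_quadrangle h hE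
  have h2 := φ.two_ne_zero
  -- The middle basis vector `m` is chosen to make `p + m + r = -2 q` and `p - m + r = 2 (p + q +
  -- r)`, which represent `C` and `D`.
  have hdet' : p ⬝ᵥ (-(p + (2 : F) • q + r)) ⨯₃ r ≠ 0 := by
    have e : p ⬝ᵥ (-(p + (2 : F) • q + r)) ⨯₃ r = -(2 * (p ⬝ᵥ q ⨯₃ r)) := by
      simp only [vec3_dotProduct, cross_apply, Pi.add_apply, Pi.neg_apply, Pi.smul_apply,
        smul_eq_mul, cons_val]
      ring
    rw [e]
    exact neg_ne_zero.mpr (mul_ne_zero h2 hdet)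
  obtain ⟨hpq, hqr, -, -, hsp, -⟩ := cross_ne_zero_of_frame hdet
  refine ⟨φ.reframe hdet', ?_, ?_, ?_, ?_⟩
  · rw [reframe_pt]; simp
  · rw [reframe_pt, ← φ.pt_smul (neg_ne_zero.mpr h2) (right_ne_zero_of_cross hpq)]
    congr 1
    simp only [cons_val, one_smul]
    module
  · rw [reframe_pt]; simp
  · rw [reframe_pt, ← φ.pt_smul h2 (left_ne_zero_of_cross hsp)]
    congr 1
    simp only [cons_val, one_smul]
    module

variable {A C B D : P}

theorem vec_ne_zero {a b c : F} (h : a ≠ 0 ∨ b ≠ 0 ∨ c ≠ 0) : ![a, b, c] ≠ 0 := fun e => by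
  have h0 := congrFun e 0
  have h1 := congrFun e 1
  have h2 := congrFun e 2
  simp at h0 h1 h2
  tauto

theorem mem_lineOf_vec {f : Fin 3 → F} {a b c : F} (h : a ≠ 0 ∨ b ≠ 0 ∨ c ≠ 0) :
    φ.pt ![a, b, c] ∈ φ.lineOf f ↔ f 0 * a + f 1 * b + f 2 * c = 0 := by
  rw [pt_mem_lineOf (vec_ne_zero h), vec3_dotProduct]
  rfl

theorem IsAdapted.mem (h : φ.IsAdapted A C B D) : A ∈ E ∧ C ∈ E ∧ B ∈ E ∧ D ∈ E := by
  rw [h.eq_A, h.eq_B, h.eq_C, h.eq_D]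
  refine ⟨φ.pt_mem (vec_ne_zero ?_), φ.pt_mem (vec_ne_zero ?_), φ.pt_mem (vec_ne_zero ?_),
    φ.pt_mem (vec_ne_zero ?_)⟩ <;> simp

theorem IsAdapted.mem_lineOf_iff (h : φ.IsAdapted A C B D) (f : Fin 3 → F) :
    (A ∈ φ.lineOf f ↔ f 0 = 0) ∧ (C ∈ φ.lineOf f ↔ f 0 + f 1 + f 2 = 0) ∧
      (B ∈ φ.lineOf f ↔ f 2 = 0) ∧ (D ∈ φ.lineOf f ↔ f 0 - f 1 + f 2 = 0) := by
  rw [h.eq_A, h.eq_B, h.eq_C, h.eq_D]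
  refine ⟨?_, ?_, ?_, ?_⟩ <;> rw [mem_lineOf_vec (by simp)] <;> simp [sub_eq_add_neg]

/-- The harmonic curve of a quadrangle is a conic. -/
theorem IsAdapted.mem_harmonicCurve (h : φ.IsAdapted A C B D) (hquad : IsQuadrangle A C B D)
    (Z : P) : Z ∈ harmonicCurve A C B D ↔ ∃ x : F × F, x ≠ 0 ∧ Z = φ.pt (conic x) := by
  have h2 := φ.two_ne_zero
  have hmem := h.mem
  constructor
  · rintro ⟨a, c, b, d, hp, hA, hC, hB, hD⟩
    obtain ⟨G, hG, ⟨aG, cG, bG, -⟩, hcoord⟩ := hp.exists_plane F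
    have : G = E := hG.eq_of_mem φ.isPlane hquad.2.1 (aG hA) (cG hC) (bG hB) hmem.1 hmem.2.1
      hmem.2.2.1
    subst this
    obtain ⟨f, g, hfg, rfl, rfl, rfl, rfl, rfl⟩ := hcoord φ
    rw [(h.mem_lineOf_iff _).1] at hA
    rw [(h.mem_lineOf_iff _).2.1] at hC
    rw [(h.mem_lineOf_iff _).2.2.1] at hB
    rw [(h.mem_lineOf_iff _).2.2.2] at hD
    simp only [Pi.add_apply, Pi.sub_apply] at hC hD
    -- Adding and subtracting the conditions at `C` and `D` leaves `f = (0, f₁, f₂)` and `g = (-f₁,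
    -- -f₂, 0)`, whose cross product is the point of the conic with parameter `(f₂, -f₁)`.
    have e1 : g 1 = -f 2 := mul_left_cancel₀ h2 (by linear_combination hC + hD - 2 * hA)
    have e2 : g 0 = -f 1 := mul_left_cancel₀ h2 (by linear_combination hC - hD - 2 * hB)
    have e : f ⨯₃ g = conic (f 2, -f 1) := by
      simp only [cross_apply, conic, hA, hB, e1, e2]
      funext i
      fin_cases i <;> simp <;> ring
    refine ⟨(f 2, -f 1), fun h0 => hfg ?_, by rw [e]⟩
    rw [e, h0]
    funext i
    fin_cases i <;> simp [conic]
  · rintro ⟨x, hx, rfl⟩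
    have e : ![0, -x.2, x.1] ⨯₃ ![x.2, -x.1, 0] = conic x := by
      simp only [cross_apply, conic]
      funext i
      fin_cases i <;> simp <;> ring
    have hpen := φ.isHarmonicPencil (f := ![0, -x.2, x.1]) (g := ![x.2, -x.1, 0])
      (by rw [e]; exact conic_ne_zero hx)
    rw [e] at hpen
    refine ⟨_, _, _, _, hpen, ?_, ?_, ?_, ?_⟩
    · rw [(h.mem_lineOf_iff _).1]; rfl
    · rw [(h.mem_lineOf_iff _).2.1]; simp
    · rw [(h.mem_lineOf_iff _).2.2.1]; rfl
    · rw [(h.mem_lineOf_iff _).2.2.2]; simp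

/-- The pencil that defines a vertex tangent, in coordinates. -/
theorem exists_of_isVertexTangent {a c b d : Fin 3 → F} (hdet : a ⬝ᵥ c ⨯₃ b ≠ 0) (hd : d ≠ 0)
    {z : Set P} (h : IsVertexTangent (φ.pt a) (φ.pt c) (φ.pt b) (φ.pt d) z) :
    ∃ f g : Fin 3 → F, f ≠ 0 ∧ z = φ.lineOf f ∧ f ⬝ᵥ a = 0 ∧ g ⬝ᵥ a = 0 ∧ g ⬝ᵥ b = 0 ∧
      (f + g) ⬝ᵥ c = 0 ∧ (f - g) ⬝ᵥ d = 0 := by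
  have hc := cross_ne_zero_of_det hdet
  have ha := left_ne_zero_of_cross hc.1
  have hc0 := left_ne_zero_of_cross hc.2.1
  have hb := left_ne_zero_of_cross hc.2.2
  obtain ⟨G, hG, ⟨-, cG, bG, -⟩, hcoord⟩ := IsHarmonicPencil.exists_plane h F
  have : G = E := hG.eq_of_mem φ.isPlane (φ.not_areCollinear hdet) (cG (left_mem_join _ _))
    (cG (right_mem_join _ _)) (bG (right_mem_join _ _)) (φ.pt_mem ha) (φ.pt_mem hc0) (φ.pt_mem hb)
  subst this
  obtain ⟨f, g, hfg, hZ, e1, e2, e3, e4⟩ := hcoord φ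
  have m2 := right_mem_join (φ.pt a) (φ.pt c)
  have m3 := right_mem_join (φ.pt a) (φ.pt b)
  have m4 := right_mem_join (φ.pt a) (φ.pt d)
  rw [e2, pt_mem_lineOf hc0] at m2
  rw [e3, pt_mem_lineOf hb] at m3
  rw [e4, pt_mem_lineOf hd] at m4
  have hab := (lineOf_inter hfg).mpr hZ
  rw [pt_mem_lineOf ha, pt_mem_lineOf ha] at hab
  exact ⟨f, g, left_ne_zero_of_cross hfg, e1, hab.1, hab.2, m3, m2, m4⟩

theorem isVertexTangent_of_dot {a c b d f g : Fin 3 → F} (hac : a ⨯₃ c ≠ 0) (hab : a ⨯₃ b ≠ 0)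
    (had : a ⨯₃ d ≠ 0) (hfg : f ⨯₃ g ≠ 0) (fa : f ⬝ᵥ a = 0) (ga : g ⬝ᵥ a = 0) (gb : g ⬝ᵥ b = 0)
    (hc : (f + g) ⬝ᵥ c = 0) (hd : (f - g) ⬝ᵥ d = 0) :
    IsVertexTangent (φ.pt a) (φ.pt c) (φ.pt b) (φ.pt d) (φ.lineOf f) := by
  have ha := left_ne_zero_of_cross hab
  have e := (lineOf_inter (φ := φ) hfg).mp
    ⟨(pt_mem_lineOf ha).mpr fa, (pt_mem_lineOf ha).mpr ga⟩
  have hadd : f + g ≠ 0 := fun h0 => hfg (by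
    rw [eq_neg_of_add_eq_zero_right h0, map_neg, cross_self, neg_zero])
  have hsub : f - g ≠ 0 := fun h0 => hfg (by rw [← sub_eq_zero.mp h0, cross_self])
  unfold IsVertexTangent
  rw [join_eq_lineOf hadd hac (by rw [add_dotProduct, fa, ga, add_zero]) hc,
    join_eq_lineOf (right_ne_zero_of_cross hfg) hab ga gb,
    join_eq_lineOf hsub had (by rw [sub_dotProduct, fa, ga, sub_zero]) hd, e]
  exact φ.isHarmonicPencil hfg

end PlaneChart

end HarmonicGeometry
-- Tangent lines of a harmonic curve.
namespace HarmonicGeometry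

open PointLineGeometry Matrix

namespace PlaneChart

variable {P : Type*} [ProjectiveSpace P] {E : Set P} {F : Type*} [Field F] {φ : PlaneChart E F}

variable {A C B D : P}

/-- The tangent lines at the vertices of a quadrangle in adapted coordinates. -/
theorem IsAdapted.vertexTangent (h : φ.IsAdapted A C B D) :
    (∀ a, IsVertexTangent A C B D a ↔ a = φ.lineOf ![0, 0, 1]) ∧
    (∀ c, IsVertexTangent C B D A c ↔ c = φ.lineOf ![1, -2, 1]) ∧
    (∀ b, IsVertexTangent B D A C b ↔ b = φ.lineOf ![1, 0, 0]) ∧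
    (∀ d, IsVertexTangent D A C B d ↔ d = φ.lineOf ![1, 2, 1]) := by
  have h2 := φ.two_ne_zero
  have key : ∀ {f : Fin 3 → F} {k : F} {a b c : F}, f ≠ 0 → f 0 = k * a → f 1 = k * b →
      f 2 = k * c → φ.lineOf f = φ.lineOf ![a, b, c] := by
    intro f k a b c hf e0 e1 e2
    have e : f = k • ![a, b, c] := by
      funext i
      fin_cases i <;> simp [e0, e1, e2]
    have hk : k ≠ 0 := by rintro rfl; simp [e] at hf
    rw [e, lineOf_smul hk]
  rw [h.eq_A, h.eq_B, h.eq_C, h.eq_D]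
  have v : ∀ {a b c : F}, a ≠ 0 ∨ b ≠ 0 ∨ c ≠ 0 → ![a, b, c] ≠ 0 := vec_ne_zero
  have cr : ∀ {u v : Fin 3 → F}, (u 1 * v 2 - u 2 * v 1 ≠ 0 ∨ u 2 * v 0 - u 0 * v 2 ≠ 0 ∨
      u 0 * v 1 - u 1 * v 0 ≠ 0) → u ⨯₃ v ≠ 0 := fun h => by
    rw [cross_apply]; exact vec_ne_zero h
  have h11 : (1 + 1 : F) ≠ 0 := by rwa [one_add_one_eq_two]
  have h11' : (-1 - 1 : F) ≠ 0 := by rw [← neg_add']; exact neg_ne_zero.mpr h11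
  refine ⟨fun z => ⟨fun hz => ?_, ?_⟩, fun z => ⟨fun hz => ?_, ?_⟩, fun z => ⟨fun hz => ?_, ?_⟩,
    fun z => ⟨fun hz => ?_, ?_⟩⟩
  · obtain ⟨f, g, hf, rfl, e1, e2, e3, e4, e5⟩ := exists_of_isVertexTangent
      (by simp [cross_apply]) (v (by simp)) hz
    simp only [vec3_dotProduct, Pi.add_apply, Pi.sub_apply, cons_val] at e1 e2 e3 e4 e5
    refine key hf (k := f 2) ?_ ?_ ?_ <;> apply mul_left_cancel₀ h2
    · linear_combination 2 * e1
    · linear_combination e4 - e5 - 2 * e2 - 2 * e3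
    · ring
  · rintro rfl
    -- With this sign `f + g` vanishes at `C` and `f - g` at `D`, as the order of the pencil
    -- requires.
    have e : φ.lineOf ![0, 0, 1] = φ.lineOf ![0, 0, -1] :=
      key (k := -1) (v (by simp)) (by simp) (by simp) (by simp)
    rw [e]
    apply isVertexTangent_of_dot (g := ![0, 1, 0])
    iterate 4 (apply cr; simp)
    all_goals simp
  · obtain ⟨f, g, hf, rfl, e1, e2, e3, e4, e5⟩ := exists_of_isVertexTangent
      (by simp [cross_apply, h11]) (v (by simp)) hz
    simp only [vec3_dotProduct, Pi.add_apply, Pi.sub_apply, cons_val] at e1 e2 e3 e4 e5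
    refine key hf (k := f 0) ?_ ?_ ?_ <;> apply mul_left_cancel₀ h2
    · ring
    · linear_combination 2 * e1 - (2 * e4 - 2 * e2 + (e2 - e3) - 2 * e5)
    · linear_combination 2 * e4 - 2 * e2 + (e2 - e3) - 2 * e5
  · rintro rfl
    apply isVertexTangent_of_dot (g := ![1, 0, -1])
    iterate 4 (apply cr; simp [h11, h11'])
    all_goals simp
    ring
  · obtain ⟨f, g, hf, rfl, e1, e2, e3, e4, e5⟩ := exists_of_isVertexTangent
      (by simp [cross_apply]) (v (by simp)) hz
    simp only [vec3_dotProduct, Pi.add_apply, Pi.sub_apply, cons_val] at e1 e2 e3 e4 e5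
    refine key hf (k := f 0) ?_ ?_ ?_ <;> apply mul_left_cancel₀ h2
    · ring
    · linear_combination e5 - e4 + 2 * e3 + 2 * e2
    · linear_combination 2 * e1
  · rintro rfl
    apply isVertexTangent_of_dot (g := ![0, 1, 0])
    iterate 4 (apply cr; simp)
    all_goals simp
  · obtain ⟨f, g, hf, rfl, e1, e2, e3, e4, e5⟩ := exists_of_isVertexTangent
      (by simp [cross_apply, h11]) (v (by simp)) hz
    simp only [vec3_dotProduct, Pi.add_apply, Pi.sub_apply, cons_val] at e1 e2 e3 e4 e5
    refine key hf (k := f 0) ?_ ?_ ?_ <;> apply mul_left_cancel₀ h2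
    · ring
    · linear_combination -2 * e1 + (2 * e5 - 2 * e4 + (e2 + e3))
    · linear_combination 2 * e5 - 2 * e4 + (e2 + e3)
  · rintro rfl
    apply isVertexTangent_of_dot (g := ![-1, 0, 1])
    iterate 4 (apply cr; simp [h11, h11'])
    all_goals simp
    ring

/-- The tangent bundle of a quadrangle consists of the tangent lines of its conic. -/
theorem IsAdapted.mem_tangentBundle (h : φ.IsAdapted A C B D) (z : Set P) :
    z ∈ tangentBundle A C B D ↔ ∃ x : F × F, x ≠ 0 ∧ z = φ.lineOf (conicTangent x) := by
  have h2 := φ.two_ne_zero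
  obtain ⟨tA, tC, tB, tD⟩ := h.vertexTangent
  constructor
  · rintro ⟨a, c, b, d, ha, hc, hb, hd, hz, A', C', B', D', hharm, ⟨zA, zC, zB, zD⟩, hA, hC, hB, hD⟩
    rw [tA] at ha
    rw [tC] at hc
    rw [tB] at hb
    rw [tD] at hd
    subst ha hc hb hd
    obtain ⟨u, hu, hu2, rfl⟩ := hA
    obtain ⟨v, hv, hv0, rfl⟩ := hB
    have hne := (hharm.exists_quadrangle φ.isPlane (φ.pt_mem hu) (φ.pt_mem hv)).1
    have huv : u ⨯₃ v ≠ 0 := fun e => hne ((φ.pt_eq_iff_cross hu hv).mpr e)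
    obtain ⟨x, y, hx, hy, rfl, rfl⟩ := (isHarmonicSet_iff huv).mp hharm
    rw [← φ.pt_smul hx hu] at zA
    rw [← φ.pt_smul hy hv] at zB
    have hu2' : (x • u) 2 = 0 := by simp at hu2 ⊢; exact Or.inr hu2
    have hv0' : (y • v) 0 = 0 := by simp at hv0 ⊢; exact Or.inr hv0
    have huv' : (x • u) ⨯₃ (y • v) ≠ 0 := by simp [huv, hx, hy]
    clear hu2 hv0 hu hv hharm hne huv
    generalize x • u = u at *
    generalize y • v = v at *
    have hadd : u + v ≠ 0 := fun h0 => huv' (by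
      rw [eq_neg_of_add_eq_zero_right h0, map_neg, cross_self, neg_zero])
    have hsub : u - v ≠ 0 := fun h0 => huv' (by rw [← sub_eq_zero.mp h0, cross_self])
    rw [pt_mem_lineOf hadd] at hC
    rw [pt_mem_lineOf hsub] at hD
    simp only [vec3_dotProduct, Pi.add_apply, Pi.sub_apply, cons_val] at hC hD
    -- With the scalars absorbed, `u + v` and `u - v` lie on the tangents at `C` and `D`. This gives
    -- `u = (2 v₁, u₁, 0)` and `v = (0, v₁, 2 u₁)`, which span the tangent with parameter `(v₁,
    -- u₁)`.
    have e0 : u 0 = 2 * v 1 := mul_left_cancel₀ h2 (by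
      linear_combination hC + hD - 2 * hv0' + 2 * hv0' - 2 * hu2')
    have e2 : v 2 = 2 * u 1 := mul_left_cancel₀ h2 (by linear_combination hC - hD - 2 * hv0')
    have e : u ⨯₃ v = (2 : F) • conicTangent (v 1, u 1) := by
      simp only [cross_apply, conicTangent, hu2', hv0', e0, e2]
      funext i
      fin_cases i <;> simp <;> ring
    have hx0 : (v 1, u 1) ≠ (0 : F × F) := fun h0 => huv' (by
      rw [e, h0]
      funext i
      fin_cases i <;> simp [conicTangent])
    refine ⟨(v 1, u 1), hx0, ?_⟩
    rw [← lineOf_smul h2, ← e]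
    exact eq_lineOf hz huv' huv' zA zB (by rw [dotProduct_comm, dot_self_cross])
      (by rw [dotProduct_comm, dot_cross_self])
  · rintro ⟨x, hx, rfl⟩
    have e : ![2 * x.1, x.2, 0] ⨯₃ ![0, x.1, 2 * x.2] = (2 : F) • conicTangent x := by
      simp only [cross_apply, conicTangent]
      funext i
      fin_cases i <;> simp <;> ring
    have hne : ![2 * x.1, x.2, 0] ⨯₃ ![0, x.1, 2 * x.2] ≠ 0 := by
      rw [e]; exact smul_ne_zero h2 (conicTangent_ne_zero hx)
    have hu := left_ne_zero_of_cross hne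
    have hv := right_ne_zero_of_cross hne
    have hadd : ![2 * x.1, x.2, 0] + ![0, x.1, 2 * x.2] ≠ 0 := fun h0 => hne (by
      rw [eq_neg_of_add_eq_zero_right h0, map_neg, cross_self, neg_zero])
    have hsub : ![2 * x.1, x.2, 0] - ![0, x.1, 2 * x.2] ≠ 0 := fun h0 => hne (by
      rw [← sub_eq_zero.mp h0, cross_self])
    have hharm := isHarmonicSet_pt (φ := φ) hne one_ne_zero one_ne_zero
    rw [one_smul, one_smul] at hharm
    refine ⟨_, _, _, _, (tA _).mpr rfl, (tC _).mpr rfl, (tB _).mpr rfl, (tD _).mpr rfl,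
      isLine_lineOf (conicTangent_ne_zero hx), _, _, _, _, hharm, ⟨?_, ?_, ?_, ?_⟩, ?_, ?_, ?_, ?_⟩
    all_goals
      rw [pt_mem_lineOf (by assumption)]
      simp only [vec3_dotProduct, conicTangent, Pi.add_apply, Pi.sub_apply, cons_val]
      ring

theorem pt_conic_eq_iff {x y : F × F} (hx : x ≠ 0) (hy : y ≠ 0) :
    φ.pt (conic x) = φ.pt (conic y) ↔ x.2 * y.1 = x.1 * y.2 := by
  rw [φ.pt_eq_iff_cross (conic_ne_zero hx) (conic_ne_zero hy), conic_cross_eq_zero_iff]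
  simp [hx, hy]

theorem pt_conic_mem_tangent {x y : F × F} (hy : y ≠ 0) :
    φ.pt (conic y) ∈ φ.lineOf (conicTangent x) ↔ x.2 * y.1 = x.1 * y.2 := by
  rw [pt_mem_lineOf (conic_ne_zero hy), tangent_dot_conic, sq_eq_zero_iff, sub_eq_zero]

/-- A line that meets the conic in a single point is a tangent line. -/
theorem eq_tangent_of_forall {f : Fin 3 → F} (hf : f ≠ 0) {x : F × F} (hx : x ≠ 0)
    (h : f ⬝ᵥ conic x = 0)
    (huniq : ∀ y : F × F, y ≠ 0 → f ⬝ᵥ conic y = 0 → x.2 * y.1 = x.1 * y.2) :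
    φ.lineOf f = φ.lineOf (conicTangent x) := by
  -- On the conic `f` becomes a binary quadratic form with root `x`. Both pairs are expressions for
  -- its second root by Vieta's formulas; two are needed since either may vanish. Uniqueness makes
  -- `x` a double root.
  have h1 := huniq (f 2 * x.1, -(f 2 * x.2 + f 1 * x.1))
  have h3 := huniq (f 1 * x.2 + f 0 * x.1, -(f 0 * x.2))
  simp only [vec3_dotProduct, conic, cons_val] at h h1 h3
  have k1 : x.1 * (2 * f 2 * x.2 + f 1 * x.1) = 0 := by
    by_cases h0 : (f 2 * x.1, -(f 2 * x.2 + f 1 * x.1)) = (0 : F × F)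
    · simp only [Prod.mk_eq_zero] at h0
      linear_combination x.2 * h0.1 - x.1 * h0.2
    · linear_combination h1 h0 (by linear_combination (f 2) ^ 2 * h)
  have k3 : x.2 * (f 1 * x.2 + 2 * f 0 * x.1) = 0 := by
    by_cases h0 : (f 1 * x.2 + f 0 * x.1, -(f 0 * x.2)) = (0 : F × F)
    · simp only [Prod.mk_eq_zero] at h0
      linear_combination x.2 * h0.1 - x.1 * h0.2
    · linear_combination h3 h0 (by linear_combination (f 0) ^ 2 * h)
  have key : ∃ k : F, f = k • conicTangent x := by
    by_cases hx1 : x.1 = 0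
    · have hx2 : x.2 ≠ 0 := fun e => hx (Prod.ext hx1 e)
      simp only [hx1, mul_zero, add_zero, mul_eq_zero, hx2, false_or, or_false] at k3
      simp [hx1, hx2] at h
      refine ⟨f 0 / x.2 ^ 2, ?_⟩
      funext i
      fin_cases i <;> simp [conicTangent, hx1, hx2, k3, h]
    · have k1' := (mul_eq_zero.mp k1).resolve_left hx1
      refine ⟨f 2 / x.1 ^ 2, ?_⟩
      funext i
      fin_cases i <;> simp [conicTangent, hx1] <;> field_simp
      · linear_combination h - x.2 * k1'
      · linear_combination k1'
  obtain ⟨k, rfl⟩ := key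
  exact lineOf_smul (by rintro rfl; simp at hf) _

end PlaneChart

/-- Coordinates in which a harmonic curve and its tangent lines take their standard form. -/
structure ConicChart {P : Type*} [ProjectiveSpace P] (E K : Set P) (F : Type*) [Field F] extends
    PlaneChart E F where
  mem_iff : ∀ Z, Z ∈ K ↔ ∃ x : F × F, x ≠ 0 ∧ Z = pt (conic x)
  isTangentLine_iff : ∀ {x : F × F}, x ≠ 0 → ∀ z,
    IsTangentLine K (pt (conic x)) z ↔ z = toPlaneChart.lineOf (conicTangent x)

/-- Another quadrangle generating `K` has its own chart, perhaps over another field. There its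
tangents meet `K` in one point only; this property needs no coordinates, so it transfers to the
fixed chart, where it characterizes tangents. -/
theorem exists_conicChart.{u} {P : Type u} [ProjectiveSpace P] {E K : Set P}
    (hK : IsHarmonicCurve E K) : ∃ (F : Type u) (_ : Field F), Nonempty (ConicChart E K F) := by
  obtain ⟨hE, A, C, B, D, hmem, hquad, rfl⟩ := hK
  obtain ⟨F, hF, ⟨φ₀⟩⟩ := exists_planeChart hE
  obtain ⟨φ, hφ⟩ := φ₀.exists_adapted hquad hmem
  have hcurve := hφ.mem_harmonicCurve hquad
  refine ⟨F, hF, ⟨⟨φ, hcurve, fun {x} hx z => ⟨?_, ?_⟩⟩⟩⟩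
  · rintro ⟨hZ, hZz, A', C', B', D', hquad', heq, hz⟩
    obtain ⟨⟨G, hG, hA', hC', hB', hD'⟩, hn, -⟩ := id hquad'
    obtain ⟨F', hF', ⟨ψ₀⟩⟩ := exists_planeChart hG
    obtain ⟨ψ, hψ⟩ := ψ₀.exists_adapted hquad' ⟨hA', hC', hB', hD'⟩
    have hcurve' := hψ.mem_harmonicCurve hquad'
    have hsub : ∀ Z ∈ harmonicCurve A' C' B' D', Z ∈ E := by
      intro Z hZ
      rw [← heq] at hZ
      obtain ⟨y, hy, rfl⟩ := (hcurve Z).mp hZ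
      exact φ.pt_mem (conic_ne_zero hy)
    -- The vertices of a quadrangle lie on its own curve, so they lie in `E`.
    have hGE : G = E := by
      refine hG.eq_of_mem hE hn hA' hC' hB' (hsub _ ?_) (hsub _ ?_) (hsub _ ?_) <;> rw [hcurve']
      · exact ⟨(1, 0), by simp, by simp [conic, hψ.eq_A]⟩
      · exact ⟨(1, 1), by simp, by simp [conic, hψ.eq_C]⟩
      · exact ⟨(0, 1), by simp, by simp [conic, hψ.eq_B]⟩
    subst hGE
    obtain ⟨y, hy, rfl⟩ := (hψ.mem_tangentBundle z).mp hz
    obtain ⟨f, hf, hzf⟩ := φ.exists_lineOf (PlaneChart.isLine_lineOf (φ := ψ)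
      (conicTangent_ne_zero hy)) (PlaneChart.lineOf_subset _)
    have huniq : ∀ W, W ∈ harmonicCurve A C B D → W ∈ φ.lineOf f → W = ψ.pt (conic y) := by
      intro W hW hWf
      rw [heq] at hW
      obtain ⟨w, hw, rfl⟩ := (hcurve' W).mp hW
      rw [← hzf, PlaneChart.pt_conic_mem_tangent hw] at hWf
      exact ((PlaneChart.pt_conic_eq_iff hy hw).mpr hWf).symm
    have hZf : φ.pt (conic x) ∈ φ.lineOf f := hzf ▸ hZz
    rw [hzf]
    refine PlaneChart.eq_tangent_of_forall hf hx
      ((PlaneChart.pt_mem_lineOf (conic_ne_zero hx)).mp hZf) fun v hv hv0 => ?_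
    rw [← PlaneChart.pt_conic_eq_iff (φ := φ) hx hv, huniq _ ((hcurve _).mpr ⟨x, hx, rfl⟩) hZf]
    exact (huniq _ ((hcurve _).mpr ⟨v, hv, rfl⟩)
      ((PlaneChart.pt_mem_lineOf (conic_ne_zero hv)).mpr hv0)).symm
  · rintro rfl
    exact ⟨(hcurve _).mpr ⟨x, hx, rfl⟩, (PlaneChart.pt_conic_mem_tangent hx).mpr (mul_comm _ _),
      A, C, B, D, hquad, rfl, (hφ.mem_tangentBundle _).mpr ⟨x, hx, rfl⟩⟩

end HarmonicGeometry
-- Parametrized lines and the comparison of harmonic groups.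
namespace HarmonicGeometry

open PointLineGeometry Matrix

/-- Homogeneous coordinates on a set of points that is a projective line. -/
structure Parametrization {P : Type*} (S : Set P) (F : Type*) [Field F] where
  pt : F × F → P
  pt_mem : ∀ {x}, x ≠ 0 → pt x ∈ S
  exists_pt : ∀ {X}, X ∈ S → ∃ x, x ≠ 0 ∧ X = pt x
  pt_eq_iff : ∀ {x y}, x ≠ 0 → y ≠ 0 → (pt x = pt y ↔ x.2 * y.1 = x.1 * y.2)

section Pairs

variable {F : Type*} [Field F] {u v : F × F}

theorem exists_pair_coordinates (h : u.2 * v.1 ≠ u.1 * v.2) (x : F × F) :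
    ∃ α β : F, x = α • u + β • v := by
  have hd : u.1 * v.2 - u.2 * v.1 ≠ 0 := sub_ne_zero.mpr h.symm
  refine ⟨(x.1 * v.2 - x.2 * v.1) / (u.1 * v.2 - u.2 * v.1),
    (u.1 * x.2 - u.2 * x.1) / (u.1 * v.2 - u.2 * v.1), Prod.ext ?_ ?_⟩ <;>
  · simp only [Prod.fst_add, Prod.snd_add, Prod.smul_fst, Prod.smul_snd, smul_eq_mul]
    rw [div_mul_eq_mul_div, div_mul_eq_mul_div, ← add_div, eq_div_iff hd]
    ring

theorem pair_coordinates_ne_zero {α β : F} (h : α • u + β • v ≠ 0) : α ≠ 0 ∨ β ≠ 0 := by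
  by_contra! h0
  exact h (by simp [h0])

theorem pair_combination_ne_zero (h : u.2 * v.1 ≠ u.1 * v.2) {α β : F} (h0 : α ≠ 0 ∨ β ≠ 0) :
    α • u + β • v ≠ 0 := by
  intro e
  have e1 : α * u.1 + β * v.1 = 0 := congrArg Prod.fst e
  have e2 : α * u.2 + β * v.2 = 0 := congrArg Prod.snd e
  have hd : u.1 * v.2 - u.2 * v.1 ≠ 0 := sub_ne_zero.mpr h.symm
  have k1 : α * (u.1 * v.2 - u.2 * v.1) = 0 := by linear_combination v.2 * e1 - v.1 * e2
  have k2 : β * (u.1 * v.2 - u.2 * v.1) = 0 := by linear_combination u.1 * e2 - u.2 * e1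
  simp [hd] at k1 k2
  tauto

theorem pair_sub_ne_zero (h : u.2 * v.1 ≠ u.1 * v.2) {α β : F} (h0 : α • u + β • v ≠ 0) :
    α • u - β • v ≠ 0 := by
  rw [sub_eq_add_neg, ← neg_smul]
  exact pair_combination_ne_zero h ((pair_coordinates_ne_zero h0).imp_right neg_ne_zero.mpr)

end Pairs

namespace Parametrization

variable {P : Type*} {S S' : Set P} {F : Type*} [Field F]

/-- Points with equal coordinates correspond. -/
theorem exists_equiv (ψ : Parametrization S F) (ψ' : Parametrization S' F) :
    ∃ e : S ≃ S', ∀ x, x ≠ 0 → ∀ X : S, (X : P) = ψ.pt x ↔ (e X : P) = ψ'.pt x := by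
  choose c hc hpt using fun X : S => ψ.exists_pt X.2
  have key : ∀ x, x ≠ 0 → ∀ X : S, (X : P) = ψ.pt x ↔ ψ'.pt (c X) = ψ'.pt x := fun x hx X => by
    rw [hpt X, ψ.pt_eq_iff (hc X) hx, ψ'.pt_eq_iff (hc X) hx]
  have hbij : Function.Bijective fun X : S => (⟨ψ'.pt (c X), ψ'.pt_mem (hc X)⟩ : S') := by
    refine ⟨fun X Y h => Subtype.ext ?_, fun Y => ?_⟩
    · rw [hpt Y]
      exact (key _ (hc Y) X).mpr (congrArg Subtype.val h)
    · obtain ⟨y, hy, hY⟩ := ψ'.exists_pt Y.2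
      exact ⟨⟨ψ.pt y, ψ.pt_mem hy⟩,
        Subtype.ext (((key y hy ⟨ψ.pt y, ψ.pt_mem hy⟩).mp rfl).trans hY.symm)⟩
  exact ⟨Equiv.ofBijective _ hbij, key⟩

/-- The permutation `f` fixes the points with coordinates `u` and `v` and is the harmonic
reflection with respect to them. -/
def IsReflection (ψ : Parametrization S F) (u v : F × F) (f : Equiv.Perm S) : Prop :=
  ∀ (X : S) (α β : F), α • u + β • v ≠ 0 → (X : P) = ψ.pt (α • u + β • v) →
    (f X : P) = ψ.pt (α • u - β • v)

theorem IsReflection.unique {ψ : Parametrization S F} {u v : F × F} (h : u.2 * v.1 ≠ u.1 * v.2)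
    {f g : Equiv.Perm S} (hf : ψ.IsReflection u v f) (hg : ψ.IsReflection u v g) : f = g := by
  ext X
  obtain ⟨x, hx, hX⟩ := ψ.exists_pt X.2
  obtain ⟨α, β, rfl⟩ := exists_pair_coordinates h x
  rw [hf X α β hx hX, hg X α β hx hX]

theorem IsReflection.permCongr {ψ : Parametrization S F} {ψ' : Parametrization S' F} {e : S ≃ S'}
    (he : ∀ x, x ≠ 0 → ∀ X : S, (X : P) = ψ.pt x ↔ (e X : P) = ψ'.pt x) {u v : F × F}
    (h : u.2 * v.1 ≠ u.1 * v.2) {f : Equiv.Perm S} (hf : ψ.IsReflection u v f) :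
    ψ'.IsReflection u v (e.permCongr f) := by
  intro X α β hne hX
  rw [Equiv.permCongr_apply, ← he _ (pair_sub_ne_zero h hne)]
  refine hf _ α β hne ?_
  rw [he _ hne, e.apply_symm_apply, hX]

end Parametrization

/-- Homogeneous coordinates on a line, with the harmonic reflections in coordinates. -/
structure LineChart {P : Type*} [ProjectiveSpace P] (l : Set P) (F : Type*) [Field F] extends
    Parametrization l F where
  reflectsTo_iff : ∀ {u v}, u.2 * v.1 ≠ u.1 * v.2 → ∀ {α β : F}, α ≠ 0 ∨ β ≠ 0 → ∀ Y,
    ReflectsTo (pt u) (pt v) (pt (α • u + β • v)) Y ↔ Y = pt (α • u - β • v)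

theorem LineChart.isLineReflection_iff {P : Type*} [ProjectiveSpace P] {l : Set P} {F : Type*}
    [Field F] (ψ : LineChart l F) {A B : P} {f : Equiv.Perm l} :
    IsLineReflection l A B f ↔ ∃ u v : F × F, u ≠ 0 ∧ v ≠ 0 ∧ u.2 * v.1 ≠ u.1 * v.2 ∧
      A = ψ.pt u ∧ B = ψ.pt v ∧ ψ.IsReflection u v f := by
  constructor
  · rintro ⟨hA, hB, hAB, h⟩
    obtain ⟨u, hu, rfl⟩ := ψ.exists_pt hA
    obtain ⟨v, hv, rfl⟩ := ψ.exists_pt hB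
    rw [Ne, ψ.pt_eq_iff hu hv] at hAB
    refine ⟨u, v, hu, hv, hAB, rfl, rfl, fun X α β hne hX => ?_⟩
    have := h X
    rwa [hX, ψ.reflectsTo_iff hAB (pair_coordinates_ne_zero hne)] at this
  · rintro ⟨u, v, hu, hv, hne, rfl, rfl, h⟩
    refine ⟨ψ.pt_mem hu, ψ.pt_mem hv, fun e => hne ((ψ.pt_eq_iff hu hv).mp e), fun X => ?_⟩
    obtain ⟨x, hx, hX⟩ := ψ.exists_pt X.2
    obtain ⟨α, β, rfl⟩ := exists_pair_coordinates hne x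
    rw [h X α β hx hX, hX, ψ.reflectsTo_iff hne (pair_coordinates_ne_zero hx)]

section Groups

variable {G H : Type*} [Group G] [Group H] {S : Set G} {S' : Set H} {N : Subgroup G}
  {N' : Subgroup H}

/-- An injective homomorphism that maps generators onto generators is an isomorphism onto the
group generated by them. -/
theorem exists_mulEquiv_of_generators (hN : N = Subgroup.closure S) (hN' : N' = Subgroup.closure S')
    (Ψ : N →* H) (hinj : Function.Injective Ψ) (h1 : ∀ g : N, (g : G) ∈ S → Ψ g ∈ S')
    (h2 : ∀ h ∈ S', ∃ g : N, (g : G) ∈ S ∧ Ψ g = h) :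
    ∃ Φ : N ≃* N', ∀ g, (Φ g : H) = Ψ g := by
  subst hN hN'
  have hr : Ψ.range = Subgroup.closure S' := by
    rw [MonoidHom.range_eq_map, ← Subgroup.closure_closure_coe_preimage, MonoidHom.map_closure]
    congr 1
    ext h
    constructor
    · rintro ⟨g, hg, rfl⟩
      exact h1 g hg
    · exact h2 h
  exact ⟨(MonoidHom.ofInjective hinj).trans (MulEquiv.subgroupCongr hr), fun g => rfl⟩

theorem nonempty_mulEquiv_of_generators (hN : N = Subgroup.closure S)
    (hN' : N' = Subgroup.closure S') (e : G ≃* H) (h : ∀ g, g ∈ S ↔ e g ∈ S') :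
    Nonempty (N ≃* N') := by
  obtain ⟨Φ, -⟩ := exists_mulEquiv_of_generators hN hN' (e.toMonoidHom.comp N.subtype)
    (e.injective.comp Subtype.val_injective) (fun g hg => (h g).mp hg) fun k hk => by
      have hg : e.symm k ∈ S := (h _).mpr (by rwa [e.apply_symm_apply])
      exact ⟨⟨e.symm k, hN ▸ Subgroup.subset_closure hg⟩, hg, e.apply_symm_apply k⟩
  exact ⟨Φ⟩

end Groups

namespace PlaneChart

variable {P : Type*} [ProjectiveSpace P] {E : Set P} {F : Type*} [Field F] {φ : PlaneChart E F}

theorem combination_cross (a b : Fin 3 → F) (x y x' y' : F) :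
    (x • a + y • b) ⨯₃ (x' • a + y' • b) = (x * y' - y * x') • (a ⨯₃ b) := by
  simp only [cross_apply, Pi.add_apply, Pi.smul_apply, smul_eq_mul]
  funext i
  fin_cases i <;> simp <;> ring

theorem combination_ne_zero {a b : Fin 3 → F} (hab : a ⨯₃ b ≠ 0) {x y : F} (h : x ≠ 0 ∨ y ≠ 0) :
    x • a + y • b ≠ 0 := by
  intro e
  have h1 := combination_cross a b x y 0 1
  have h2 := combination_cross a b x y 1 0
  rw [e, map_zero, LinearMap.zero_apply, eq_comm, smul_eq_zero] at h1 h2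
  simp [hab] at h1 h2
  tauto

theorem pt_combination_eq_iff {a b : Fin 3 → F} (hab : a ⨯₃ b ≠ 0) {x y x' y' : F}
    (h : x ≠ 0 ∨ y ≠ 0) (h' : x' ≠ 0 ∨ y' ≠ 0) :
    φ.pt (x • a + y • b) = φ.pt (x' • a + y' • b) ↔ y * x' = x * y' := by
  rw [φ.pt_eq_iff_cross (combination_ne_zero hab h) (combination_ne_zero hab h'),
    combination_cross, smul_eq_zero, sub_eq_zero]
  simp [hab, eq_comm]

/-- Harmonic reflections of a line in coordinates. -/
theorem reflectsTo_iff {a b : Fin 3 → F} (hab : a ⨯₃ b ≠ 0) {x y : F} (h : x ≠ 0 ∨ y ≠ 0) (Y : P) :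
    ReflectsTo (φ.pt a) (φ.pt b) (φ.pt (x • a + y • b)) Y ↔ Y = φ.pt (x • a - y • b) := by
  have ha := left_ne_zero_of_cross hab
  have hb := right_ne_zero_of_cross hab
  have eA : φ.pt (x • a + y • b) = φ.pt a ↔ y = 0 := by
    simpa using pt_combination_eq_iff (φ := φ) (x' := 1) (y' := 0) hab h (by simp)
  have eB : φ.pt (x • a + y • b) = φ.pt b ↔ x = 0 := by
    simpa [eq_comm] using pt_combination_eq_iff (φ := φ) (x' := 0) (y' := 1) hab h (by simp)
  unfold ReflectsTo
  rw [Ne, Ne, eA, eB, isHarmonicSet_iff hab]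
  by_cases hy : y = 0
  · have hx : x ≠ 0 := h.resolve_right (by simp [hy])
    subst hy
    simp [hx, φ.pt_smul hx ha]
  by_cases hx : x = 0
  · subst hx
    simp [hy, ← neg_smul, φ.pt_smul (neg_ne_zero.mpr hy) hb]
  simp only [hx, hy, false_and, not_false_eq_true, true_and, false_or]
  constructor
  · rintro ⟨x', y', hx', hy', e, rfl⟩
    rw [pt_combination_eq_iff hab h (Or.inl hx')] at e
    rw [sub_eq_add_neg, sub_eq_add_neg, ← neg_smul, ← neg_smul,
      pt_combination_eq_iff hab (Or.inl hx') (Or.inl hx)]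
    linear_combination e
  · rintro rfl
    exact ⟨x, y, hx, hy, rfl, rfl⟩

/-- The coordinates on a line with respect to two of its points. -/
def lineChart (φ : PlaneChart E F) {a b : Fin 3 → F} (hab : a ⨯₃ b ≠ 0) {l : Set P}
    (hl : l = φ.lineOf (a ⨯₃ b)) : LineChart l F :=
  have h0 : ∀ {x : F × F}, x ≠ 0 → x.1 ≠ 0 ∨ x.2 ≠ 0 := fun {x} hx => by
    by_contra! h
    exact hx (Prod.ext h.1 h.2)
  { pt := fun x => φ.pt (x.1 • a + x.2 • b)
    pt_mem := fun {x} hx => by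
      rw [hl, pt_mem_lineOf (combination_ne_zero hab (h0 hx))]
      simp [dotProduct_comm (a ⨯₃ b)]
    exists_pt := fun {X} hX => by
      rw [hl] at hX
      obtain ⟨w, hw, hX, rfl⟩ := hX
      obtain ⟨c, hc⟩ := exists_det_ne_zero hab
      obtain ⟨z, x, y, rfl⟩ := exists_coordinates hc w
      have hz : z = 0 := by
        rw [dotProduct_comm] at hX
        simpa [add_dotProduct, hc] using hX
      subst hz
      exact ⟨(x, y), fun e => hw (by simp_all), by simp⟩
    pt_eq_iff := fun {x y} hx hy => pt_combination_eq_iff hab (h0 hx) (h0 hy)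
    reflectsTo_iff := fun {u v} huv {α β} h Y => by
      have huv' : (u.1 • a + u.2 • b) ⨯₃ (v.1 • a + v.2 • b) ≠ 0 := by
        rw [combination_cross]
        exact smul_ne_zero (sub_ne_zero.mpr huv.symm) hab
      have e1 : (α • u + β • v).1 • a + (α • u + β • v).2 • b =
          α • (u.1 • a + u.2 • b) + β • (v.1 • a + v.2 • b) := by
        simp only [Prod.fst_add, Prod.snd_add, Prod.smul_fst, Prod.smul_snd, smul_eq_mul]
        module
      have e2 : (α • u - β • v).1 • a + (α • u - β • v).2 • b =
          α • (u.1 • a + u.2 • b) - β • (v.1 • a + v.2 • b) := by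
        simp only [Prod.fst_sub, Prod.snd_sub, Prod.smul_fst, Prod.smul_snd, smul_eq_mul]
        module
      rw [e1, e2]
      exact reflectsTo_iff huv' h Y }

theorem nonempty_lineChart (φ : PlaneChart E F) {l : Set P} (hl : IsLine l) (hlE : l ⊆ E) :
    Nonempty (LineChart l F) := by
  obtain ⟨X, hX⟩ := nonempty_of_isLine hl
  obtain ⟨Y, hY, hYX, -⟩ := exists_mem_ne hl X X
  obtain ⟨u, hu, rfl⟩ := φ.exists_pt (hlE hX)
  obtain ⟨v, hv, rfl⟩ := φ.exists_pt (hlE hY)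
  have huv : u ⨯₃ v ≠ 0 := fun e => hYX ((φ.pt_eq_iff_cross hu hv).mpr e).symm
  exact ⟨φ.lineChart huv (by rw [← join_pt huv, join_eq hl hYX.symm hX hY])⟩

end PlaneChart

section Lines

variable {P : Type*} [ProjectiveSpace P] {l m : Set P}

/-- Both charts use the same field, and reflections have the same formula in each, so the bijection
of points with equal coordinates conjugates generators to generators. -/
theorem LineChart.nonempty_mulEquiv {F : Type*} [Field F] (ψ : LineChart l F) (ψ' : LineChart m F) :
    Nonempty (harmonicGroup l ≃* harmonicGroup m) := by
  obtain ⟨e, he⟩ := ψ.exists_equiv ψ'.toParametrization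
  have he' : ∀ x, x ≠ 0 → ∀ Y : m, (Y : P) = ψ'.pt x ↔ (e.symm Y : P) = ψ.pt x := fun x hx Y => by
    rw [he x hx, e.apply_symm_apply]
  refine nonempty_mulEquiv_of_generators rfl rfl e.permCongrHom fun f => ⟨?_, ?_⟩
  · rintro ⟨A, B, h⟩
    obtain ⟨u, v, hu, hv, hne, -, -, hf⟩ := ψ.isLineReflection_iff.mp h
    exact ⟨_, _, ψ'.isLineReflection_iff.mpr ⟨u, v, hu, hv, hne, rfl, rfl, hf.permCongr he hne⟩⟩
  · rintro ⟨A, B, h⟩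
    obtain ⟨u, v, hu, hv, hne, -, -, hf⟩ := ψ'.isLineReflection_iff.mp h
    have hf' := hf.permCongr he' hne
    have ef : e.symm.permCongr (e.permCongrHom f) = f := by ext X; simp
    rw [ef] at hf'
    exact ⟨_, _, ψ.isLineReflection_iff.mpr ⟨u, v, hu, hv, hne, rfl, rfl, hf'⟩⟩

/-- Intersecting lines lie in a common plane, whose chart coordinatizes both over one field. -/
theorem nonempty_harmonicGroup_mulEquiv_of_meet (hl : IsLine l) (hm : IsLine m)
    (h : (l ∩ m).Nonempty) : Nonempty (harmonicGroup l ≃* harmonicGroup m) := by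
  by_cases hne : l = m
  · subst hne
    exact ⟨MulEquiv.refl _⟩
  obtain ⟨E, hE, hlE, hmE⟩ := exists_isPlane_of_lines_meet hl hm h hne
  obtain ⟨F, _, ⟨φ⟩⟩ := exists_planeChart hE
  obtain ⟨ψ⟩ := φ.nonempty_lineChart hl hlE
  obtain ⟨ψ'⟩ := φ.nonempty_lineChart hm hmE
  exact ψ.nonempty_mulEquiv ψ'

/-- All lines have isomorphic harmonic groups. -/
theorem nonempty_harmonicGroup_mulEquiv (hl : IsLine l) (hm : IsLine m) :
    Nonempty (harmonicGroup l ≃* harmonicGroup m) := by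
  obtain ⟨A, hA⟩ := nonempty_of_isLine hl
  obtain ⟨B, hB, hBA, -⟩ := exists_mem_ne hm A A
  obtain ⟨e⟩ := nonempty_harmonicGroup_mulEquiv_of_meet hl (isLine_join hBA.symm)
    ⟨A, hA, left_mem_join _ _⟩
  obtain ⟨e'⟩ := nonempty_harmonicGroup_mulEquiv_of_meet (isLine_join hBA.symm) hm
    ⟨B, right_mem_join _ _, hB⟩
  exact ⟨e.trans e'⟩

end Lines

end HarmonicGeometry
-- Harmonic homologies and hyperbolic reflections.
namespace HarmonicGeometry

open PointLineGeometry Matrix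

section Homology

variable {F : Type*} [Field F]

/-- The linear map that negates `q` and fixes the kernel of `h`. -/
def homology (h q : Fin 3 → F) : (Fin 3 → F) →ₗ[F] (Fin 3 → F) where
  toFun w := w - (2 * (h ⬝ᵥ w) / (h ⬝ᵥ q)) • q
  map_add' w w' := by rw [dotProduct_add]; module
  map_smul' c w := by
    rw [dotProduct_smul, smul_eq_mul, RingHom.id_apply, smul_sub, smul_smul]
    congr 2
    ring

variable {h q : Fin 3 → F}

theorem homology_combination (hq : h ⬝ᵥ q ≠ 0) {m : Fin 3 → F} (hm : h ⬝ᵥ m = 0) (s : F) :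
    homology h q (s • q + m) = m - s • q := by
  have e : 2 * (h ⬝ᵥ (s • q + m)) / (h ⬝ᵥ q) = 2 * s := by
    rw [dotProduct_add, hm, dotProduct_smul, add_zero, smul_eq_mul]
    field_simp
  change s • q + m - (2 * (h ⬝ᵥ (s • q + m)) / (h ⬝ᵥ q)) • q = _
  rw [e]
  module

theorem exists_homology_decomposition (hq : h ⬝ᵥ q ≠ 0) (w : Fin 3 → F) :
    ∃ (s : F) (m : Fin 3 → F), h ⬝ᵥ m = 0 ∧ w = s • q + m := by
  refine ⟨h ⬝ᵥ w / (h ⬝ᵥ q), w - (h ⬝ᵥ w / (h ⬝ᵥ q)) • q, ?_, by module⟩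
  rw [dotProduct_sub, dotProduct_smul, smul_eq_mul]
  field_simp
  ring

theorem homology_involutive (hq : h ⬝ᵥ q ≠ 0) : Function.Involutive (homology h q) := by
  intro w
  obtain ⟨s, m, hm, rfl⟩ := exists_homology_decomposition hq w
  have e : m - s • q = (-s) • q + m := by module
  rw [homology_combination hq hm, e, homology_combination hq hm]
  module

theorem cross_ne_zero_of_dot (hq : h ⬝ᵥ q ≠ 0) {m : Fin 3 → F} (hm : h ⬝ᵥ m = 0) (hm0 : m ≠ 0) :
    q ⨯₃ m ≠ 0 := by
  intro e
  have hq0 : q ≠ 0 := by rintro rfl; simp at hq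
  obtain ⟨c, rfl⟩ := (cross_eq_zero_iff hq0).mp e
  simp [hq] at hm
  simp [hm] at hm0

end Homology

namespace PlaneChart

variable {P : Type*} [ProjectiveSpace P] {E : Set P} {F : Type*} [Field F] {φ : PlaneChart E F}

/-- The permutation `f` of the plane is given by the linear map `L` in coordinates. -/
def Induces (φ : PlaneChart E F) (L : (Fin 3 → F) ≃ₗ[F] (Fin 3 → F)) (f : Equiv.Perm E) : Prop :=
  ∀ (X : E) (w : Fin 3 → F), w ≠ 0 → (X : P) = φ.pt w → (f X : P) = φ.pt (L w)

theorem exists_induces (φ : PlaneChart E F) (L : (Fin 3 → F) ≃ₗ[F] (Fin 3 → F)) :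
    ∃ f : Equiv.Perm E, φ.Induces L f := by
  choose c hc hpt using fun X : E => φ.exists_pt X.2
  have hL : ∀ {w}, w ≠ 0 → L w ≠ 0 := fun h => by simpa using h
  have key : ∀ {v w : Fin 3 → F}, v ≠ 0 → w ≠ 0 →
      (φ.pt (L v) = φ.pt (L w) ↔ φ.pt v = φ.pt w) := fun {v w} hv hw => by
    rw [φ.pt_eq_iff hv hw, φ.pt_eq_iff (hL hv) (hL hw)]
    exact exists_congr fun a => by rw [← map_smul, L.injective.eq_iff]
  have hbij : Function.Bijective fun X : E => (⟨φ.pt (L (c X)), φ.pt_mem (hL (hc X))⟩ : E) := by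
    refine ⟨fun X Y h => Subtype.ext ?_, fun Y => ?_⟩
    · rw [← hpt X, ← hpt Y]
      exact (key (hc X) (hc Y)).mp (congrArg Subtype.val h)
    · have hw : L.symm (c Y) ≠ 0 := by simpa using hc Y
      refine ⟨⟨φ.pt (L.symm (c Y)), φ.pt_mem hw⟩, Subtype.ext ?_⟩
      have := (key (hc ⟨φ.pt (L.symm (c Y)), φ.pt_mem hw⟩) hw).mpr (hpt _)
      rw [L.apply_symm_apply] at this
      exact this.trans (hpt Y)
  exact ⟨Equiv.ofBijective _ hbij, fun X w hw h => (key (hc X) hw).mpr ((hpt X).trans h)⟩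

theorem Induces.unique {L : (Fin 3 → F) ≃ₗ[F] (Fin 3 → F)} {f g : Equiv.Perm E}
    (hf : φ.Induces L f) (hg : φ.Induces L g) : f = g := by
  ext X
  obtain ⟨w, hw, hX⟩ := φ.exists_pt X.2
  rw [hf X w hw hX.symm, hg X w hw hX.symm]

theorem Induces.mul {L M : (Fin 3 → F) ≃ₗ[F] (Fin 3 → F)} {f g : Equiv.Perm E}
    (hf : φ.Induces L f) (hg : φ.Induces M g) : φ.Induces (M.trans L) (f * g) :=
  fun X w hw hX => hf _ _ (by simpa using hw) (hg X w hw hX)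

theorem Induces.inv {L : (Fin 3 → F) ≃ₗ[F] (Fin 3 → F)} {f : Equiv.Perm E}
    (hf : φ.Induces L f) : φ.Induces L.symm f⁻¹ := by
  obtain ⟨g, hg⟩ := φ.exists_induces L.symm
  have h1 : φ.Induces (LinearEquiv.refl F _) 1 := fun X w hw hX => hX
  have h2 : φ.Induces (LinearEquiv.refl F _) (f * g) := by
    have := hf.mul hg
    rwa [LinearEquiv.symm_trans_self] at this
  rwa [inv_eq_of_mul_eq_one_right (h2.unique h1)]

/-- Harmonic reflections of a plane are linear in coordinates. -/
theorem isPlaneReflection_iff {h q : Fin 3 → F} (hq : h ⬝ᵥ q ≠ 0) (f : Equiv.Perm E) :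
    IsPlaneReflection E (φ.pt q) (φ.lineOf h) f ↔
      φ.Induces (LinearEquiv.ofInvolutive _ (homology_involutive hq)) f := by
  have hq0 : q ≠ 0 := by rintro rfl; simp at hq
  have hh0 : h ≠ 0 := by rintro rfl; simp at hq
  have hself : ∀ {s : F}, s ≠ 0 → φ.pt (homology h q (s • q)) = φ.pt q := fun {s} hs => by
    have := homology_combination hq (m := 0) (by simp) s
    rw [add_zero, zero_sub, ← neg_smul] at this
    rw [this, φ.pt_smul (neg_ne_zero.mpr hs) hq0]
  have hrefl : ∀ {s : F} {m : Fin 3 → F}, h ⬝ᵥ m = 0 → m ≠ 0 → ∀ Y,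
      ReflectsTo (φ.pt q) (φ.pt m) (φ.pt (s • q + m)) Y ↔ Y = φ.pt (homology h q (s • q + m)) := by
    intro s m hm hm0 Y
    have hqm := cross_ne_zero_of_dot hq hm hm0
    have := reflectsTo_iff (φ := φ) hqm (x := s) (y := 1) (by simp) Y
    rw [one_smul] at this
    have hne : s • q - m ≠ 0 := by
      have := combination_ne_zero hqm (x := s) (y := -1) (by simp)
      rwa [neg_smul, one_smul, ← sub_eq_add_neg] at this
    have e : m - s • q = (-1 : F) • (s • q - m) := by module
    rw [this, homology_combination hq hm, e, φ.pt_smul (by simp) hne]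
  -- The component `m` of `s • q + m` in the kernel of `h` is the point where the line to the centre
  -- meets the mirror.
  have hjoin : ∀ {s : F} {m : Fin 3 → F}, h ⬝ᵥ m = 0 → m ≠ 0 → ∀ M,
      M ∈ join (φ.pt (s • q + m)) (φ.pt q) ∩ φ.lineOf h ↔ M = φ.pt m := by
    intro s m hm hm0 M
    have hqm := cross_ne_zero_of_dot hq hm hm0
    have e : (s • q + m) ⨯₃ q = -(q ⨯₃ m) := by
      rw [cross_anticomm, map_add, LinearMap.add_apply, map_smul, LinearMap.smul_apply, cross_self,
        smul_zero, zero_add]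
    have hne : (s • q + m) ⨯₃ q ≠ 0 := by rw [e]; exact neg_ne_zero.mpr hqm
    have e2 : ((s • q + m) ⨯₃ q) ⨯₃ h = (h ⬝ᵥ m) • q + (-(h ⬝ᵥ q)) • m := by
      rw [e]
      simp only [cross_apply, vec3_dotProduct]
      funext i
      fin_cases i <;> simp <;> ring
    rw [hm, zero_smul, zero_add] at e2
    have hq' := neg_ne_zero.mpr hq
    rw [join_pt hne, Set.mem_inter_iff, lineOf_inter (by rw [e2]; exact smul_ne_zero hq' hm0), e2,
      φ.pt_smul hq' hm0]
  constructor
  · rintro ⟨-, -, -, -, hf⟩ X w hw hX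
    obtain ⟨s, m, hm, rfl⟩ := exists_homology_decomposition hq w
    change _ = φ.pt (homology h q _)
    by_cases hm0 : m = 0
    · subst hm0
      have hs : s ≠ 0 := by rintro rfl; simp at hw
      rw [add_zero] at hX ⊢
      rw [hself hs]
      exact (hf X).1 (by rw [hX, φ.pt_smul hs hq0])
    · have hqm := cross_ne_zero_of_dot hq hm hm0
      have hXq : (X : P) ≠ φ.pt q := by
        rw [hX, Ne, φ.pt_eq_iff_cross hw hq0, ← neg_eq_zero, cross_anticomm]
        simpa using hqm
      obtain ⟨M, hM, hr⟩ := (hf X).2 hXq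
      rw [hX, hjoin hm hm0] at hM
      rwa [hM, hX, hrefl hm hm0] at hr
  · intro hf
    refine ⟨φ.pt_mem hq0, isLine_lineOf hh0, lineOf_subset _, by rwa [pt_mem_lineOf hq0],
      fun X => ⟨fun hX => ?_, fun hX => ?_⟩⟩
    · have := hf X _ hq0 hX
      rw [this]
      have := hself one_ne_zero
      rwa [one_smul] at this
    · obtain ⟨w, hw, hXw⟩ := φ.exists_pt X.2
      obtain ⟨s, m, hm, rfl⟩ := exists_homology_decomposition hq w
      have hm0 : m ≠ 0 := by
        rintro rfl
        have hs : s ≠ 0 := by rintro rfl; simp at hw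
        rw [add_zero, φ.pt_smul hs hq0] at hXw
        exact hX hXw.symm
      refine ⟨φ.pt m, ?_, ?_⟩
      · rw [← hXw, hjoin hm hm0]
      · rw [hf X _ hw hXw.symm, ← hXw, hrefl hm hm0]
        rfl

end PlaneChart

section Secants

variable {F : Type*} [Field F] {u v : F × F}

/-- The coefficients of the secant line of the standard conic through two of its points. -/
def conicSecant (u v : F × F) : Fin 3 → F := ![u.2 * v.2, -(u.1 * v.2 + u.2 * v.1), u.1 * v.1]

/-- The pole of the secant line of the standard conic through two of its points. -/
def conicPole (u v : F × F) : Fin 3 → F := ![2 * u.1 * v.1, u.1 * v.2 + u.2 * v.1, 2 * u.2 * v.2]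

theorem secant_dot_pole (u v : F × F) :
    conicSecant u v ⬝ᵥ conicPole u v = -(u.1 * v.2 - u.2 * v.1) ^ 2 := by
  simp only [vec3_dotProduct, conicSecant, conicPole, cons_val]; ring

theorem secant_dot_pole_ne_zero (h : u.2 * v.1 ≠ u.1 * v.2) :
    conicSecant u v ⬝ᵥ conicPole u v ≠ 0 := by
  rw [secant_dot_pole]
  exact neg_ne_zero.mpr (pow_ne_zero 2 (sub_ne_zero.mpr h.symm))

theorem secant_dot_conic (u v : F × F) :
    conicSecant u v ⬝ᵥ conic u = 0 ∧ conicSecant u v ⬝ᵥ conic v = 0 := by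
  simp only [vec3_dotProduct, conicSecant, conic, cons_val]
  constructor <;> ring

theorem tangent_cross_tangent (u v : F × F) :
    conicTangent u ⨯₃ conicTangent v = (u.1 * v.2 - u.2 * v.1) • conicPole u v := by
  simp only [cross_apply, conicTangent, conicPole]
  funext i
  fin_cases i <;> simp <;> ring

/-- Linearity of the pole in its second parameter is what makes it a coordinate on the tangent at
`u`. -/
theorem conicPole_combination (u v : F × F) :
    v.1 • conicPole u (1, 0) + v.2 • conicPole u (0, 1) = conicPole u v := by
  funext i
  fin_cases i <;> simp [conicPole] <;> ring

theorem conicPole_cross (u : F × F) :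
    conicPole u (1, 0) ⨯₃ conicPole u (0, 1) = (2 : F) • conicTangent u := by
  simp only [cross_apply, conicTangent, conicPole]
  funext i
  fin_cases i <;> simp <;> ring

theorem conicPole_ne_zero (h2 : (2 : F) ≠ 0) (hu : u ≠ 0) (hv : v ≠ 0) : conicPole u v ≠ 0 := by
  rw [← conicPole_combination]
  refine PlaneChart.combination_ne_zero ?_ ?_
  · rw [conicPole_cross]
    exact smul_ne_zero h2 (conicTangent_ne_zero hu)
  · by_contra! h
    exact hv (Prod.ext h.1 h.2)

theorem tangent_dot_pole (u v : F × F) : conicTangent v ⬝ᵥ conicPole u v = 0 := by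
  simp only [vec3_dotProduct, conicTangent, conicPole, cons_val]; ring

/-- Expanding `conic (α • u + β • v)` gives a part on the secant plus `αβ` times the pole; negating
the latter amounts to replacing `β` by `-β`. -/
theorem homology_conic (h : u.2 * v.1 ≠ u.1 * v.2) (α β : F) :
    homology (conicSecant u v) (conicPole u v) (conic (α • u + β • v)) = conic (α • u - β • v) := by
  have e : conic (α • u + β • v) =
      (α * β) • conicPole u v + (α ^ 2 • conic u + β ^ 2 • conic v) := by
    funext i
    fin_cases i <;> simp [conic, conicPole] <;> ring
  rw [e, homology_combination (secant_dot_pole_ne_zero h)]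
  · funext i
    fin_cases i <;> simp [conic, conicPole] <;> ring
  · simp [dotProduct_add, secant_dot_conic]

end Secants

namespace ConicChart

variable {P : Type*} [ProjectiveSpace P] {E K : Set P} {F : Type*} [Field F]

/-- The rational parametrization of a harmonic curve. -/
def parametrization (φ : ConicChart E K F) : Parametrization K F where
  pt x := φ.pt (conic x)
  pt_mem hx := (φ.mem_iff _).mpr ⟨_, hx, rfl⟩
  exists_pt hX := (φ.mem_iff _).mp hX
  pt_eq_iff := PlaneChart.pt_conic_eq_iff

theorem isSecantPole_iff (φ : ConicChart E K F) {u v : F × F} (hu : u ≠ 0) (hv : v ≠ 0)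
    (h : u.2 * v.1 ≠ u.1 * v.2) (Q : P) :
    IsSecantPole K (φ.pt (conic u)) (φ.pt (conic v)) Q ↔ Q = φ.pt (conicPole u v) := by
  have hd : u.1 * v.2 - u.2 * v.1 ≠ 0 := sub_ne_zero.mpr h.symm
  have hp : conicPole u v ≠ 0 := conicPole_ne_zero φ.two_ne_zero hu hv
  have hc : conicTangent u ⨯₃ conicTangent v ≠ 0 := by
    rw [tangent_cross_tangent]
    exact smul_ne_zero hd hp
  have e : φ.pt (conicTangent u ⨯₃ conicTangent v) = φ.pt (conicPole u v) := by
    rw [tangent_cross_tangent, φ.pt_smul hd hp]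
  rw [← e, ← PlaneChart.lineOf_inter hc]
  constructor
  · rintro ⟨-, a, b, ha, hb, hQ⟩
    rw [φ.isTangentLine_iff hu] at ha
    rw [φ.isTangentLine_iff hv] at hb
    subst ha hb
    exact hQ
  · intro hQ
    exact ⟨fun e => h ((PlaneChart.pt_conic_eq_iff hu hv).mp e), _, _,
      (φ.isTangentLine_iff hu _).mpr rfl, (φ.isTangentLine_iff hv _).mpr rfl, hQ⟩

theorem isHyperbolicReflection_iff (φ : ConicChart E K F) {u v : F × F} (hu : u ≠ 0) (hv : v ≠ 0)
    (h : u.2 * v.1 ≠ u.1 * v.2) (f : Equiv.Perm E) :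
    IsHyperbolicReflection E K (φ.pt (conic u)) (φ.pt (conic v)) f ↔ φ.Induces
      (LinearEquiv.ofInvolutive _ (homology_involutive (secant_dot_pole_ne_zero h))) f := by
  have hs : conicSecant u v ≠ 0 := fun e => secant_dot_pole_ne_zero h (by simp [e])
  have hj : join (φ.pt (conic u)) (φ.pt (conic v)) = φ.lineOf (conicSecant u v) :=
    PlaneChart.join_eq_lineOf hs (by simp [conic_cross_eq_zero_iff, hu, hv, h])
      (secant_dot_conic u v).1 (secant_dot_conic u v).2
  rw [← PlaneChart.isPlaneReflection_iff (secant_dot_pole_ne_zero h), ← hj]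
  unfold IsHyperbolicReflection
  simp [φ.isSecantPole_iff hu hv h]

theorem exists_parameters (φ : ConicChart E K F) {U V : P} (hU : U ∈ K) (hV : V ∈ K)
    (hUV : U ≠ V) :
    ∃ u v : F × F, u ≠ 0 ∧ v ≠ 0 ∧ u.2 * v.1 ≠ u.1 * v.2 ∧ U = φ.pt (conic u) ∧
      V = φ.pt (conic v) := by
  obtain ⟨u, hu, rfl⟩ := (φ.mem_iff U).mp hU
  obtain ⟨v, hv, rfl⟩ := (φ.mem_iff V).mp hV
  exact ⟨u, v, hu, hv, fun e => hUV ((PlaneChart.pt_conic_eq_iff hu hv).mpr e), rfl, rfl⟩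

theorem existsUnique_isHyperbolicReflection (φ : ConicChart E K F) {U V : P} (hU : U ∈ K) (hV : V ∈ K)
    (hUV : U ≠ V) :
    ∃! f : Equiv.Perm E, IsHyperbolicReflection E K U V f := by
  obtain ⟨u, v, hu, hv, h, rfl, rfl⟩ := φ.exists_parameters hU hV hUV
  simp only [φ.isHyperbolicReflection_iff hu hv h]
  obtain ⟨f, hf⟩ := φ.exists_induces
    (LinearEquiv.ofInvolutive _ (homology_involutive (secant_dot_pole_ne_zero h)))
  exact ⟨f, hf, fun g hg => hg.unique hf⟩

theorem existsUnique_isTangentLine (φ : ConicChart E K F) {T : P} (hT : T ∈ K) :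
    ∃! t : Set P, IsTangentLine K T t := by
  obtain ⟨x, hx, rfl⟩ := (φ.mem_iff T).mp hT
  simp only [φ.isTangentLine_iff hx, existsUnique_eq]

theorem reflection_apply (φ : ConicChart E K F) {u v : F × F} (hu : u ≠ 0) (hv : v ≠ 0)
    (h : u.2 * v.1 ≠ u.1 * v.2)
    {f : Equiv.Perm E} (hf : IsHyperbolicReflection E K (φ.pt (conic u)) (φ.pt (conic v)) f)
    {X : E} {α β : F} (hne : α • u + β • v ≠ 0) (hX : (X : P) = φ.pt (conic (α • u + β • v))) :
    (f X : P) = φ.pt (conic (α • u - β • v)) := by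
  have := (φ.isHyperbolicReflection_iff hu hv h f).mp hf X _ (conic_ne_zero hne) hX
  rw [this, ← homology_conic h]
  rfl

/-- The elements of the hyperbolic group are linear in coordinates and preserve the curve. -/
theorem hyperbolicGroup_induces (φ : ConicChart E K F) {g : Equiv.Perm E}
    (hg : g ∈ hyperbolicGroup E K) :
    (∃ L, φ.Induces L g) ∧ ∀ X : E, (X : P) ∈ K ↔ (g X : P) ∈ K := by
  induction hg using Subgroup.closure_induction with
  | mem f hf =>
    obtain ⟨U, hU, V, hV, hUV, hf⟩ := hf
    obtain ⟨u, v, hu, hv, h, rfl, rfl⟩ := φ.exists_parameters hU hV hUV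
    have hind := (φ.isHyperbolicReflection_iff hu hv h f).mp hf
    have hmem : ∀ X : E, (X : P) ∈ K → (f X : P) ∈ K := fun X hX => by
      obtain ⟨x, hx, hX⟩ := (φ.mem_iff _).mp hX
      obtain ⟨α, β, rfl⟩ := exists_pair_coordinates h x
      rw [φ.reflection_apply hu hv h hf hx hX]
      exact (φ.mem_iff _).mpr ⟨_, pair_sub_ne_zero h hx, rfl⟩
    -- Because `f` is an involution, mapping the curve into itself already gives both implications.
    have hinv : ∀ X, f (f X) = X := fun X => Subtype.ext <| by
      obtain ⟨w, hw, hX⟩ := φ.exists_pt X.2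
      have e := hind.mul hind X w hw hX.symm
      rw [Equiv.Perm.mul_apply] at e
      rw [e, ← hX]
      exact congrArg φ.pt (homology_involutive (secant_dot_pole_ne_zero h) w)
    exact ⟨⟨_, hind⟩, fun X => ⟨hmem X, fun hX => by simpa [hinv] using hmem _ hX⟩⟩
  | one => exact ⟨⟨LinearEquiv.refl F _, fun X w hw hX => hX⟩, fun X => Iff.rfl⟩
  | mul f g _ _ hf hg =>
    obtain ⟨⟨L, hL⟩, hf⟩ := hf
    obtain ⟨⟨M, hM⟩, hg⟩ := hg
    exact ⟨⟨_, hL.mul hM⟩, fun X => (hg X).trans (hf _)⟩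
  | inv f _ hf =>
    obtain ⟨⟨L, hL⟩, hf⟩ := hf
    exact ⟨⟨_, hL.inv⟩, fun X => by simpa using (hf (f⁻¹ X)).symm⟩

/-- A linear permutation of the plane that fixes the points of the curve is the identity. -/
theorem eq_one_of_fixes (φ : ConicChart E K F) {L : (Fin 3 → F) ≃ₗ[F] (Fin 3 → F)}
    {g : Equiv.Perm E} (hL : φ.Induces L g) (hg : ∀ X : E, (X : P) ∈ K → g X = X) : g = 1 := by
  have key : ∀ x : F × F, x ≠ 0 → ∃ c : F, L (conic x) = c • conic x := fun x hx => by
    have hx' := conic_ne_zero hx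
    have hfix := hg ⟨φ.pt (conic x), φ.pt_mem hx'⟩ ((φ.mem_iff _).mpr ⟨x, hx, rfl⟩)
    have := hL ⟨φ.pt (conic x), φ.pt_mem hx'⟩ _ hx' rfl
    rw [hfix] at this
    exact (φ.pt_eq_iff hx' (by simpa using hx')).mp this
  obtain ⟨a, ha⟩ := key (1, 0) (by simp)
  obtain ⟨c, hc⟩ := key (0, 1) (by simp)
  obtain ⟨b, hb⟩ := key (1, 1) (by simp)
  obtain ⟨d, hd⟩ := key (1, -1) (by simp)
  -- Four points in general position are fixed; the linear relation between their vectors forces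
  -- equal eigenvalues.
  have hsum : (conic (1, 1) : Fin 3 → F) + conic (1, -1) =
      (2 : F) • (conic (1, 0) + conic (0, 1)) := by
    funext i
    fin_cases i <;> simp [conic] <;> ring
  have hL2 := congrArg L hsum
  rw [map_add, map_smul, map_add, ha, hb, hc, hd] at hL2
  have e0 := congrFun hL2 0
  have e1 := congrFun hL2 1
  have e2 := congrFun hL2 2
  simp [conic] at e0 e1 e2
  have h2 := φ.two_ne_zero
  have hba : b = a := mul_left_cancel₀ h2 (by linear_combination e0 + e1)
  have hca : c = a := mul_left_cancel₀ h2 (by linear_combination e0 - e2)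
  have hscalar : ∀ w, L w = a • w := fun w => by
    have hw : w = (w 0 - w 1) • conic (1, 0) + (w 2 - w 1) • conic (0, 1) +
        w 1 • conic (1, 1) := by
      funext i
      fin_cases i <;> simp [conic]
    rw [hw]
    simp only [map_add, map_smul, ha, hb, hc, hba, hca]
    module
  ext X
  obtain ⟨w, hw, hX⟩ := φ.exists_pt X.2
  have ha0 : a ≠ 0 := by
    rintro rfl
    exact hw (L.injective (by rw [hscalar, zero_smul, map_zero]))
  rw [hL X w hw hX.symm, hscalar, φ.pt_smul ha0 hw, hX]
  rfl

end ConicChart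

end HarmonicGeometry
-- The tangential map and the isomorphism.
namespace HarmonicGeometry

open PointLineGeometry Matrix

namespace ConicChart

variable {P : Type*} [ProjectiveSpace P] {E K : Set P} {F : Type*} [Field F]

/-- The action of the hyperbolic group on the curve. -/
theorem exists_restriction (φ : ConicChart E K F) :
    ∃ r : hyperbolicGroup E K →* Equiv.Perm K,
      (∀ (g : hyperbolicGroup E K) (X : E) (hX : (X : P) ∈ K),
        (r g ⟨X, hX⟩ : P) = ((g : Equiv.Perm E) X : P)) ∧ Function.Injective r := by
  have hKE : ∀ {X}, X ∈ K → X ∈ E := fun hX => by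
    obtain ⟨x, hx, rfl⟩ := (φ.mem_iff _).mp hX
    exact φ.pt_mem (conic_ne_zero hx)
  let r₀ : hyperbolicGroup E K →* Equiv.Perm {X : E // (X : P) ∈ K} :=
    { toFun := fun g => (g : Equiv.Perm E).subtypePerm
        fun X => ((φ.hyperbolicGroup_induces g.2).2 X).symm
      map_one' := by ext; rfl
      map_mul' := fun f g => by ext; rfl }
  let r : hyperbolicGroup E K →* Equiv.Perm K :=
    (Equiv.subtypeSubtypeEquivSubtype hKE).permCongrHom.toMonoidHom.comp r₀
  have hr : ∀ (g : hyperbolicGroup E K) (X : E) (hX : (X : P) ∈ K),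
      (r g ⟨X, hX⟩ : P) = ((g : Equiv.Perm E) X : P) := fun g X hX => rfl
  refine ⟨r, hr, (injective_iff_map_eq_one r).mpr fun g hg => Subtype.ext ?_⟩
  obtain ⟨L, hL⟩ := (φ.hyperbolicGroup_induces g.2).1
  refine φ.eq_one_of_fixes hL fun X hX => Subtype.ext ?_
  rw [← hr g X hX, hg]
  rfl

theorem isReflection_of_isHyperbolicReflection (φ : ConicChart E K F) {u v : F × F} (hu : u ≠ 0)
    (hv : v ≠ 0) (h : u.2 * v.1 ≠ u.1 * v.2) {f : Equiv.Perm E}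
    (hf : IsHyperbolicReflection E K (φ.pt (conic u)) (φ.pt (conic v)) f) {f' : Equiv.Perm K}
    (hf' : ∀ (X : E) (hX : (X : P) ∈ K), (f' ⟨X, hX⟩ : P) = (f X : P)) :
    φ.parametrization.IsReflection u v f' := by
  intro X α β hne hX
  have := hf' ⟨X, by rw [hX]; exact φ.pt_mem (conic_ne_zero hne)⟩ X.2
  rw [this]
  exact φ.reflection_apply hu hv h hf hne hX

/-- Coordinates on a tangent line in which the tangential map is the identity. -/
def tangentChart (φ : ConicChart E K F) {x : F × F} (hx : x ≠ 0) :
    LineChart (φ.lineOf (conicTangent x)) F :=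
  φ.lineChart (a := conicPole x (1, 0)) (b := conicPole x (0, 1))
    (by rw [conicPole_cross]; exact smul_ne_zero φ.two_ne_zero (conicTangent_ne_zero hx))
    (by rw [conicPole_cross, PlaneChart.lineOf_smul φ.two_ne_zero])

theorem tangentChart_pt (φ : ConicChart E K F) {x : F × F} (hx : x ≠ 0) (y : F × F) :
    (φ.tangentChart hx).pt y = φ.pt (conicPole x y) :=
  congrArg φ.pt (conicPole_combination x y)

/-- The point with coordinate `y` on the tangent at `x` is the pole of `x` and `y`, which lies on
the tangent at `y`. For `y = x` it is twice the vector of the point of contact. -/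
theorem isTangentialMap (φ : ConicChart E K F) {x : F × F} (hx : x ≠ 0)
    {τ : K ≃ φ.lineOf (conicTangent x)}
    (hτ : ∀ y, y ≠ 0 → ∀ X : K, (X : P) = φ.pt (conic y) ↔ (τ X : P) = (φ.tangentChart hx).pt y) :
    IsTangentialMap K (φ.pt (conic x)) (φ.lineOf (conicTangent x)) τ := by
  intro X
  constructor
  · intro hX
    have e : conicPole x x = (2 : F) • conic x := by
      funext i
      fin_cases i <;> simp [conicPole, conic] <;> ring
    rw [(hτ x hx X).mp hX, tangentChart_pt, e, φ.pt_smul φ.two_ne_zero (conic_ne_zero hx)]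
  · intro _
    obtain ⟨y, hy, hX⟩ := (φ.mem_iff _).mp X.2
    refine ⟨φ.lineOf (conicTangent y), ?_, (τ X).2, ?_⟩
    · rw [hX]
      exact (φ.isTangentLine_iff hy _).mpr rfl
    · have h1 := (hτ y hy X).mp hX
      rw [tangentChart_pt] at h1
      rw [h1, PlaneChart.pt_mem_lineOf (conicPole_ne_zero φ.two_ne_zero hx hy), tangent_dot_pole]

/-- The tangential map carries the hyperbolic group to the harmonic group of a tangent line. -/
theorem exists_tangential_mulEquiv (φ : ConicChart E K F) {T : P} {t : Set P}
    (ht : IsTangentLine K T t) : ∃ τ : K ≃ t, IsTangentialMap K T t τ ∧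
      ∃ Φ : hyperbolicGroup E K ≃* harmonicGroup t,
        (∀ (g : hyperbolicGroup E K) (X : E) (hX : (X : P) ∈ K),
          ∃ hY : ((g : Equiv.Perm E) X : P) ∈ K,
            (Φ g : Equiv.Perm t) (τ ⟨(X : P), hX⟩) = τ ⟨((g : Equiv.Perm E) X : P), hY⟩) ∧
        (∀ (U V : K) (f : hyperbolicGroup E K),
          IsHyperbolicReflection E K (U : P) (V : P) (f : Equiv.Perm E) →
            IsLineReflection t (τ U : P) (τ V : P) (Φ f : Equiv.Perm t)) := by
  obtain ⟨x, hx, rfl⟩ := (φ.mem_iff T).mp ht.1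
  rw [φ.isTangentLine_iff hx] at ht
  subst ht
  obtain ⟨τ, hτ⟩ := φ.parametrization.exists_equiv (φ.tangentChart hx).toParametrization
  obtain ⟨r, hr, hrinj⟩ := φ.exists_restriction
  have hrefl : ∀ {u v : F × F}, u ≠ 0 → v ≠ 0 → u.2 * v.1 ≠ u.1 * v.2 →
      ∀ f : hyperbolicGroup E K,
      IsHyperbolicReflection E K (φ.pt (conic u)) (φ.pt (conic v)) (f : Equiv.Perm E) →
      (φ.tangentChart hx).IsReflection u v (τ.permCongrHom (r f)) := fun hu hv h f hf =>
    (φ.isReflection_of_isHyperbolicReflection hu hv h hf (hr f)).permCongr hτ h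
  obtain ⟨Φ, hΦ⟩ := exists_mulEquiv_of_generators (N := hyperbolicGroup E K)
    (N' := harmonicGroup (φ.lineOf (conicTangent x))) rfl rfl
    (τ.permCongrHom.toMonoidHom.comp r) (τ.permCongrHom.injective.comp hrinj)
    (fun f ⟨U, hU, V, hV, hUV, hf⟩ => by
      obtain ⟨u, v, hu, hv, h, rfl, rfl⟩ := φ.exists_parameters hU hV hUV
      exact ⟨_, _, (φ.tangentChart hx).isLineReflection_iff.mpr
        ⟨u, v, hu, hv, h, rfl, rfl, hrefl hu hv h f hf⟩⟩)
    -- A reflection of the tangent line comes from the hyperbolic reflection with the same pair of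
    -- parameters.
    (fun f ⟨A, B, hf⟩ => by
      obtain ⟨u, v, hu, hv, h, -, -, hf⟩ := (φ.tangentChart hx).isLineReflection_iff.mp hf
      have hU : φ.pt (conic u) ∈ K := (φ.mem_iff _).mpr ⟨u, hu, rfl⟩
      have hV : φ.pt (conic v) ∈ K := (φ.mem_iff _).mpr ⟨v, hv, rfl⟩
      have hUV : φ.pt (conic u) ≠ φ.pt (conic v) := fun e =>
        h ((PlaneChart.pt_conic_eq_iff hu hv).mp e)
      obtain ⟨g, hg, -⟩ := φ.existsUnique_isHyperbolicReflection hU hV hUV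
      have hmem : ∃ U ∈ K, ∃ V ∈ K, U ≠ V ∧ IsHyperbolicReflection E K U V g :=
        ⟨_, hU, _, hV, hUV, hg⟩
      exact ⟨⟨g, Subgroup.subset_closure hmem⟩, hmem, (hrefl hu hv h _ hg).unique h hf⟩)
  refine ⟨τ, φ.isTangentialMap hx hτ, Φ, fun g X hX => ?_, fun U V f hf => ?_⟩
  · refine ⟨((φ.hyperbolicGroup_induces g.2).2 X).mp hX, ?_⟩
    rw [hΦ]
    change τ (r g (τ.symm (τ ⟨X, hX⟩))) = _
    rw [τ.symm_apply_apply]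
    exact congrArg τ (Subtype.ext (hr g X hX))
  · obtain ⟨Q, ⟨hUV, -⟩, -⟩ := id hf
    obtain ⟨u, v, hu, hv, h, eU, eV⟩ := φ.exists_parameters U.2 V.2 hUV
    rw [eU, eV] at hf
    rw [hΦ]
    exact (φ.tangentChart hx).isLineReflection_iff.mpr ⟨u, v, hu, hv, h, (hτ u hu U).mp eU,
      (hτ v hv V).mp eV, hrefl hu hv h f hf⟩

end ConicChart

end HarmonicGeometry
-- The main theorem.
theorem mainTheorem5 {P : Type*} [ProjectiveSpace P] (E K : Set P) (hK : IsHarmonicCurve E K) :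
    (∀ l : Set P, PointLineGeometry.IsLine l →
      Nonempty (hyperbolicGroup E K ≃* harmonicGroup l)) ∧
    (∀ U ∈ K, ∀ V ∈ K, U ≠ V → ∃! f : Equiv.Perm E, IsHyperbolicReflection E K U V f) ∧
    (∀ T ∈ K, ∃! t : Set P, IsTangentLine K T t) ∧
    (∀ (T : P) (t : Set P), IsTangentLine K T t →
      ∃ τ : K ≃ t, IsTangentialMap K T t τ ∧
        ∃ Φ : hyperbolicGroup E K ≃* harmonicGroup t,
          (∀ (g : hyperbolicGroup E K) (X : E) (hX : (X : P) ∈ K),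
            ∃ hY : ((g : Equiv.Perm E) X : P) ∈ K,
              (Φ g : Equiv.Perm t) (τ ⟨(X : P), hX⟩) = τ ⟨((g : Equiv.Perm E) X : P), hY⟩) ∧
          (∀ (U V : K) (f : hyperbolicGroup E K),
            IsHyperbolicReflection E K (U : P) (V : P) (f : Equiv.Perm E) →
              IsLineReflection t (τ U : P) (τ V : P) (Φ f : Equiv.Perm t))) := by
  obtain ⟨F, _, ⟨φ⟩⟩ := exists_conicChart hK
  have htan := fun (T : P) (t : Set P) (ht : IsTangentLine K T t) => φ.exists_tangential_mulEquiv ht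
  refine ⟨fun l hl => ?_, fun U hU V hV hUV => φ.existsUnique_isHyperbolicReflection hU hV hUV,
    fun T hT => φ.existsUnique_isTangentLine hT, htan⟩
  -- Any point of the curve will do: its tangent line is compared with `l`.
  have hx : ((1, 0) : F × F) ≠ 0 := by simp
  obtain ⟨-, -, Φ, -⟩ := htan _ _ ((φ.isTangentLine_iff hx _).mpr rfl)
  obtain ⟨e⟩ := nonempty_harmonicGroup_mulEquiv
    (PlaneChart.isLine_lineOf (φ := φ.toPlaneChart) (conicTangent_ne_zero hx)) hl
  exact ⟨Φ.trans e⟩
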